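/- **Setting.** Let $Z$ be a complex manifold and let $M\subset Z$ be a real-analytic submanifold that is generic, i.e. $T_pM+iT_pM=T_pZ$ for all $p\in M$, with the induced CR-structure given by $H_pM=T_pM\cap iT_pM$ and $Jv=iv$. Fix $a\in M$ and put $n=\dim_{\mathbb C}Z$. Let $\mathrm{Aut}(M,a)$ be the group of germs at $a$ of bianalytic CR-isomorphisms $(M,a)\to(M,a)$. Let $\mathfrak g=\mathfrak{hol}(M,a)$ be the real Lie algebra of germs at $a$ of real-analytic vector fields on $M$ whose local flows consist of CR-maps; it is regarded as a real subalgebra of the complex Lie algebra $\mathfrak{hol}(Z,a)$ of germs of holomorphic vector fields on $Z$. An *involution of $(M,a)$* is a germ $\tau:(M,a)\to(M,a)$ of a real-analytic anti-CR map with $\tau^2=\mathrm{id}$ and $\tau(a)=a$. Let $M^\tau$ be the germ of its fixed point set and let $\mathfrak g^{-\tau}$, $T_a^{-\tau}M$ be the $(-1)$-eigenspaces of $\tau$ on $\mathfrak g$ and $T_aM$. A *tube realization* of $(M,a)$ is a bianalytic CR-isomorphism of germs $\varphi:(M,a)\to(T,c)$, where $T=\mathbb R^r+iB\subset\mathbb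 C^r$ is the tube over a connected real-analytic submanifold $B\subset\mathbb R^r$, for some $r$. Two tube realizations $(M,a)\to(T,c)$ and $(M,a)\to(T',c')$ are *affinely equivalent* if some complex affine isomorphism of the ambient spaces maps the germ $(T,c)$ onto the germ $(T',c')$. Two subsets $\mathfrak v,\mathfrak v'\subset\mathfrak g$ are *conjugate* if $\mathfrak v'=g_*\mathfrak v$ for some $g\in\mathrm{Aut}(M,a)$. For an abelian Lie subalgebra $\mathfrak v\subset\mathfrak g$ consider the following conditions. * (i) $\mathfrak v$ is totally real in $\mathfrak{hol}(Z,a)$, i.e. $\mathfrak v\cap i\mathfrak v=0$. * (i') There is an involution $\tau$ of $(M,a)$ with $\mathfrak v\subset\mathfrak g^{-\tau}$. * (ii) The values at $a$ of the elements of $\mathfrak v+i\mathfrak v\subset\mathfrak{hol}(Z,a)$ form the full tangent space $T_aZ$. **Proposition.** 1. The assignment $\varphi\mapsto\{\varphi^*(v\,\partial/\partial z):v\in\mathbb R^r\}$ induces a bijection from the affine equivalence classes of tube realizations of $(M,a)$ onto the $\mathrm{Aut}(M,a)$-conjugacy classes of abelian Lie subalgebras $\mathfrak v\subset\mathfrak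 g$ satisfying (i') and (ii). Moreover, for every abelian Lie subalgebra $\mathfrak v\subset\mathfrak g$ satisfying (ii), the conditions (i) and (i') are equivalent. 2. Let $\mathfrak v\subset\mathfrak g$ be an abelian Lie subalgebra satisfying (i') and (ii). Then the involution $\tau$ in (i') is uniquely determined by $\mathfrak v$. The germ at $a$ of $M^\tau$ is a real-analytic submanifold with $\dim_aM^\tau=\mathrm{CR}\text{-}\dim M$, and $\dim_{\mathbb R}T_a^{-\tau}M=n$. 3. For $\mathfrak v$ and $\tau$ as in 2 and every $g\in\mathrm{Aut}(M,a)$, the abelian Lie subalgebra $g_*\mathfrak v$ satisfies (i') and (ii), and its unique involution is $g\circ\tau\circ g^{-1}$. -/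

import Mathlib

open Set Filter Topology
open scoped Manifold ContDiff

noncomputable section

namespace CRTube

universe uE uZ uF uM

/-! ### Generically embedded CR-manifolds

`Z` is a complex manifold modelled on `E`, `M` is a real-analytic manifold modelled on `F`, and
`ι : M → Z` is the inclusion map. The tangent space of `Z` at any point is the complex vector space
`E` (in the preferred chart at that point). -/

section CRManifold

variable {E : Type uE} [NormedAddCommGroup E] [NormedSpace ℂ E]
  {Z : Type uZ} [TopologicalSpace Z] [ChartedSpace E Z]
  {F : Type uF} [NormedAddCommGroup F] [NormedSpace ℝ F]
  {M : Type uM} [TopologicalSpace M] [ChartedSpace F M]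

/-- The (real) differential of `ι : M → Z` at `p`, with values in the complex vector space
`T_{ι p} Z = E`. -/
def dEmb (E : Type uE) [NormedAddCommGroup E] [NormedSpace ℂ E] {Z : Type uZ} [TopologicalSpace Z]
    [ChartedSpace E Z] (F : Type uF) [NormedAddCommGroup F] [NormedSpace ℝ F]
    {M : Type uM} [TopologicalSpace M] [ChartedSpace F M] (ι : M → Z) (p : M) :
    TangentSpace 𝓘(ℝ, F) p →L[ℝ] E :=
  mfderiv 𝓘(ℝ, F) 𝓘(ℝ, E) ι p

variable (E Z F M) in
/-- A realization `ι` of `M` as a real-analytic generic submanifold of the complex manifold `Z`: a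
real-analytic embedding with `T_p M + i T_p M = T_p Z` for all `p`. -/
structure GenericEmbedding where
  toFun : M → Z
  analytic : ContMDiff 𝓘(ℝ, F) 𝓘(ℝ, E) ω toFun
  isEmbedding : IsEmbedding toFun
  injective_dEmb : ∀ p, Function.Injective (dEmb E F toFun p)
  generic : ∀ p, Submodule.span ℂ (range (dEmb E F toFun p)) = ⊤

/-- The (real) differential of the inclusion `M → Z` at `p`. -/
def GenericEmbedding.d (ι : GenericEmbedding E Z F M) (p : M) : TangentSpace 𝓘(ℝ, F) p →L[ℝ] E :=
  dEmb E F ι.toFun p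

/-- For tangent vectors `v`, `w` of `M` at `p`: `v` lies in the holomorphic tangent space
`H_p M = T_p M ∩ i T_p M`, and `w = J v`. -/
def IsJ (ι : GenericEmbedding E Z F M) (p : M) (v w : TangentSpace 𝓘(ℝ, F) p) : Prop :=
  ι.d p w = Complex.I • ι.d p v

/-- The holomorphic tangent space `H_p M = T_p M ∩ i T_p M` as a complex subspace of `T_p Z`. -/
def holTangent (ι : GenericEmbedding E Z F M) (p : M) : Submodule ℂ E where
  carrier := {x | x ∈ range (ι.d p) ∧ Complex.I • x ∈ range (ι.d p)}
  zero_mem' := ⟨⟨0, by simp⟩, ⟨0, by simp⟩⟩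
  add_mem' := by
    rintro x y ⟨⟨v, rfl⟩, ⟨v', hv'⟩⟩ ⟨⟨w, rfl⟩, ⟨w', hw'⟩⟩
    exact ⟨⟨v + w, by simp⟩, ⟨v' + w', by simp [hv', hw']⟩⟩
  smul_mem' := by
    rintro c x ⟨⟨v, rfl⟩, ⟨w, hw⟩⟩
    have key : ∀ y : E, c • y = c.re • y + c.im • (Complex.I • y) := by
      intro y
      conv_lhs => rw [← Complex.re_add_im c, add_smul, mul_smul]
      simp only [Complex.coe_smul]
    refine ⟨⟨c.re • v + c.im • w, ?_⟩, ⟨c.re • w - c.im • v, ?_⟩⟩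
    · rw [map_add, map_smul, map_smul, hw, key]
    · rw [map_sub, map_smul, map_smul, hw, key (ι.d p v), smul_add,
        smul_comm Complex.I c.re, smul_comm Complex.I c.im, smul_smul Complex.I Complex.I,
        Complex.I_mul_I, neg_one_smul, smul_neg, sub_eq_add_neg]

/-- The CR-dimension of `M` (at `p`): the complex dimension of `H_p M`. -/
def crDim (ι : GenericEmbedding E Z F M) (p : M) : ℕ := Module.finrank ℂ (holTangent ι p)

/-! ### CR-maps and anti-CR-maps, automorphisms and involutions of the germ `(M, a)` -/

/-- The differential of `f : M → M` at `p` maps `H_p M` complex linearly into `H_{f p} M`. -/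
def IsCRAt (ι : GenericEmbedding E Z F M) (f : M → M) (p : M) : Prop :=
  ∀ v w : TangentSpace 𝓘(ℝ, F) p, IsJ ι p v w →
    IsJ ι (f p) (mfderiv 𝓘(ℝ, F) 𝓘(ℝ, F) f p v) (mfderiv 𝓘(ℝ, F) 𝓘(ℝ, F) f p w)

/-- The differential of `f : M → M` at `p` maps `H_p M` antilinearly into `H_{f p} M`. -/
def IsAntiCRAt (ι : GenericEmbedding E Z F M) (f : M → M) (p : M) : Prop :=
  ∀ v w : TangentSpace 𝓘(ℝ, F) p, IsJ ι p v w →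
    IsJ ι (f p) (mfderiv 𝓘(ℝ, F) 𝓘(ℝ, F) f p v) (-(mfderiv 𝓘(ℝ, F) 𝓘(ℝ, F) f p w))

/-- `f` represents a germ of a real-analytic CR-map `(M, a) → (M, a)`. -/
structure IsCRGerm (ι : GenericEmbedding E Z F M) (a : M) (f : M → M) : Prop where
  map_base : f a = a
  analytic : ContMDiffAt 𝓘(ℝ, F) 𝓘(ℝ, F) ω f a
  cr : ∀ᶠ p in 𝓝 a, IsCRAt ι f p

/-- `g` and `h` represent mutually inverse elements of the stability group `Aut(M, a)`. -/
structure IsAutPair (ι : GenericEmbedding E Z F M) (a : M) (g h : M → M) : Prop where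
  left : IsCRGerm ι a g
  right : IsCRGerm ι a h
  left_inv : ∀ᶠ p in 𝓝 a, h (g p) = p
  right_inv : ∀ᶠ p in 𝓝 a, g (h p) = p

/-- `g` represents an element of the stability group `Aut(M, a)`. -/
def IsAut (ι : GenericEmbedding E Z F M) (a : M) (g : M → M) : Prop := ∃ h, IsAutPair ι a g h

/-- `τ` represents an involution of the CR-manifold germ `(M, a)`. -/
structure IsInvolution (ι : GenericEmbedding E Z F M) (a : M) (τ : M → M) : Prop where
  map_base : τ a = a
  analytic : ContMDiffAt 𝓘(ℝ, F) 𝓘(ℝ, F) ω τ a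
  antiCR : ∀ᶠ p in 𝓝 a, IsAntiCRAt ι τ p
  involutive : ∀ᶠ p in 𝓝 a, τ (τ p) = p

/-- The `-1`-eigenspace of `τ` on `T_a M` (for `τ a = a`, the space `T_{τ a} M` is `T_a M`). -/
def negTangent (F : Type uF) [NormedAddCommGroup F] [NormedSpace ℝ F]
    {M : Type uM} [TopologicalSpace M] [ChartedSpace F M] (a : M) (τ : M → M) : Submodule ℝ F :=
  let A : F →L[ℝ] F := mfderiv 𝓘(ℝ, F) 𝓘(ℝ, F) τ a
  Module.End.eigenspace (A : Module.End ℝ F) (-1)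

/-- Near its point `a`, the subset `S` of the real-analytic manifold `M` is a real-analytic
submanifold of dimension `d`. -/
def IsAnalyticSubmanifoldAt (F : Type uF) [NormedAddCommGroup F] [NormedSpace ℝ F]
    {M : Type uM} [TopologicalSpace M] [ChartedSpace F M] (S : Set M) (d : ℕ) (a : M) : Prop :=
  a ∈ S ∧ ∃ e ∈ IsManifold.maximalAtlas 𝓘(ℝ, F) ω M, a ∈ e.source ∧
    ∃ L : Submodule ℝ F, Module.finrank ℝ L = d ∧ ∀ p ∈ e.source, p ∈ S ↔ e p ∈ L

/-! ### Germs of vector fields and `hol(M, a)` -/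

variable (F) in
/-- The vector fields on `M` that vanish in a neighbourhood of `a`. -/
def nullFields (a : M) : Submodule ℝ (∀ p : M, TangentSpace 𝓘(ℝ, F) p) where
  carrier := {X | ∀ᶠ p in 𝓝 a, X p = 0}
  zero_mem' := Eventually.of_forall fun _ => rfl
  add_mem' := by
    intro X Y hX hY
    filter_upwards [hX, hY] with p h1 h2
    simp [h1, h2]
  smul_mem' := by
    intro c X hX
    filter_upwards [hX] with p h
    simp [h]

variable (F) in
/-- Germs at `a` of (arbitrary) vector fields on `M`. -/
abbrev VFGerm (a : M) : Type (max uF uM) :=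
  (∀ p : M, TangentSpace 𝓘(ℝ, F) p) ⧸ nullFields F a

/-- The germ at `a` of a vector field. -/
abbrev germ (a : M) (X : ∀ p : M, TangentSpace 𝓘(ℝ, F) p) : VFGerm F a :=
  (nullFields F a).mkQ X

section Hol

variable [IsManifold 𝓘(ℝ, F) ω M]

/-- Near `a`, the vector field `X` is a real-analytic infinitesimal CR-transformation: it is
real-analytic and its local flow `Φ` consists of CR-transformations. -/
structure IsInfinitesimalCR (ι : GenericEmbedding E Z F M) (a : M) (X : ∀ p : M, TangentSpace 𝓘(ℝ, F) p) : Prop where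
  analytic : ContMDiffAt 𝓘(ℝ, F) (𝓘(ℝ, F)).tangent ω
    (fun p => (⟨p, X p⟩ : TangentBundle 𝓘(ℝ, F) M)) a
  flow : ∃ (Φ : ℝ → M → M) (U : Set M) (ε : ℝ), IsOpen U ∧ a ∈ U ∧ 0 < ε ∧
    (∀ p ∈ U, Φ 0 p = p) ∧
    (∀ p ∈ U, IsMIntegralCurveOn (I := 𝓘(ℝ, F)) (fun t => Φ t p) X (Ioo (-ε) ε)) ∧
    ContMDiffOn (𝓘(ℝ, ℝ).prod 𝓘(ℝ, F)) 𝓘(ℝ, F) ω (fun q : ℝ × M => Φ q.1 q.2)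
      (Ioo (-ε) ε ×ˢ U) ∧
    ∀ t ∈ Ioo (-ε) ε, ∀ p ∈ U, IsCRAt ι (Φ t) p

/-- `hol(M, a)`: the germs at `a` of real-analytic infinitesimal CR-transformations. -/
def hol (ι : GenericEmbedding E Z F M) (a : M) : Set (VFGerm F a) :=
  {ξ | ∃ X, germ a X = ξ ∧ IsInfinitesimalCR ι a X}

/-- `𝔳` is an abelian Lie subalgebra of `hol(M, a)`: a real linear subspace on which the bracket
vanishes identically. -/
structure IsAbelianSubalgebra (ι : GenericEmbedding E Z F M) (a : M) (𝔳 : Submodule ℝ (VFGerm F a)) : Prop where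
  subset_hol : (𝔳 : Set (VFGerm F a)) ⊆ hol ι a
  abelian : ∀ X Y : (∀ p : M, TangentSpace 𝓘(ℝ, F) p), germ a X ∈ 𝔳 → germ a Y ∈ 𝔳 →
    ∀ᶠ p in 𝓝 a, VectorField.mlieBracket 𝓘(ℝ, F) X Y p = 0

/-- `𝔳` is totally real, `𝔳 ∩ i𝔳 = 0`. Here the multiplication by `i` is that of the complex Lie
algebra `hol(Z, a)` of germs of holomorphic vector fields on `Z`, which contains `hol(M, a)`; as `M`
is generic in `Z`, such germs are determined by their restrictions to `M`, so that `Y = i X` there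
says that `Y p = i X p` in `T_p Z` for all `p` in `M` near `a`. -/
def IsTotallyReal (ι : GenericEmbedding E Z F M) (a : M) (𝔳 : Submodule ℝ (VFGerm F a)) : Prop :=
  ∀ X Y : (∀ p : M, TangentSpace 𝓘(ℝ, F) p), germ a X ∈ 𝔳 → germ a Y ∈ 𝔳 →
    (∀ᶠ p in 𝓝 a, ι.d p (Y p) = Complex.I • ι.d p (X p)) → germ a X = 0

/-- The values at `a` of the fields in `𝔢 = 𝔳 + i𝔳` form the full tangent space `T_a Z`. -/
def SpansTangent (ι : GenericEmbedding E Z F M) (a : M) (𝔳 : Submodule ℝ (VFGerm F a)) : Prop :=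
  Submodule.span ℂ {x : E | ∃ X : (∀ p : M, TangentSpace 𝓘(ℝ, F) p),
    germ a X ∈ 𝔳 ∧ x = ι.d a (X a)} = ⊤

/-- `𝔳` lies in the `-1`-eigenspace of `τ`, i.e. `τ_* X = -X` for all `X` in `𝔳`. -/
def InNegEigenspace (a : M) (τ : M → M) (𝔳 : Submodule ℝ (VFGerm F a)) : Prop :=
  ∀ X : (∀ p : M, TangentSpace 𝓘(ℝ, F) p), germ a X ∈ 𝔳 →
    ∀ᶠ p in 𝓝 a, mfderiv 𝓘(ℝ, F) 𝓘(ℝ, F) τ p (X p) = -X (τ p)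

/-- `τ` is an involution of the germ `(M, a)` with `𝔳 ⊆ hol(M, a)^{-τ}`. -/
def IsInvolutionFor (ι : GenericEmbedding E Z F M) (a : M) (𝔳 : Submodule ℝ (VFGerm F a)) (τ : M → M) : Prop :=
  IsInvolution ι a τ ∧ InNegEigenspace a τ 𝔳

/-- `𝔳` is an abelian Lie subalgebra of `hol(M, a)` such that (i') some involution of `(M, a)` has
`𝔳` in its `-1`-eigenspace, and (ii) `𝔳 + i𝔳` spans `T_a Z`. -/
structure IsTubeSubalgebra (ι : GenericEmbedding E Z F M) (a : M) (𝔳 : Submodule ℝ (VFGerm F a)) : Prop where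
  isAbelianSubalgebra : IsAbelianSubalgebra ι a 𝔳
  exists_involution : ∃ τ, IsInvolutionFor ι a 𝔳 τ
  spans : SpansTangent ι a 𝔳

/-- `𝔳' = g_* 𝔳`, where `Y = g_* X` means that `dg_p (X p) = Y (g p)` for all `p` near `a`. -/
def IsPushforward (a : M) (g : M → M) (𝔳 𝔳' : Submodule ℝ (VFGerm F a)) : Prop :=
  ∀ Y : (∀ p : M, TangentSpace 𝓘(ℝ, F) p), germ a Y ∈ 𝔳' ↔
    ∃ X : (∀ p : M, TangentSpace 𝓘(ℝ, F) p), germ a X ∈ 𝔳 ∧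
      ∀ᶠ p in 𝓝 a, mfderiv 𝓘(ℝ, F) 𝓘(ℝ, F) g p (X p) = Y (g p)

/-- The abelian Lie subalgebras of `hol(M, a)` with (i') and (ii). -/
def TubeSubalgebra (ι : GenericEmbedding E Z F M) (a : M) : Type (max uF uM) :=
  {𝔳 : Submodule ℝ (VFGerm F a) // IsTubeSubalgebra ι a 𝔳}

/-- Conjugacy with respect to `Aut(M, a)`. -/
def TubeSubalgebra.Conjugate {ι : GenericEmbedding E Z F M} {a : M} (𝔳 𝔳' : TubeSubalgebra ι a) : Prop :=
  ∃ g, IsAut ι a g ∧ IsPushforward a g 𝔳.1 𝔳'.1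

end Hol

/-! ### Tube realizations -/

/-- The tube `ℝ^r + iB` in `ℂ^r` over the base `B` in `ℝ^r`. -/
def tube {r : ℕ} (B : Set (Fin r → ℝ)) : Set (Fin r → ℂ) := {z | (fun j => (z j).im) ∈ B}

/-- `φ` represents a CR-isomorphism of germs `(M, a) → (T, φ a)`, for `T` a submanifold of `ℂ^r`:
it is bianalytic onto `T`, and CR in both directions. As `dφ` is an isomorphism of `T_p M` onto
`T_{φ p} T`, the latter says that `w = J v` in `H_p M` exactly if `dφ w = i dφ v`. -/
structure IsCRIsoOnto (ι : GenericEmbedding E Z F M) (a : M) {r : ℕ} (φ : M → Fin r → ℂ) (T : Set (Fin r → ℂ)) :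
    Prop where
  analytic : ContMDiffAt 𝓘(ℝ, F) 𝓘(ℝ, Fin r → ℂ) ω φ a
  mapsTo : ∀ᶠ p in 𝓝 a, φ p ∈ T
  inverse : ∃ ψ : (Fin r → ℂ) → M, ContMDiffAt 𝓘(ℝ, Fin r → ℂ) 𝓘(ℝ, F) ω ψ (φ a) ∧
    (∀ᶠ p in 𝓝 a, ψ (φ p) = p) ∧ ∀ᶠ z in 𝓝[T] (φ a), φ (ψ z) = z
  cr : ∀ᶠ p in 𝓝 a, ∀ v w : TangentSpace 𝓘(ℝ, F) p, 
    IsJ ι p v w ↔ dEmb (Fin r → ℂ) F φ p w = Complex.I • dEmb (Fin r → ℂ) F φ p v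

/-- A tube realization of the germ `(M, a)`: a CR-isomorphism of germs onto a germ of a tube
`ℝ^r + iB` over a connected real-analytic submanifold `B` of `ℝ^r`. -/
structure TubeRealization (ι : GenericEmbedding E Z F M) (a : M) where
  r : ℕ
  base : Set (Fin r → ℝ)
  isConnected_base : IsConnected base
  submanifold_base : ∃ d, ∀ y ∈ base, IsAnalyticSubmanifoldAt (Fin r → ℝ) base d y
  toFun : M → Fin r → ℂ
  isCRIsoOnto : IsCRIsoOnto ι a toFun (tube base)

namespace TubeRealization

variable {ι : GenericEmbedding E Z F M} {a : M}

/-- Two tube realizations are affinely equivalent if some complex affine isomorphism of the ambient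
spaces maps one tube germ onto the other. -/
def AffinelyEquivalent (R R' : TubeRealization ι a) : Prop :=
  ∃ l : (Fin R.r → ℂ) ≃ᵃ[ℂ] (Fin R'.r → ℂ), l (R.toFun a) = R'.toFun a ∧
    ∀ᶠ z in 𝓝 (R.toFun a), z ∈ tube R.base ↔ l z ∈ tube R'.base

/-- The space of germs `φ^*(v ∂/∂z)`, `v ∈ ℝ^r`, for a tube realization `φ`. -/
def translationAlgebra (R : TubeRealization ι a) : Submodule ℝ (VFGerm F a) where
  carrier := {ξ | ∃ X : (∀ p : M, TangentSpace 𝓘(ℝ, F) p), germ a X = ξ ∧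
    ∃ v : Fin R.r → ℝ, ∀ᶠ p in 𝓝 a, dEmb (Fin R.r → ℂ) F R.toFun p (X p) = fun j => (v j : ℂ)}
  zero_mem' := ⟨0, by simp, 0, Eventually.of_forall fun p => by ext j; simp⟩
  add_mem' := by
    rintro _ _ ⟨X, rfl, v, hv⟩ ⟨Y, rfl, w, hw⟩
    refine ⟨X + Y, by simp, v + w, ?_⟩
    filter_upwards [hv, hw] with p h1 h2
    ext j
    simp [h1, h2]
  smul_mem' := by
    rintro c _ ⟨X, rfl, v, hv⟩
    refine ⟨c • X, by simp, c • v, ?_⟩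
    filter_upwards [hv] with p h1
    ext j
    simp [h1]

end TubeRealization

end CRManifold

end CRTube

end

/-! Let `X_1, …, X_n` be commuting infinitesimal CR-automorphisms whose values at `a` form a
complex basis of `T_a Z`, and let `θ` be the `ℂ^n`-valued one-form on `M` with `v = ∑ θ_k(v) X_k`.
To first order the CR-fields extend holomorphically, so commutativity makes `θ` closed. A
primitive `φ` has `dφ(X_k) = e_k`: it is a CR-immersion whose image is tangent to the real
directions `ℝ^n`, hence an open piece of a tube. If `Y` commutes with all `X_k`, then `θ(Y)` is
locally constant; total reality makes the constant real, so that `φ` turns `𝔳` into the algebra of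
all real translations.

In tube coordinates an anti-CR germ reversing the real translations and fixing the base point `z₀`
can only be `x + iy ↦ 2 re z₀ - x + iy`. This gives existence and uniqueness of the involution,
whose fixed points are the level set `re φ = re φ(a)`. Conversely, if `X` and `Y = iX` are both
reversed by an anti-CR map, then `X = 0`. Finally, a CR-isomorphism of tubes carrying translations
to translations has constant complex linear differential, so it is affine; and a complex affine
isomorphism of tubes can be replaced by one with real linear part, which respects translations. -/

noncomputable section

namespace CRTube

section Primitive

variable {F : Type*} [NormedAddCommGroup F] [NormedSpace ℝ F]
  {V : Type*} [NormedAddCommGroup V] [NormedSpace ℝ V]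

/-- The power series `q` such that `u ↦ q.sum u u` is a primitive of the analytic one-form with
power series `p`, as far as radial derivatives are concerned. -/
def primitiveSeries (p : FormalMultilinearSeries ℝ F (F →L[ℝ] V)) :
    FormalMultilinearSeries ℝ F (F →L[ℝ] V) := fun n => ((n : ℝ) + 1)⁻¹ • p n

theorem radius_le_radius_primitiveSeries (p : FormalMultilinearSeries ℝ F (F →L[ℝ] V)) :
    p.radius ≤ (primitiveSeries p).radius := by
  refine FormalMultilinearSeries.radius_le_of_le fun n => ?_
  have hn : ‖((n : ℝ) + 1)⁻¹‖ ≤ 1 := by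
    rw [norm_inv, Real.norm_of_nonneg (by positivity)]
    exact inv_le_one_of_one_le₀ (by simp)
  rw [primitiveSeries, norm_smul]
  exact mul_le_of_le_one_left (norm_nonneg _) hn

theorem fderiv_unshift_primitiveSeries_apply [CompleteSpace V] {θ : F → F →L[ℝ] V}
    {p : FormalMultilinearSeries ℝ F (F →L[ℝ] V)} {x : F} {r : ENNReal}
    (hp : HasFPowerSeriesOnBall θ p x r) {G : F → V} {c : V}
    (hG : HasFPowerSeriesOnBall G ((primitiveSeries p).unshift c) x r) {u : F}
    (hu : u ∈ Metric.eball (0 : F) r) : fderiv ℝ G (x + u) u = θ (x + u) u := by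
  have hGsum := (hG.fderiv.hasSum hu).mapL (ContinuousLinearMap.apply ℝ V u)
  refine hGsum.unique ?_
  convert (hp.hasSum hu).mapL (ContinuousLinearMap.apply ℝ V u) using 2 with n
  swap
  · rfl
  have hn : (n : ℝ) + 1 ≠ 0 := by positivity
  calc ((primitiveSeries p).unshift c).derivSeries n (fun _ => u) u
      = (n + 1) • ((((n : ℝ) + 1)⁻¹ • p n) (Fin.init fun _ => u) : F →L[ℝ] V) u :=
        FormalMultilinearSeries.derivSeries_apply_diag ..
    _ = p n (fun _ => u) u := by
        rw [smul_apply, FunLike.coe_smul, Pi.smul_apply, ← Nat.cast_smul_eq_nsmul ℝ, smul_smul,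
          Nat.cast_add_one, mul_inv_cancel₀ hn, one_smul]
        rfl

theorem exists_analyticAt_fderiv_radial_eq [CompleteSpace V] {θ : F → F →L[ℝ] V} {x : F}
    (hθ : AnalyticAt ℝ θ x) (c : V) :
    ∃ G : F → V, AnalyticAt ℝ G x ∧ G x = c ∧
      ∀ᶠ y in 𝓝 x, fderiv ℝ G y (y - x) = θ y (y - x) := by
  obtain ⟨p, r, hp⟩ := hθ
  have hr : r ≤ (primitiveSeries p).radius := hp.r_le.trans (radius_le_radius_primitiveSeries p)
  have hq : HasFPowerSeriesOnBall (fun y => (primitiveSeries p).sum (y - x))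
      (primitiveSeries p) x r := by
    simpa only [zero_add] using (((primitiveSeries p).hasFPowerSeriesOnBall
      (hp.r_pos.trans_le hr)).comp_sub x).mono hp.r_pos hr
  have hG := hq.unshift (z := c)
  refine ⟨_, hG.analyticAt, by simp, ?_⟩
  filter_upwards [Metric.eball_mem_nhds x hp.r_pos] with y hy
  have hu : y - x ∈ Metric.eball (0 : F) r := by
    simpa [Metric.mem_eball, edist_eq_enorm_sub] using hy
  simpa only [add_sub_cancel] using fderiv_unshift_primitiveSeries_apply hp hG hu

theorem eq_of_fderiv_radial_eq {f g : F → V} {x : F} {ε : ℝ}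
    (hf : ∀ y ∈ Metric.ball x ε, DifferentiableAt ℝ f y)
    (hg : ∀ y ∈ Metric.ball x ε, DifferentiableAt ℝ g y)
    (h : ∀ y ∈ Metric.ball x ε, fderiv ℝ f y (y - x) = fderiv ℝ g y (y - x)) (hx : f x = g x)
    {y : F} (hy : y ∈ Metric.ball x ε) : f y = g y := by
  set ray : ℝ → F := fun t => x + (1 - t) • (y - x) with hray
  have ray_mem : ∀ t ∈ Icc (0 : ℝ) 1, ray t ∈ Metric.ball x ε := fun t ht => by
    rw [mem_ball_iff_norm] at hy ⊢
    rw [hray, add_sub_cancel_left, norm_smul, Real.norm_of_nonneg (by linarith [ht.2])]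
    exact (mul_le_of_le_one_left (norm_nonneg _) (by linarith [ht.1])).trans_lt hy
  have hasDerivAt_ray : ∀ t, HasDerivAt ray (-(y - x)) t := fun t => by
    simpa [hray] using (((hasDerivAt_id t).const_sub 1).smul_const (y - x)).const_add x
  have hasDerivAt_diff : ∀ t ∈ Icc (0 : ℝ) 1, HasDerivAt (fun t => (f - g) (ray t))
      ((fderiv ℝ f (ray t) - fderiv ℝ g (ray t)) (-(y - x))) t := fun t ht =>
    ((hf _ (ray_mem t ht)).hasFDerivAt.sub (hg _ (ray_mem t ht)).hasFDerivAt).comp_hasDerivAt t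
      (hasDerivAt_ray t)
  have deriv_eq_zero : ∀ t ∈ Ico (0 : ℝ) 1,
      (fderiv ℝ f (ray t) - fderiv ℝ g (ray t)) (-(y - x)) = 0 := fun t ht => by
    have hradial := h _ (ray_mem t (Ico_subset_Icc_self ht))
    rw [hray, add_sub_cancel_left, map_smul, map_smul] at hradial
    rw [map_neg, neg_eq_zero, FunLike.coe_sub, Pi.sub_apply, sub_eq_zero]
    exact smul_right_injective V (sub_pos.2 ht.2).ne' hradial
  have hconst := constant_of_has_deriv_right_zero (f := fun t => (f - g) (ray t))
    (fun t ht => (hasDerivAt_diff t ht).continuousAt.continuousWithinAt)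
    (fun t ht => deriv_eq_zero t ht ▸ (hasDerivAt_diff t (Ico_subset_Icc_self ht)).hasDerivWithinAt)
    1 (right_mem_Icc.2 zero_le_one)
  simpa [hray, hx, sub_eq_zero, eq_comm] using hconst

theorem contDiffAt_omega_of_hasFDerivAt [CompleteSpace V] {φ : F → V} {θ : F → F →L[ℝ] V}
    {x : F} (hθ : ContDiffAt ℝ ω θ x) (hφ : ∀ᶠ y in 𝓝 x, HasFDerivAt φ (θ y) y) :
    ContDiffAt ℝ ω φ x := by
  obtain ⟨G, hG, hGx, hGθ⟩ := exists_analyticAt_fderiv_radial_eq hθ.analyticAt (φ x)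
  obtain ⟨ε, hε, hball⟩ := Metric.eventually_nhds_iff_ball.1
    (hφ.and (hGθ.and hG.eventually_analyticAt))
  refine (hG.contDiffAt (n := ω)).congr_of_eventuallyEq ?_
  filter_upwards [Metric.ball_mem_nhds x hε] with y hy
  refine eq_of_fderiv_radial_eq (fun z hz => (hball z hz).1.differentiableAt)
    (fun z hz => (hball z hz).2.2.differentiableAt) (fun z hz => ?_) hGx.symm hy
  rw [(hball z hz).1.fderiv, (hball z hz).2.1]

end Primitive

section LocalConstancy

variable {F : Type*} [NormedAddCommGroup F] [NormedSpace ℝ F]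
  {V : Type*} [NormedAddCommGroup V] [NormedSpace ℝ V]

theorem eventually_eq_of_fderiv_eq_zero {f : F → V} {x : F}
    (h : ∀ᶠ y in 𝓝 x, DifferentiableAt ℝ f y ∧ fderiv ℝ f y = 0) : ∀ᶠ y in 𝓝 x, f y = f x := by
  obtain ⟨ε, hε, hball⟩ := Metric.eventually_nhds_iff_ball.1 h
  filter_upwards [Metric.ball_mem_nhds x hε] with y hy
  exact Metric.isOpen_ball.is_const_of_fderiv_eq_zero (𝕜 := ℝ) (convex_ball x ε).isPreconnected
    (fun z hz => (hball z hz).1.differentiableWithinAt) (fun z hz => (hball z hz).2) hy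
    (Metric.mem_ball_self hε)

theorem eq_of_fderiv_fst_eq_zero {W : Type*} [NormedAddCommGroup W] [NormedSpace ℝ W]
    {f : F × W → V} {O : Set F} (hO : IsOpen O) (hO' : IsPreconnected O) {w : W}
    (h : ∀ p ∈ O, DifferentiableAt ℝ f (p, w) ∧ ∀ u, fderiv ℝ f (p, w) (u, 0) = 0)
    {p q : F} (hp : p ∈ O) (hq : q ∈ O) : f (p, w) = f (q, w) := by
  have hderiv : ∀ p ∈ O, HasFDerivAt (fun p => f (p, w)) (0 : F →L[ℝ] V) p := fun p hp =>
    (HasFDerivAt.comp (g := f) p (h p hp).1.hasFDerivAt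
      (hasFDerivAt_prodMk_left p w)).congr_fderiv (by ext1 u; exact (h p hp).2 u)
  exact hO.is_const_of_fderiv_eq_zero (𝕜 := ℝ) hO'
    (fun p hp => (hderiv p hp).differentiableAt.differentiableWithinAt)
    (fun p hp => (hderiv p hp).fderiv) hp hq

end LocalConstancy

section CRLinear

/-- `Q` is complex linear along `L`: it respects the partially defined complex structure that `L`
induces on its domain, in which `w = J v` means `L w = i L v`. -/
def IsCRLinear {F E V : Type*} [SMul ℂ E] [SMul ℂ V] (L : F → E) (Q : F → V) : Prop :=
  ∀ v w, L w = Complex.I • L v → Q w = Complex.I • Q v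

theorem smul_eq_re_smul_add_I_smul_im_smul {W : Type*} [AddCommGroup W] [Module ℂ W]
    (z : ℂ) (y : W) : z • y = z.re • y + Complex.I • z.im • y := by
  conv_lhs => rw [← Complex.re_add_im z, add_smul, mul_comm, mul_smul]
  simp only [Complex.coe_smul]

theorem IsCRLinear.map_eq_sum {F E V κ 𝓛 𝓠 : Type*} [AddCommGroup F] [Module ℝ F]
    [AddCommGroup E] [Module ℂ E] [AddCommGroup V] [Module ℂ V] [Fintype κ]
    [FunLike 𝓛 F E] [LinearMapClass 𝓛 ℝ F E] [FunLike 𝓠 F V] [LinearMapClass 𝓠 ℝ F V]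
    {L : 𝓛} {Q : 𝓠} (hQ : IsCRLinear L Q) {x : κ → F} {c : κ → ℂ} {u : F}
    (hu : L u = ∑ k, c k • L (x k)) : Q u = ∑ k, c k • Q (x k) := by
  have hJ : L (u - ∑ k, (c k).re • x k) = Complex.I • L (∑ k, (c k).im • x k) := by
    rw [map_sub, hu, map_sum, map_sum, Finset.smul_sum, ← Finset.sum_sub_distrib]
    refine Finset.sum_congr rfl fun k _ => ?_
    rw [map_smul, map_smul, smul_eq_re_smul_add_I_smul_im_smul (c k), add_sub_cancel_left]
  have hQJ := hQ _ _ hJ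
  rw [map_sub, map_sum, map_sum, Finset.smul_sum, sub_eq_iff_eq_add,
    ← Finset.sum_add_distrib] at hQJ
  rw [hQJ]
  refine Finset.sum_congr rfl fun k _ => ?_
  rw [map_smul, map_smul, smul_eq_re_smul_add_I_smul_im_smul (c k), add_comm]

end CRLinear

section FrameMap

variable {E : Type*} [NormedAddCommGroup E] [NormedSpace ℂ E] {κ : Type*} [Fintype κ]

/-- The map `c ↦ ∑ k, c k • f k` attached to a family `f` of vectors. It is bundled as a continuous
linear function of `f`, so that it can be differentiated in `f`. -/
def frameMap : (κ → E) →L[ℝ] (κ → ℂ) →L[ℝ] E :=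
  ∑ k, ((ContinuousLinearMap.compL ℝ (κ → ℂ) ℂ E).flip (ContinuousLinearMap.proj k)) ∘L
    (ContinuousLinearMap.lsmul ℝ ℂ : ℂ →L[ℝ] E →L[ℝ] E).flip ∘L ContinuousLinearMap.proj k

@[simp] theorem frameMap_apply (f : κ → E) (c : κ → ℂ) : frameMap f c = ∑ k, c k • f k := by
  simp [frameMap]

theorem frameMap_I_smul (f : κ → E) (c : κ → ℂ) :
    frameMap f (Complex.I • c) = Complex.I • frameMap f c := by
  simp [Finset.smul_sum, mul_smul]

theorem frameMap_single [DecidableEq κ] (f : κ → E) (k : κ) : frameMap f (Pi.single k 1) = f k := by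
  simp [Pi.single_apply, ite_smul]

theorem isInvertible_frameMap_basis (b : Module.Basis κ ℂ E) : (frameMap b).IsInvertible := by
  refine ⟨(b.equivFun.symm.restrictScalars ℝ).toContinuousLinearEquiv, ?_⟩
  ext1 c
  rw [frameMap_apply]
  exact b.equivFun_symm_apply c

end FrameMap

section FieldsAlongMaps

variable {F : Type*} [NormedAddCommGroup F] [NormedSpace ℝ F]

/-- The image of the vector field `X` under the differential of `j`, as a field along `j`. -/
def along {V : Type*} [NormedAddCommGroup V] [NormedSpace ℝ V] (j : F → V) (X : F → F) (u : F) :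
    V :=
  fderiv ℝ j u (X u)

section Real

variable {V : Type*} [NormedAddCommGroup V] [NormedSpace ℝ V] {j : F → V} {X Y : F → F} {u : F}

theorem contDiffAt_along (hj : ContDiffAt ℝ ω j u) (hX : ContDiffAt ℝ ω X u) :
    ContDiffAt ℝ ω (along j X) u :=
  (hj.fderiv_right (m := ω) le_rfl).clm_apply hX

theorem fderiv_along_apply (hj : ContDiffAt ℝ 2 j u) (hX : DifferentiableAt ℝ X u) (v : F) :
    fderiv ℝ (along j X) u v = fderiv ℝ (fderiv ℝ j) u v (X u) + fderiv ℝ j u (fderiv ℝ X u v) := by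
  have hj' : DifferentiableAt ℝ (fderiv ℝ j) u :=
    (hj.fderiv_right (m := 1) (by norm_num)).differentiableAt one_ne_zero
  have h := (hj'.hasFDerivAt.clm_apply hX.hasFDerivAt).fderiv
  change fderiv ℝ (along j X) u = _ at h
  rw [h, add_comm]
  rfl

theorem fderiv_lieBracket_apply (hj : ContDiffAt ℝ 2 j u) (hX : DifferentiableAt ℝ X u)
    (hY : DifferentiableAt ℝ Y u) :
    fderiv ℝ j u (VectorField.lieBracket ℝ X Y u) =
      fderiv ℝ (along j Y) u (X u) - fderiv ℝ (along j X) u (Y u) := by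
  have hsymm : fderiv ℝ (fderiv ℝ j) u (X u) (Y u) = fderiv ℝ (fderiv ℝ j) u (Y u) (X u) :=
    (hj.isSymmSndFDerivAt (by simp)) _ _
  rw [fderiv_along_apply hj hX, fderiv_along_apply hj hY, VectorField.lieBracket_eq, map_sub, hsymm]
  abel

end Real

variable {E : Type*} [NormedAddCommGroup E] [NormedSpace ℂ E]

/-- Near `x₀`, the vector field `X` is an infinitesimal CR-transformation of the submanifold
parametrized by `j`: its image along `j` is a CR function. -/
structure IsCRField (j : F → E) (X : F → F) (x₀ : F) : Prop where
  contDiffAt : ContDiffAt ℝ ω X x₀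
  cr : ∀ᶠ u in 𝓝 x₀, IsCRLinear (fderiv ℝ j u) (fderiv ℝ (along j X) u)

theorem IsCRField.eventually {j : F → E} {X : F → F} {x₀ : F} (hX : IsCRField j X x₀) :
    ∀ᶠ u in 𝓝 x₀, IsCRField j X u := by
  filter_upwards [hX.contDiffAt.eventually (by simp), hX.cr.eventually_nhds] with u hd hcr
  exact ⟨hd, hcr⟩

variable {κ : Type*} [Fintype κ]

/-- The vector fields `X k` are commuting infinitesimal CR-transformations near `x₀` of the
submanifold parametrized by `j`, and their values at `x₀` form a complex basis of `E`. -/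
structure IsCommutingCRFrame (j : F → E) (X : κ → F → F) (x₀ : F) : Prop where
  contDiffAt_map : ContDiffAt ℝ ω j x₀
  isCRField : ∀ k, IsCRField j (X k) x₀
  lieBracket_eq_zero : ∀ k l, ∀ᶠ u in 𝓝 x₀, VectorField.lieBracket ℝ (X k) (X l) u = 0
  isInvertible : (frameMap fun k => along j (X k) x₀).IsInvertible

/-- The coefficients of the differential of `j` in the frame `X`. -/
def coframe (j : F → E) (X : κ → F → F) (u : F) : F →L[ℝ] κ → ℂ :=
  (frameMap fun k => along j (X k) u).inverse ∘L fderiv ℝ j u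

namespace IsCommutingCRFrame

variable {j : F → E} {X : κ → F → F} {x₀ : F} (hX : IsCommutingCRFrame j X x₀)
include hX

theorem contDiffAt_along (k : κ) : ContDiffAt ℝ ω (along j (X k)) x₀ :=
  CRTube.contDiffAt_along hX.contDiffAt_map (hX.isCRField k).contDiffAt

theorem hasFDerivAt_frameMap : HasFDerivAt (fun u => frameMap fun k => along j (X k) u)
    (frameMap ∘L ContinuousLinearMap.pi fun k => fderiv ℝ (along j (X k)) x₀) x₀ :=
  (frameMap : (κ → E) →L[ℝ] (κ → ℂ) →L[ℝ] E).hasFDerivAt.comp x₀ (hasFDerivAt_pi.2 fun k =>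
    ((hX.contDiffAt_along k).differentiableAt (by simp)).hasFDerivAt)

theorem contDiffAt_frameMap : ContDiffAt ℝ ω (fun u => frameMap fun k => along j (X k) u) x₀ :=
  (frameMap : (κ → E) →L[ℝ] (κ → ℂ) →L[ℝ] E).contDiff.contDiffAt.comp x₀
    (contDiffAt_pi.2 hX.contDiffAt_along)

theorem eventually : ∀ᶠ u in 𝓝 x₀, IsCommutingCRFrame j X u := by
  have hopen : ∀ᶠ T in 𝓝 (frameMap fun k => along j (X k) x₀), T.IsInvertible := by
    obtain ⟨e, he⟩ := hX.isInvertible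
    rw [← he]
    exact ContinuousLinearEquiv.nhds e
  filter_upwards [hX.contDiffAt_map.eventually (by simp),
    eventually_all.2 fun k => (hX.isCRField k).eventually,
    eventually_all.2 fun k => eventually_all.2 fun l => (hX.lieBracket_eq_zero k l).eventually_nhds,
    hX.contDiffAt_frameMap.continuousAt.eventually hopen] with u hj hcr hbracket hinv
  exact ⟨hj, hcr, hbracket, hinv⟩

theorem frameMap_coframe (v : F) :
    frameMap (fun k => along j (X k) x₀) (coframe j X x₀ v) = fderiv ℝ j x₀ v := by
  rw [coframe, ContinuousLinearMap.comp_apply, ← ContinuousLinearMap.comp_apply,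
    hX.isInvertible.self_comp_inverse, ContinuousLinearMap.id_apply]

theorem injective_coframe (hj : Function.Injective (fderiv ℝ j x₀)) :
    Function.Injective (coframe j X x₀) := fun v w h => hj <| by
  rw [← hX.frameMap_coframe, ← hX.frameMap_coframe, h]

theorem coframe_apply_self [DecidableEq κ] (k : κ) :
    coframe j X x₀ (X k x₀) = Pi.single k 1 :=
  hX.isInvertible.injective <| by rw [hX.frameMap_coframe, frameMap_single, along]

theorem coframe_eq_I_smul_iff (v w : F) : coframe j X x₀ w = Complex.I • coframe j X x₀ v ↔
    fderiv ℝ j x₀ w = Complex.I • fderiv ℝ j x₀ v := by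
  rw [← hX.frameMap_coframe w, ← hX.frameMap_coframe v, ← frameMap_I_smul,
    hX.isInvertible.injective.eq_iff]

theorem contDiffAt_coframe : ContDiffAt ℝ ω (coframe j X) x₀ := by
  obtain ⟨e, he⟩ := hX.isInvertible
  have hinverse : ContDiffAt ℝ ω ContinuousLinearMap.inverse
      (frameMap fun k => along j (X k) x₀) := he ▸ contDiffAt_map_inverse e
  exact (hinverse.comp x₀ hX.contDiffAt_frameMap).clm_comp
    (hX.contDiffAt_map.fderiv_right (m := ω) le_rfl)

theorem fderiv_along_eq_sum {Y : F → F} (hY : IsCRField j Y x₀) (v : F) :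
    fderiv ℝ (along j Y) x₀ v =
      ∑ l, coframe j X x₀ v l • fderiv ℝ (along j Y) x₀ (X l x₀) := by
  refine hY.cr.self_of_nhds.map_eq_sum ?_
  rw [← hX.frameMap_coframe v, frameMap_apply]
  rfl

theorem fderiv_along_comm {Y : F → F} (hY : ContDiffAt ℝ ω Y x₀) (k : κ)
    (hcomm : VectorField.lieBracket ℝ (X k) Y x₀ = 0) :
    fderiv ℝ (along j Y) x₀ (X k x₀) = fderiv ℝ (along j (X k)) x₀ (Y x₀) := by
  rw [← sub_eq_zero, ← fderiv_lieBracket_apply (hX.contDiffAt_map.of_le le_top)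
    ((hX.isCRField k).contDiffAt.differentiableAt (by simp)) (hY.differentiableAt (by simp)),
    hcomm, map_zero]

theorem sum_coframe_smul_fderiv_symm (v w : F) :
    ∑ k, coframe j X x₀ w k • fderiv ℝ (along j (X k)) x₀ v =
      ∑ k, coframe j X x₀ v k • fderiv ℝ (along j (X k)) x₀ w := by
  simp only [hX.fderiv_along_eq_sum (hX.isCRField _) v, hX.fderiv_along_eq_sum (hX.isCRField _) w,
    Finset.smul_sum, smul_smul]
  rw [Finset.sum_comm]
  refine Finset.sum_congr rfl fun k _ => Finset.sum_congr rfl fun l _ => ?_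
  rw [hX.fderiv_along_comm (hX.isCRField k).contDiffAt l (hX.lieBracket_eq_zero l k).self_of_nhds,
    mul_comm]

theorem fderiv_coframe_symm (v w : F) :
    fderiv ℝ (coframe j X) x₀ v w = fderiv ℝ (coframe j X) x₀ w v := by
  have hprod : ∀ v w, (∑ k, coframe j X x₀ w k • fderiv ℝ (along j (X k)) x₀ v) +
      frameMap (fun k => along j (X k) x₀) (fderiv ℝ (coframe j X) x₀ v w) =
        fderiv ℝ (fderiv ℝ j) x₀ v w := fun v w => by
    have h := (hX.hasFDerivAt_frameMap.clm_comp
      (hX.contDiffAt_coframe.differentiableAt (by simp)).hasFDerivAt).congr_of_eventuallyEq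
      (f₁ := fderiv ℝ j)
      (hX.eventually.mono fun u hu => ContinuousLinearMap.ext fun v => (hu.frameMap_coframe v).symm)
    rw [h.fderiv]
    simp [add_comm]
  have hsymm : fderiv ℝ (fderiv ℝ j) x₀ v w = fderiv ℝ (fderiv ℝ j) x₀ w v :=
    hX.contDiffAt_map.isSymmSndFDerivAt_of_omega v w
  rw [← hprod, ← hprod, hX.sum_coframe_smul_fderiv_symm, add_right_inj] at hsymm
  exact hX.isInvertible.injective hsymm

theorem exists_hasFDerivAt_coframe :
    ∃ φ : F → κ → ℂ, ContDiffAt ℝ ω φ x₀ ∧ ∀ᶠ u in 𝓝 x₀, HasFDerivAt φ (coframe j X u) u := by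
  obtain ⟨ε, hε, hball⟩ := Metric.eventually_nhds_iff_ball.1 hX.eventually
  obtain ⟨φ, hφ⟩ := (convex_ball x₀ ε).exists_forall_hasFDerivAt_of_fderiv_symmetric
    Metric.isOpen_ball (fun u hu =>
      ((hball u hu).contDiffAt_coframe.differentiableAt (by simp)).differentiableWithinAt)
    (fun u hu => (hball u hu).fderiv_coframe_symm)
  have hφ' : ∀ᶠ u in 𝓝 x₀, HasFDerivAt φ (coframe j X u) u := by
    filter_upwards [Metric.ball_mem_nhds x₀ hε] with u hu using hφ u hu
  exact ⟨φ, contDiffAt_omega_of_hasFDerivAt hX.contDiffAt_coframe hφ', hφ'⟩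

theorem fderiv_coframe_apply_eq_zero {Y : F → F} (hY : IsCRField j Y x₀)
    (hcomm : ∀ k, VectorField.lieBracket ℝ (X k) Y x₀ = 0) :
    fderiv ℝ (fun u => coframe j X u (Y u)) x₀ = 0 := by
  set c : F → κ → ℂ := fun u => coframe j X u (Y u)
  have hcd : DifferentiableAt ℝ c x₀ :=
    (hX.contDiffAt_coframe.clm_apply hY.contDiffAt).differentiableAt (by simp)
  ext1 v
  have hprod : fderiv ℝ (along j Y) x₀ v = (∑ k, c x₀ k • fderiv ℝ (along j (X k)) x₀ v) +
      frameMap (fun k => along j (X k) x₀) (fderiv ℝ c x₀ v) := by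
    have h := (hX.hasFDerivAt_frameMap.clm_apply hcd.hasFDerivAt).congr_of_eventuallyEq
      (f₁ := along j Y) (hX.eventually.mono fun u hu => (hu.frameMap_coframe (Y u)).symm)
    rw [h.fderiv]
    simp [add_comm]
  have hcoeff : fderiv ℝ (along j Y) x₀ v = ∑ k, c x₀ k • fderiv ℝ (along j (X k)) x₀ v := by
    rw [hX.sum_coframe_smul_fderiv_symm, hX.fderiv_along_eq_sum hY]
    simp only [hX.fderiv_along_comm hY.contDiffAt _ (hcomm _)]
  rw [hcoeff, left_eq_add] at hprod
  exact hX.isInvertible.injective (hprod.trans (map_zero _).symm)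

theorem eventually_coframe_eq {Y : F → F} (hY : IsCRField j Y x₀)
    (hcomm : ∀ k, ∀ᶠ u in 𝓝 x₀, VectorField.lieBracket ℝ (X k) Y u = 0) :
    ∀ᶠ u in 𝓝 x₀, coframe j X u (Y u) = coframe j X x₀ (Y x₀) := by
  refine eventually_eq_of_fderiv_eq_zero (f := fun u => coframe j X u (Y u)) ?_
  filter_upwards [hX.eventually, hY.eventually, eventually_all.2 hcomm] with u hXu hYu hcommu
  exact ⟨(hXu.contDiffAt_coframe.clm_apply hYu.contDiffAt).differentiableAt (by simp),
    hXu.fderiv_coframe_apply_eq_zero hYu hcommu⟩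

end IsCommutingCRFrame

end FieldsAlongMaps

section MixedPartials

variable {F : Type*} [NormedAddCommGroup F] [NormedSpace ℝ F]
  {V : Type*} [NormedAddCommGroup V] [NormedSpace ℝ V] {H : ℝ × F → V} {t : ℝ} {u : F}

theorem hasFDerivAt_partial_snd (hH : DifferentiableAt ℝ H (t, u)) :
    HasFDerivAt (fun y => H (t, y)) (fderiv ℝ H (t, u) ∘L ContinuousLinearMap.inr ℝ ℝ F) u :=
  hH.hasFDerivAt.comp u (hasFDerivAt_prodMk_right t u)

theorem hasDerivAt_partial_fst (hH : DifferentiableAt ℝ H (t, u)) :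
    HasDerivAt (fun s => H (s, u)) (fderiv ℝ H (t, u) (1, 0)) t :=
  hH.hasFDerivAt.comp_hasDerivAt t ((hasDerivAt_id t).prodMk (hasDerivAt_const t u))

theorem hasDerivAt_fderiv_partial_snd (hH : ContDiffAt ℝ 2 H (t, u)) (v : F) :
    HasDerivAt (fun s => fderiv ℝ (fun y => H (s, y)) u v)
      (fderiv ℝ (fun y => deriv (fun s => H (s, y)) t) u v) t := by
  have hdiff : ∀ᶠ q in 𝓝 (t, u), DifferentiableAt ℝ H q :=
    (hH.eventually (by simp)).mono fun q hq => hq.differentiableAt two_ne_zero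
  have hdiff' : DifferentiableAt ℝ (fderiv ℝ H) (t, u) :=
    (hH.fderiv_right (m := 1) (by norm_num)).differentiableAt one_ne_zero
  have hfst : (fun y => deriv (fun s => H (s, y)) t) =ᶠ[𝓝 u] fun y => fderiv ℝ H (t, y) (1, 0) :=
    ((Continuous.prodMk_right t).tendsto u).eventually hdiff |>.mono fun y hy =>
      (hasDerivAt_partial_fst hy).deriv
  have hsnd : (fun s => fderiv ℝ (fun y => H (s, y)) u v) =ᶠ[𝓝 t]
      fun s => fderiv ℝ H (s, u) (0, v) :=
    ((Continuous.prodMk_left u).tendsto t).eventually hdiff |>.mono fun s hs => by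
      change fderiv ℝ (fun y => H (s, y)) u v = _
      rw [(hasFDerivAt_partial_snd hs).fderiv]
      simp
  have hmixed : fderiv ℝ (fun y => deriv (fun s => H (s, y)) t) u v =
      fderiv ℝ (fderiv ℝ H) (t, u) (0, v) (1, 0) := by
    rw [hfst.fderiv_eq, ((hasFDerivAt_partial_snd hdiff').clm_apply
      (hasFDerivAt_const ((1 : ℝ), (0 : F)) u)).fderiv]
    simp
  rw [hmixed, (hH.isSymmSndFDerivAt (by simp)) (0, v) (1, 0)]
  refine HasDerivAt.congr_of_eventuallyEq ?_ hsnd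
  simpa using (hasDerivAt_partial_fst hdiff').clm_apply (hasDerivAt_const t ((0 : ℝ), v))

theorem isCRLinear_fderiv_velocity {E : Type*} [NormedAddCommGroup E] [NormedSpace ℂ E]
    {V : Type*} [NormedAddCommGroup V] [NormedSpace ℂ V] {H : ℝ × F → V} {L : F → E}
    (hH : ContDiffAt ℝ 2 H (t, u))
    (hcr : ∀ᶠ s in 𝓝 t, IsCRLinear L (fderiv ℝ (fun y => H (s, y)) u)) :
    IsCRLinear L (fderiv ℝ (fun y => deriv (fun s => H (s, y)) t) u) := fun v w hvw =>
  (hasDerivAt_fderiv_partial_snd hH w).unique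
    (((hasDerivAt_fderiv_partial_snd hH v).const_smul Complex.I).congr_of_eventuallyEq
      (hcr.mono fun _ hs => hs v w hvw))

end MixedPartials

section LocalDiffeomorphism

variable {F : Type*} [NormedAddCommGroup F] [NormedSpace ℝ F]
  {V : Type*} [NormedAddCommGroup V] [NormedSpace ℝ V]

theorem exists_openPartialHomeomorph [CompleteSpace F] {G : F → V} {G' : F ≃L[ℝ] V} {x : F}
    (hG : ContDiffAt ℝ ω G x) (hG' : HasFDerivAt G (G' : F →L[ℝ] V) x) :
    ∃ e : OpenPartialHomeomorph F V, ⇑e = G ∧ x ∈ e.source ∧ ContDiffOn ℝ ω e e.source ∧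
      ContDiffOn ℝ ω e.symm e.target := by
  let e := hG.toOpenPartialHomeomorph G hG' (by simp)
  have hinvertible : ∀ᶠ u in 𝓝 x, ContDiffAt ℝ ω G u ∧ (fderiv ℝ G u).IsInvertible := by
    refine (hG.eventually (by simp)).and
      ((hG.fderiv_right (m := ω) le_rfl).continuousAt.eventually ?_)
    rw [hG'.fderiv]
    exact G'.nhds
  obtain ⟨O, hO, hOopen, hxO⟩ := eventually_nhds_iff.1 hinvertible
  refine ⟨e.restrOpen O hOopen, rfl, ⟨hG.mem_toOpenPartialHomeomorph_source hG' (by simp), hxO⟩,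
    fun u hu => (hO u hu.2).1.contDiffWithinAt, fun y hy => ?_⟩
  have hyO : e.symm y ∈ e.source ∩ O := (e.restrOpen O hOopen).map_target hy
  obtain ⟨hGy, B, hB⟩ := hO _ hyO.2
  have hGB : HasFDerivAt e (B : F →L[ℝ] V) (e.symm y) :=
    hB ▸ (hGy.differentiableAt (by simp)).hasFDerivAt
  exact (e.contDiffAt_symm hy.1 hGB hGy).contDiffWithinAt

theorem fderiv_symm_fderiv_apply {e : OpenPartialHomeomorph F V}
    (he : ContDiffOn ℝ ω e e.source) (hsymm : ContDiffOn ℝ ω e.symm e.target) {u : F}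
    (hu : u ∈ e.source) (v : F) : fderiv ℝ e.symm (e u) (fderiv ℝ e u v) = v := by
  have hed : DifferentiableAt ℝ e u :=
    (he.contDiffAt (e.open_source.mem_nhds hu)).differentiableAt (by simp)
  have hsymmd : DifferentiableAt ℝ e.symm (e u) :=
    (hsymm.contDiffAt (e.open_target.mem_nhds (e.map_source hu))).differentiableAt (by simp)
  rw [← ContinuousLinearMap.comp_apply, ← fderiv_comp u hsymmd hed,
    (show e.symm ∘ e =ᶠ[𝓝 u] id from e.eventually_left_inverse hu).fderiv_eq, fderiv_id,
    ContinuousLinearMap.id_apply]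

theorem exists_linearization [CompleteSpace F] [FiniteDimensional ℝ V] {h : F → V} {x : F}
    (hh : ContDiffAt ℝ ω h x) (hsurj : Function.Surjective (fderiv ℝ h x)) :
    ∃ e : OpenPartialHomeomorph F F, x ∈ e.source ∧ ContDiffOn ℝ ω e e.source ∧
      ContDiffOn ℝ ω e.symm e.target ∧ ∀ u ∈ e.source, h u = h x ↔ e u ∈ (fderiv ℝ h x).ker := by
  set A := fderiv ℝ h x
  obtain ⟨s, hs⟩ := A.exists_rightInverse_of_surjective (LinearMap.range_eq_top.2 hsurj)
  have hAs : ∀ v, A (s v) = v := fun v => congrArg (fun B : V →L[ℝ] V => B v) hs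
  set G : F → F := fun u => (u - x) + s (h u - h x - A (u - x))
  have hAG : ∀ u, A (G u) = h u - h x := fun u => by rw [map_add, hAs, add_sub_cancel]
  have hG : ContDiffAt ℝ ω G x :=
    (contDiffAt_id.sub contDiffAt_const).add (s.contDiff.contDiffAt.comp x
      ((hh.sub contDiffAt_const).sub
        (A.contDiff.contDiffAt.comp x (contDiffAt_id.sub contDiffAt_const))))
  have hG' : HasFDerivAt G (ContinuousLinearEquiv.refl ℝ F : F →L[ℝ] F) x := by
    have hsub : HasFDerivAt (fun u => u - x) (ContinuousLinearMap.id ℝ F) x :=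
      (hasFDerivAt_id x).sub_const x
    have hsum := hsub.add (s.hasFDerivAt.comp x
      (((hh.differentiableAt (by simp)).hasFDerivAt.sub_const (h x)).sub
        (A.hasFDerivAt.comp x hsub)))
    exact hsum.congr_fderiv (by ext v; simp [A])
  obtain ⟨e, he, hx, heA, hesymm⟩ := exists_openPartialHomeomorph hG hG'
  refine ⟨e, hx, heA, hesymm, fun u _ => ?_⟩
  rw [LinearMap.mem_ker, he]
  exact (sub_eq_zero.symm.trans (by rw [← hAG]; rfl))

end LocalDiffeomorphism

theorem exists_isUnit_add_smul {n K L : Type*} [Fintype n] [DecidableEq n] [Field K] [Infinite K]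
    [Field L] [Algebra K L] {A B : Matrix n n K} {z : L}
    (h : IsUnit (A.map (algebraMap K L) + z • B.map (algebraMap K L))) :
    ∃ s : K, IsUnit (A + s • B) := by
  let p : Polynomial K :=
    (A.map Polynomial.C + (Polynomial.X : Polynomial K) • B.map Polynomial.C).det
  have hp : Polynomial.aeval z p = (A.map (algebraMap K L) + z • B.map (algebraMap K L)).det := by
    rw [AlgHom.map_det]
    congr 1
    ext i k
    simp [mul_comm z]
  have hp_ne_zero : p ≠ 0 := fun h0 =>
    ((Matrix.isUnit_iff_isUnit_det _).1 h).ne_zero (by rw [← hp, h0, map_zero])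
  obtain ⟨s, hs⟩ : ∃ s, p.eval s ≠ 0 := by
    by_contra! hzero
    exact hp_ne_zero (Polynomial.funext fun s => by rw [hzero, Polynomial.eval_zero])
  have hps : p.eval s = (A + s • B).det := by
    rw [← Polynomial.coe_evalRingHom, RingHom.map_det]
    congr 1
    ext i k
    simp [mul_comm s]
  exact ⟨s, (Matrix.isUnit_iff_isUnit_det _).2 (isUnit_iff_ne_zero.2 (hps ▸ hs))⟩

section Components

variable {κ : Type*}

/-- The componentwise real part on `ℂ^κ`. -/
def rePi : (κ → ℂ) →L[ℝ] κ → ℝ := ContinuousLinearMap.piMap fun _ => Complex.reCLM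

/-- The componentwise imaginary part on `ℂ^κ`. -/
def imPi : (κ → ℂ) →L[ℝ] κ → ℝ := ContinuousLinearMap.piMap fun _ => Complex.imCLM

/-- The inclusion of `ℝ^κ` in `ℂ^κ`. -/
def ofRealPi : (κ → ℝ) →L[ℝ] κ → ℂ := ContinuousLinearMap.piMap fun _ => Complex.ofRealCLM

@[simp] theorem rePi_apply (z : κ → ℂ) (k : κ) : rePi z k = (z k).re := rfl
@[simp] theorem imPi_apply (z : κ → ℂ) (k : κ) : imPi z k = (z k).im := rfl
@[simp] theorem ofRealPi_apply (v : κ → ℝ) (k : κ) : ofRealPi v k = v k := rfl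

@[simp] theorem rePi_ofRealPi (v : κ → ℝ) : rePi (ofRealPi v) = v := by ext; simp
@[simp] theorem imPi_ofRealPi (v : κ → ℝ) : imPi (ofRealPi v) = 0 := by ext; simp
@[simp] theorem rePi_I_smul (z : κ → ℂ) : rePi (Complex.I • z) = -imPi z := by ext; simp
@[simp] theorem imPi_I_smul (z : κ → ℂ) : imPi (Complex.I • z) = rePi z := by ext; simp

theorem ofRealPi_rePi_add_I_smul_ofRealPi_imPi (z : κ → ℂ) :
    ofRealPi (rePi z) + Complex.I • ofRealPi (imPi z) = z := by
  ext k
  simp [mul_comm Complex.I]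

theorem ext_rePi_imPi {z w : κ → ℂ} (hre : rePi z = rePi w) (him : imPi z = imPi w) : z = w := by
  rw [← ofRealPi_rePi_add_I_smul_ofRealPi_imPi z, hre, him, ofRealPi_rePi_add_I_smul_ofRealPi_imPi]

theorem mem_tube_iff {n : ℕ} {B : Set (Fin n → ℝ)} {z : Fin n → ℂ} : z ∈ tube B ↔ imPi z ∈ B :=
  Iff.rfl

end Components

section SectionImage

variable {V : Type*} [NormedAddCommGroup V] [NormedSpace ℝ V] {W : Submodule ℝ V} {π : V →L[ℝ] W}
  {O : Set W} {η : W → V}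

/-- For a section `η` over `O` of the projection `π` onto `W`, the chart `y ↦ y - η (π y) + π y`
of `V`, which straightens the image of `η` to `O ⊆ W`. -/
def sectionChart (hπ : ∀ w : W, π w = w) (hO : IsOpen O) (hη : ContinuousOn η O)
    (hπη : ∀ w ∈ O, π (η w) = w) : OpenPartialHomeomorph V V where
  toFun y := y - η (π y) + π y
  invFun y := y - π y + η (π y)
  source := π ⁻¹' O
  target := π ⁻¹' O
  map_source' y hy := by simpa [hπη _ hy, hπ] using hy
  map_target' y hy := by simpa [hπη _ hy, hπ] using hy
  left_inv' y hy := by simp [hπη _ hy, hπ]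
  right_inv' y hy := by simp [hπη _ hy, hπ]
  open_source := hO.preimage π.continuous
  open_target := hO.preimage π.continuous
  continuousOn_toFun := (continuousOn_id.sub (hη.comp π.continuous.continuousOn fun _ hy => hy)).add
    (W.subtypeL.comp π).continuous.continuousOn
  continuousOn_invFun := (continuousOn_id.sub (W.subtypeL.comp π).continuous.continuousOn).add
    (hη.comp π.continuous.continuousOn fun _ hy => hy)

theorem sectionChart_mem_iff (hπ : ∀ w : W, π w = w) (hO : IsOpen O) (hη : ContinuousOn η O)
    (hπη : ∀ w ∈ O, π (η w) = w) {y : V} (hy : π y ∈ O) :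
    sectionChart hπ hO hη hπη y ∈ W ↔ y ∈ η '' O := by
  change y - η (π y) + π y ∈ W ↔ _
  rw [W.add_mem_iff_left (π y).2]
  constructor
  · intro hmem
    have hzero : (⟨_, hmem⟩ : W) = 0 := by rw [← hπ ⟨_, hmem⟩, map_sub, hπη _ hy, sub_self]
    exact ⟨π y, hy, (sub_eq_zero.1 (congrArg Subtype.val hzero)).symm⟩
  · rintro ⟨w, hw, rfl⟩
    rw [hπη w hw, sub_self]
    exact W.zero_mem

theorem isAnalyticSubmanifoldAt_image (hπ : ∀ w : W, π w = w) (hO : IsOpen O)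
    (hη : ContDiffOn ℝ ω η O) (hπη : ∀ w ∈ O, π (η w) = w) {y : V} (hy : y ∈ η '' O) :
    IsAnalyticSubmanifoldAt V (η '' O) (Module.finrank ℝ W) y := by
  have hηπ : ContDiffOn ℝ ω (fun y => η (π y)) (π ⁻¹' O) :=
    hη.comp π.contDiff.contDiffOn fun y hy => hy
  have hπ' : ContDiff ℝ ω (fun y : V => ((π y : W) : V)) := (W.subtypeL.comp π).contDiff
  let e := sectionChart hπ hO hη.continuousOn hπη
  refine ⟨hy, e, e.mem_maximalAtlas_of_contMDiffOn
    (contMDiffOn_iff_contDiffOn.2 ((contDiffOn_id.sub hηπ).add hπ'.contDiffOn))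
    (contMDiffOn_iff_contDiffOn.2 ((contDiffOn_id.sub hπ'.contDiffOn).add hηπ)), ?_, W, rfl,
    fun p hp => (sectionChart_mem_iff hπ hO hη.continuousOn hπη hp).symm⟩
  obtain ⟨w, hw, rfl⟩ := hy
  change π (η w) ∈ O
  rwa [hπη w hw]

end SectionImage

section TubeParametrization

variable {F : Type*} [NormedAddCommGroup F] [NormedSpace ℝ F] {κ : Type*} [Fintype κ]
  {φ : F → κ → ℂ}

/-- The coordinates `(Re z, π (Im z))`, where `π` is meant to be a projection onto the tangent space
of the base of a tube. -/
def tubeCoord {W : Type*} [NormedAddCommGroup W] [NormedSpace ℝ W] (π : (κ → ℝ) →L[ℝ] W) :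
    (κ → ℂ) →L[ℝ] (κ → ℝ) × W :=
  rePi.prod (π ∘L imPi)

section

variable {W : Type*} [NormedAddCommGroup W] [NormedSpace ℝ W] {π : (κ → ℝ) →L[ℝ] W}

omit [Fintype κ] in
theorem tubeCoord_ofRealPi (α : κ → ℝ) : tubeCoord π (ofRealPi α) = (α, 0) := by
  simp [tubeCoord]

theorem fderiv_imPi_symm_apply_eq_zero {e : OpenPartialHomeomorph F ((κ → ℝ) × W)}
    (he : ContDiffOn ℝ ω e e.source) (hesymm : ContDiffOn ℝ ω e.symm e.target)
    (heφ : ⇑e = tubeCoord π ∘ φ) {q : (κ → ℝ) × W} (hq : q ∈ e.target)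
    (hφ : DifferentiableAt ℝ φ (e.symm q)) {α : κ → ℝ}
    (hα : ofRealPi α ∈ range (fderiv ℝ φ (e.symm q))) :
    fderiv ℝ (fun q => imPi (φ (e.symm q))) q (α, 0) = 0 := by
  obtain ⟨v, hv⟩ := hα
  have hev : fderiv ℝ e (e.symm q) v = (α, 0) := by
    rw [heφ, ((tubeCoord π).hasFDerivAt.comp _ hφ.hasFDerivAt).fderiv,
      ContinuousLinearMap.comp_apply, hv, tubeCoord_ofRealPi]
  have hsymmv : fderiv ℝ e.symm q (α, 0) = v := by
    rw [← hev]
    simpa only [e.right_inv hq] using fderiv_symm_fderiv_apply he hesymm (e.map_target hq) v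
  have hd : DifferentiableAt ℝ e.symm q :=
    (hesymm.contDiffAt (e.open_target.mem_nhds hq)).differentiableAt (by simp)
  change fderiv ℝ (imPi ∘ φ ∘ e.symm) q (α, 0) = 0
  rw [(imPi.hasFDerivAt.comp q (hφ.hasFDerivAt.comp q hd.hasFDerivAt)).fderiv,
    ContinuousLinearMap.comp_apply, ContinuousLinearMap.comp_apply, hsymmv, hv, imPi_ofRealPi]

theorem imPi_comp_symm_eq {e : OpenPartialHomeomorph F ((κ → ℝ) × W)}
    (he : ContDiffOn ℝ ω e e.source) (hesymm : ContDiffOn ℝ ω e.symm e.target)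
    (heφ : ⇑e = tubeCoord π ∘ φ) {O : Set (κ → ℝ)} (hO : IsOpen O) (hO' : IsPreconnected O) {w : W}
    (h : ∀ p ∈ O, (p, w) ∈ e.target ∧ DifferentiableAt ℝ φ (e.symm (p, w)) ∧
      ∀ α, ofRealPi α ∈ range (fderiv ℝ φ (e.symm (p, w)))) {p q : κ → ℝ} (hp : p ∈ O)
    (hq : q ∈ O) : imPi (φ (e.symm (p, w))) = imPi (φ (e.symm (q, w))) := by
  refine eq_of_fderiv_fst_eq_zero (f := fun q => imPi (φ (e.symm q))) hO hO' (fun p hp => ?_) hp hq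
  obtain ⟨hpw, hφ, hα⟩ := h p hp
  exact ⟨(imPi (κ := κ)).differentiableAt.comp _ (hφ.comp _
      ((hesymm.contDiffAt (e.open_target.mem_nhds hpw)).differentiableAt (by simp))),
    fun α => fderiv_imPi_symm_apply_eq_zero he hesymm heφ hpw hφ (hα α)⟩

theorem exists_tube_parametrization [CompleteSpace F] {G' : F ≃L[ℝ] (κ → ℝ) × W} {x₀ : F}
    (hφ : ContDiffAt ℝ ω φ x₀) (hG' : tubeCoord π ∘L fderiv ℝ φ x₀ = G')
    (htan : ∀ᶠ u in 𝓝 x₀, ∀ α, ofRealPi α ∈ range (fderiv ℝ φ u)) :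
    ∃ (K : (κ → ℝ) × W → F) (O : Set (κ → ℝ)) (O' : Set W) (η : W → κ → ℝ),
      O ×ˢ O' ∈ 𝓝 (tubeCoord π (φ x₀)) ∧ IsOpen O' ∧ IsConnected O' ∧
      ContDiffAt ℝ ω K (tubeCoord π (φ x₀)) ∧ (∀ᶠ u in 𝓝 x₀, K (tubeCoord π (φ u)) = u) ∧
      ContDiffOn ℝ ω η O' ∧ (∀ w ∈ O', π (η w) = w) ∧
      ∀ p ∈ O, ∀ w ∈ O', rePi (φ (K (p, w))) = p ∧ imPi (φ (K (p, w))) = η w := by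
  obtain ⟨e, heφ, hx₀, he, hesymm⟩ := exists_openPartialHomeomorph
    ((tubeCoord π).contDiff.contDiffAt.comp x₀ hφ)
    (hG' ▸ (tubeCoord π).hasFDerivAt.comp x₀ (hφ.differentiableAt (by simp)).hasFDerivAt)
  have hq₀ : e x₀ ∈ e.target := e.map_source hx₀
  have hnear : ∀ᶠ q in 𝓝 (e x₀), q ∈ e.target ∧ ContDiffAt ℝ ω φ (e.symm q) ∧
      ∀ α, ofRealPi α ∈ range (fderiv ℝ φ (e.symm q)) :=
    (show ∀ᶠ q in 𝓝 (e x₀), q ∈ e.target from e.open_target.mem_nhds hq₀).and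
      ((e.tendsto_symm hx₀).eventually ((hφ.eventually (by simp)).and htan))
  obtain ⟨ε, hε, hball⟩ := Metric.eventually_nhds_iff_ball.1 hnear
  obtain ⟨⟨p₀, w₀⟩, hq⟩ : ∃ q, e x₀ = q := ⟨_, rfl⟩
  rw [hq] at hball hq₀
  simp only [← ball_prod_same, mem_prod, Prod.forall] at hball
  have hp₀ : p₀ ∈ Metric.ball p₀ ε := Metric.mem_ball_self hε
  have hright : ∀ p ∈ Metric.ball p₀ ε, ∀ w ∈ Metric.ball w₀ ε,
      tubeCoord π (φ (e.symm (p, w))) = (p, w) := fun p hp w hw => by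
    have h := e.right_inv (hball p w ⟨hp, hw⟩).1
    rwa [heφ] at h
  have hbase : tubeCoord π (φ x₀) = (p₀, w₀) := by rw [← hq, heφ]; rfl
  refine ⟨e.symm, Metric.ball p₀ ε, Metric.ball w₀ ε, fun w => imPi (φ (e.symm (p₀, w))), ?_,
    Metric.isOpen_ball, (convex_ball w₀ ε).isConnected (Metric.nonempty_ball.2 hε), ?_, ?_,
    fun w hw => ?_, fun w hw => congrArg Prod.snd (hright p₀ hp₀ w hw), fun p hp w hw =>
      ⟨congrArg Prod.fst (hright p hp w hw), ?_⟩⟩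
  · rw [hbase]
    exact prod_mem_nhds (Metric.ball_mem_nhds _ hε) (Metric.ball_mem_nhds _ hε)
  · rw [hbase]
    exact hesymm.contDiffAt (e.open_target.mem_nhds hq₀)
  · filter_upwards [e.eventually_left_inverse hx₀] with u hu
    rwa [heφ] at hu
  · obtain ⟨hpw, hφpw, -⟩ := hball p₀ w ⟨hp₀, hw⟩
    exact ((imPi (κ := κ)).contDiff.contDiffAt.comp w (hφpw.comp w
      ((hesymm.contDiffAt (e.open_target.mem_nhds hpw)).comp w
        (contDiffAt_const.prodMk contDiffAt_id)))).contDiffWithinAt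
  · exact imPi_comp_symm_eq he hesymm heφ Metric.isOpen_ball (convex_ball p₀ ε).isPreconnected
      (fun q hq => (hball q w ⟨hq, hw⟩).imp_right (.imp_left (·.differentiableAt (by simp)))) hp hp₀

end

theorem bijective_tubeCoord_comp {D : F →L[ℝ] κ → ℂ} (hD : Function.Injective D)
    (htan : ∀ α, ofRealPi α ∈ range D) {W : Submodule ℝ (κ → ℝ)}
    (hW : ∀ y, y ∈ W ↔ ∃ v, imPi (D v) = y) {π : (κ → ℝ) →L[ℝ] W} (hπ : ∀ w : W, π w = w) :
    Function.Bijective (tubeCoord π ∘L D) := by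
  have hπD : ∀ v, (π (imPi (D v)) : κ → ℝ) = imPi (D v) := fun v =>
    congrArg Subtype.val (hπ ⟨imPi (D v), (hW _).2 ⟨v, rfl⟩⟩)
  constructor
  · refine (injective_iff_map_eq_zero _).2 fun v hv => ?_
    have hre : rePi (D v) = 0 := congrArg Prod.fst hv
    have hπim : π (imPi (D v)) = 0 := congrArg Prod.snd hv
    have him : imPi (D v) = 0 := by rw [← hπD, hπim, Submodule.coe_zero]
    exact hD ((ext_rePi_imPi (by rw [hre, map_zero]) (by rw [him, map_zero])).trans
      (map_zero D).symm)
  · rintro ⟨α, w⟩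
    obtain ⟨v, hv⟩ := (hW _).1 w.2
    obtain ⟨u, hu⟩ := htan (α - rePi (D v))
    refine ⟨v + u, ?_⟩
    rw [ContinuousLinearMap.comp_apply, map_add D, hu, map_add, tubeCoord_ofRealPi]
    refine Prod.ext (add_sub_cancel _ α) ?_
    change π (imPi (D v)) + 0 = w
    rw [add_zero, hv, hπ]

theorem exists_tube_of_immersion [FiniteDimensional ℝ F] {n : ℕ} {φ : F → Fin n → ℂ} {x₀ : F}
    (hφ : ContDiffAt ℝ ω φ x₀) (hinj : Function.Injective (fderiv ℝ φ x₀))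
    (htan : ∀ᶠ u in 𝓝 x₀, ∀ α, ofRealPi α ∈ range (fderiv ℝ φ u)) :
    ∃ (B : Set (Fin n → ℝ)) (ψ : (Fin n → ℂ) → F), IsConnected B ∧
      (∃ d, ∀ y ∈ B, IsAnalyticSubmanifoldAt (Fin n → ℝ) B d y) ∧
      (∀ᶠ u in 𝓝 x₀, φ u ∈ tube B) ∧ ContDiffAt ℝ ω ψ (φ x₀) ∧
      (∀ᶠ u in 𝓝 x₀, ψ (φ u) = u) ∧ ∀ᶠ z in 𝓝[tube B] (φ x₀), φ (ψ z) = z := by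
  set W := LinearMap.range (imPi ∘L fderiv ℝ φ x₀ : F →ₗ[ℝ] Fin n → ℝ)
  obtain ⟨π, hπ⟩ := Submodule.ClosedComplemented.of_finiteDimensional W
  have hbij := bijective_tubeCoord_comp hinj htan.self_of_nhds (fun _ => Iff.rfl) hπ
  let G' := LinearEquiv.ofBijective (tubeCoord π ∘L fderiv ℝ φ x₀).toLinearMap hbij
  obtain ⟨K, O, O', η, hmem, hO', hO'c, hK, hKφ, hη, hπη, hφK⟩ :=
    exists_tube_parametrization (G' := G'.toContinuousLinearEquiv) hφ rfl htan
  have hnear : ∀ᶠ z in 𝓝 (φ x₀), tubeCoord π z ∈ O ×ˢ O' :=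
    (tubeCoord π).continuous.continuousAt.eventually hmem
  refine ⟨η '' O', K ∘ tubeCoord π, hO'c.image η hη.continuousOn,
    ⟨Module.finrank ℝ W, fun y hy => isAnalyticSubmanifoldAt_image hπ hO' hη hπη hy⟩, ?_,
    hK.comp (φ x₀) (tubeCoord π).contDiff.contDiffAt, hKφ, ?_⟩
  · filter_upwards [hKφ, hφ.continuousAt.eventually hnear] with u hu huO
    refine mem_tube_iff.2 ⟨_, huO.2, ?_⟩
    rw [← (hφK _ huO.1 _ huO.2).2, Prod.mk.eta, hu]
  · filter_upwards [self_mem_nhdsWithin, nhdsWithin_le_nhds hnear] with z hz hzO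
    obtain ⟨w, hw, hwz⟩ := mem_tube_iff.1 hz
    have hzw : (tubeCoord π z).2 = w := by
      change π (imPi z) = w
      rw [← hwz, hπη w hw]
    obtain ⟨hre, him⟩ := hφK _ hzO.1 _ hzO.2
    exact ext_rePi_imPi hre (him.trans (by rw [hzw, hwz]))

end TubeParametrization

section ManifoldCalculus

variable {V V' : Type*} [NormedAddCommGroup V] [NormedSpace ℂ V]
  [NormedAddCommGroup V'] [NormedSpace ℂ V']
  {F : Type*} [NormedAddCommGroup F] [NormedSpace ℝ F]
  {G : Type*} [NormedAddCommGroup G] [NormedSpace ℝ G]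
  {M : Type*} [TopologicalSpace M] [ChartedSpace F M]
  {N : Type*} [TopologicalSpace N] [ChartedSpace G N]

theorem dEmb_comp {f : M → V} {g : N → M} {p : N}
    (hf : MDifferentiableAt 𝓘(ℝ, F) 𝓘(ℝ, V) f (g p))
    (hg : MDifferentiableAt 𝓘(ℝ, G) 𝓘(ℝ, F) g p) (u : TangentSpace 𝓘(ℝ, G) p) :
    dEmb V G (f ∘ g) p u = dEmb V F f (g p) (mfderiv 𝓘(ℝ, G) 𝓘(ℝ, F) g p u) :=
  mfderiv_comp_apply p hf hg u

theorem dEmb_comp_left {S : V → V'} {f : M → V} {p : M} (hS : DifferentiableAt ℝ S (f p))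
    (hf : MDifferentiableAt 𝓘(ℝ, F) 𝓘(ℝ, V) f p) (u : TangentSpace 𝓘(ℝ, F) p) :
    dEmb V' F (S ∘ f) p u = fderiv ℝ S (f p) (dEmb V F f p u) := by
  have h := mfderiv_comp_apply p hS.mdifferentiableAt hf u
  rwa [mfderiv_eq_fderiv] at h

theorem dEmb_congr {f f' : M → V} {p : M} (h : f =ᶠ[𝓝 p] f') (u : TangentSpace 𝓘(ℝ, F) p) :
    dEmb V F f p u = dEmb V F f' p u := by
  have heq : (mfderiv 𝓘(ℝ, F) 𝓘(ℝ, V) f p : F →L[ℝ] V) = mfderiv 𝓘(ℝ, F) 𝓘(ℝ, V) f' p :=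
    h.mfderiv_eq
  exact congrArg (fun A : F →L[ℝ] V => A u) heq

theorem dEmb_sub {f f' : M → V} {p : M} (hf : MDifferentiableAt 𝓘(ℝ, F) 𝓘(ℝ, V) f p)
    (hf' : MDifferentiableAt 𝓘(ℝ, F) 𝓘(ℝ, V) f' p) (u : TangentSpace 𝓘(ℝ, F) p) :
    dEmb V F (f - f') p u = dEmb V F f p u - dEmb V F f' p u := by
  have heq : (dEmb V F (f - f') p : F →L[ℝ] V) = dEmb V F f p - dEmb V F f' p :=
    (hf.hasMFDerivAt.sub hf'.hasMFDerivAt).mfderiv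
  exact congrArg (fun A : F →L[ℝ] V => A u) heq

variable [IsManifold 𝓘(ℝ, F) ω M]

theorem eventually_mdifferentiableAt [IsManifold 𝓘(ℝ, G) ω N] {f : M → N} {a : M}
    (hf : ContMDiffAt 𝓘(ℝ, F) 𝓘(ℝ, G) ω f a) :
    ∀ᶠ p in 𝓝 a, MDifferentiableAt 𝓘(ℝ, F) 𝓘(ℝ, G) f p :=
  ((contMDiffAt_iff_contMDiffAt_nhds (by simp)).1 hf).mono fun _ hp =>
    hp.mdifferentiableAt (by simp)

end ManifoldCalculus

section Charts

variable {V : Type*} [NormedAddCommGroup V] [NormedSpace ℂ V]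
  {F : Type*} [NormedAddCommGroup F] [NormedSpace ℝ F]
  {M : Type*} [TopologicalSpace M] [ChartedSpace F M]

variable (F) in
theorem tendsto_extChartAt_symm (a : M) :
    Tendsto (extChartAt 𝓘(ℝ, F) a).symm (𝓝 (extChartAt 𝓘(ℝ, F) a a)) (𝓝 a) := by
  simpa only [ContinuousAt, extChartAt_to_inv] using continuousAt_extChartAt_symm (I := 𝓘(ℝ, F)) a

variable (F) in
theorem eventually_mem_extChartAt_target (a : M) :
    ∀ᶠ x in 𝓝 (extChartAt 𝓘(ℝ, F) a a), x ∈ (extChartAt 𝓘(ℝ, F) a).target :=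
  (isOpen_extChartAt_target a).mem_nhds (mem_extChartAt_target a)

variable (F) in
theorem eventually_extChartAt_symm_iff {a : M} {P : M → Prop} :
    (∀ᶠ x in 𝓝 (extChartAt 𝓘(ℝ, F) a a), P ((extChartAt 𝓘(ℝ, F) a).symm x)) ↔
      ∀ᶠ p in 𝓝 a, P p := by
  refine ⟨fun h => ?_, fun h => (tendsto_extChartAt_symm F a).eventually h⟩
  filter_upwards [(continuousAt_extChartAt (I := 𝓘(ℝ, F)) a).eventually h,
    extChartAt_source_mem_nhds (I := 𝓘(ℝ, F)) a] with p hp hsource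
  rwa [(extChartAt 𝓘(ℝ, F) a).left_inv hsource] at hp

variable [IsManifold 𝓘(ℝ, F) ω M]

theorem contMDiffAt_extChartAt_symm_of_mem {a : M} {x : F}
    (hx : x ∈ (extChartAt 𝓘(ℝ, F) a).target) :
    ContMDiffAt 𝓘(ℝ, F) 𝓘(ℝ, F) ω (extChartAt 𝓘(ℝ, F) a).symm x :=
  (contMDiffOn_extChartAt_symm (n := ω) a).contMDiffAt ((isOpen_extChartAt_target a).mem_nhds hx)

theorem mdifferentiableAt_extChartAt_symm_of_mem {a : M} {x : F}
    (hx : x ∈ (extChartAt 𝓘(ℝ, F) a).target) :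
    MDifferentiableAt 𝓘(ℝ, F) 𝓘(ℝ, F) (extChartAt 𝓘(ℝ, F) a).symm x :=
  (contMDiffAt_extChartAt_symm_of_mem hx).mdifferentiableAt (by simp)

theorem isInvertible_mfderiv_extChartAt_symm_of_mem {a : M} {x : F}
    (hx : x ∈ (extChartAt 𝓘(ℝ, F) a).target) :
    (mfderiv 𝓘(ℝ, F) 𝓘(ℝ, F) (extChartAt 𝓘(ℝ, F) a).symm x).IsInvertible := by
  have h := isInvertible_mfderivWithin_extChartAt_symm (I := 𝓘(ℝ, F)) hx
  rwa [modelWithCornersSelf_coe, range_id, mfderivWithin_univ] at h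

theorem fderiv_comp_extChartAt_symm_apply {f : M → V} {a : M} {x : F}
    (hx : x ∈ (extChartAt 𝓘(ℝ, F) a).target)
    (hf : MDifferentiableAt 𝓘(ℝ, F) 𝓘(ℝ, V) f ((extChartAt 𝓘(ℝ, F) a).symm x)) (u : F) :
    fderiv ℝ (f ∘ (extChartAt 𝓘(ℝ, F) a).symm) x u = dEmb V F f ((extChartAt 𝓘(ℝ, F) a).symm x)
      (mfderiv 𝓘(ℝ, F) 𝓘(ℝ, F) (extChartAt 𝓘(ℝ, F) a).symm x u) :=
  (congrArg (fun A : F →L[ℝ] V => A u) mfderiv_eq_fderiv.symm).trans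
    (dEmb_comp hf (mdifferentiableAt_extChartAt_symm_of_mem hx) u)

theorem eventually_eq_of_dEmb_eq_zero {f : M → V} {a : M}
    (hf : ∀ᶠ p in 𝓝 a, MDifferentiableAt 𝓘(ℝ, F) 𝓘(ℝ, V) f p)
    (hf' : ∀ᶠ p in 𝓝 a, ∀ u, dEmb V F f p u = 0) : ∀ᶠ p in 𝓝 a, f p = f a := by
  rw [← eventually_extChartAt_symm_iff F]
  have hconst : ∀ᶠ x in 𝓝 (extChartAt 𝓘(ℝ, F) a a),
      (f ∘ (extChartAt 𝓘(ℝ, F) a).symm) x =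
        (f ∘ (extChartAt 𝓘(ℝ, F) a).symm) (extChartAt 𝓘(ℝ, F) a a) := by
    refine eventually_eq_of_fderiv_eq_zero ?_
    filter_upwards [eventually_mem_extChartAt_target F a,
      (eventually_extChartAt_symm_iff F).2 hf, (eventually_extChartAt_symm_iff F).2 hf']
      with x hx hfx hfx'
    exact ⟨(hfx.comp x (mdifferentiableAt_extChartAt_symm_of_mem hx)).differentiableAt,
      ContinuousLinearMap.ext fun u => (fderiv_comp_extChartAt_symm_apply hx hfx u).trans (hfx' _)⟩
  simpa only [Function.comp_apply, extChartAt_to_inv] using hconst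

theorem eventually_eq_of_dEmb_eq {f f' : M → V} {a : M}
    (hf : ∀ᶠ p in 𝓝 a, MDifferentiableAt 𝓘(ℝ, F) 𝓘(ℝ, V) f p)
    (hf' : ∀ᶠ p in 𝓝 a, MDifferentiableAt 𝓘(ℝ, F) 𝓘(ℝ, V) f' p)
    (h : ∀ᶠ p in 𝓝 a, ∀ u, dEmb V F f p u = dEmb V F f' p u) (ha : f a = f' a) :
    f =ᶠ[𝓝 a] f' := by
  have hconst : ∀ᶠ p in 𝓝 a, (f - f') p = (f - f') a := by
    refine eventually_eq_of_dEmb_eq_zero (F := F) ?_ ?_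
    · filter_upwards [hf, hf'] with p hp hp' using hp.sub hp'
    · filter_upwards [hf, hf', h] with p hp hp' heq u
      rw [dEmb_sub hp hp', heq, sub_self]
  filter_upwards [hconst] with p hp
  rwa [Pi.sub_apply, Pi.sub_apply, ha, sub_self, sub_eq_zero] at hp

end Charts

section VectorFields

variable {F : Type*} [NormedAddCommGroup F] [NormedSpace ℝ F]
  {M : Type*} [TopologicalSpace M] [ChartedSpace F M]
  {a : M} {X Y : ∀ p : M, TangentSpace 𝓘(ℝ, F) p}

theorem germ_eq_iff : germ a X = germ a Y ↔ ∀ᶠ p in 𝓝 a, X p = Y p := by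
  refine (Submodule.Quotient.eq _).trans ?_
  change (∀ᶠ p in 𝓝 a, X p - Y p = 0) ↔ _
  exact eventually_congr (Eventually.of_forall fun p => sub_eq_zero)

theorem germ_eq_zero_iff : germ a X = 0 ↔ ∀ᶠ p in 𝓝 a, X p = 0 :=
  Submodule.Quotient.mk_eq_zero _

variable [IsManifold 𝓘(ℝ, F) ω M]

/-- The vector field `X` on `M` is real-analytic at `a`. -/
abbrev IsAnalyticFieldAt (a : M) (X : ∀ p : M, TangentSpace 𝓘(ℝ, F) p) : Prop :=
  ContMDiffAt 𝓘(ℝ, F) (𝓘(ℝ, F)).tangent ω (fun p => (⟨p, X p⟩ : TangentBundle 𝓘(ℝ, F) M)) a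

omit [IsManifold 𝓘(ℝ, F) ω M] in
/-- The expression of the vector field `X` in the preferred chart at `a`. -/
def chartField (a : M) (X : ∀ p : M, TangentSpace 𝓘(ℝ, F) p) : F → F :=
  VectorField.mpullback 𝓘(ℝ, F) 𝓘(ℝ, F) (extChartAt 𝓘(ℝ, F) a).symm X

theorem mfderiv_chartField {x : F} (hx : x ∈ (extChartAt 𝓘(ℝ, F) a).target)
    (X : ∀ p : M, TangentSpace 𝓘(ℝ, F) p) :
    mfderiv 𝓘(ℝ, F) 𝓘(ℝ, F) (extChartAt 𝓘(ℝ, F) a).symm x (chartField (F := F) a X x) =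
      X ((extChartAt 𝓘(ℝ, F) a).symm x) :=
  (isInvertible_mfderiv_extChartAt_symm_of_mem hx).self_apply_inverse (X _)

variable [CompleteSpace F]

theorem contDiffAt_chartField (hX : IsAnalyticFieldAt a X) :
    ContDiffAt ℝ ω (chartField a X) (extChartAt 𝓘(ℝ, F) a a) := by
  have h := ContMDiffAt.mpullback_vectorField_preimage (m := ω) (n := ω)
    (f := (extChartAt 𝓘(ℝ, F) a).symm) (V := X) (x₀ := extChartAt 𝓘(ℝ, F) a a)
    (by rwa [extChartAt_to_inv])
    (contMDiffAt_extChartAt_symm_of_mem (mem_extChartAt_target a))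
    (isInvertible_mfderiv_extChartAt_symm_of_mem (mem_extChartAt_target a)) le_rfl
  rw [← contMDiffWithinAt_univ] at h
  exact contDiffWithinAt_univ.1 (contMDiffWithinAt_vectorSpace_iff_contDiffWithinAt.1 h)

theorem isAnalyticFieldAt_of_mfderiv_extChartAt {Ξ : F → F}
    (hΞ : ContDiffAt ℝ ω Ξ (extChartAt 𝓘(ℝ, F) a a))
    (h : ∀ᶠ p in 𝓝 a, mfderiv 𝓘(ℝ, F) 𝓘(ℝ, F) (extChartAt 𝓘(ℝ, F) a) p (X p) =
      Ξ (extChartAt 𝓘(ℝ, F) a p)) :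
    IsAnalyticFieldAt a X := by
  have hΞ' : IsAnalyticFieldAt (F := F) (extChartAt 𝓘(ℝ, F) a a) Ξ := by
    refine contMDiffWithinAt_univ.1 ?_
    exact contMDiffWithinAt_vectorSpace_iff_contDiffWithinAt.2 (contDiffWithinAt_univ.2 hΞ)
  have hpullback := ContMDiffAt.mpullback_vectorField_preimage (m := ω) (n := ω)
    (f := extChartAt 𝓘(ℝ, F) a) (V := Ξ) (x₀ := a) hΞ' contMDiffAt_extChartAt
    (isInvertible_mfderiv_extChartAt (mem_extChartAt_source a)) le_rfl
  refine hpullback.congr_of_eventuallyEq ?_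
  filter_upwards [h, extChartAt_source_mem_nhds (I := 𝓘(ℝ, F)) a] with p hp hsource
  have hXp : X p = VectorField.mpullback 𝓘(ℝ, F) 𝓘(ℝ, F) (extChartAt 𝓘(ℝ, F) a) Ξ p := by
    refine ((isInvertible_mfderiv_extChartAt hsource).inverse_apply_self (X p)).symm.trans ?_
    rw [hp]
    rfl
  rw [hXp]

theorem lieBracket_chartField {x : F} (hx : x ∈ (extChartAt 𝓘(ℝ, F) a).target)
    (hX : IsAnalyticFieldAt ((extChartAt 𝓘(ℝ, F) a).symm x) X)
    (hY : IsAnalyticFieldAt ((extChartAt 𝓘(ℝ, F) a).symm x) Y) :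
    VectorField.lieBracket ℝ (chartField a X) (chartField a Y) x =
      chartField a (VectorField.mlieBracket 𝓘(ℝ, F) X Y) x := by
  rw [← VectorField.lieBracketWithin_univ]
  refine (congrFun (VectorField.mlieBracketWithin_eq_lieBracketWithin (s := univ)) x).symm.trans ?_
  exact (VectorField.mpullback_mlieBracket (n := ω) (hX.mdifferentiableAt (by simp))
    (hY.mdifferentiableAt (by simp)) (contMDiffAt_extChartAt_symm_of_mem hx) (by simp)).symm

theorem mlieBracket_eq_zero_iff_chartField
    (hX : IsAnalyticFieldAt a X) (hY : IsAnalyticFieldAt a Y) :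
    (∀ᶠ p in 𝓝 a, VectorField.mlieBracket 𝓘(ℝ, F) X Y p = 0) ↔
      ∀ᶠ x in 𝓝 (extChartAt 𝓘(ℝ, F) a a),
        VectorField.lieBracket ℝ (chartField a X) (chartField a Y) x = 0 := by
  rw [← eventually_extChartAt_symm_iff F]
  refine eventually_congr ?_
  filter_upwards [eventually_mem_extChartAt_target F a,
    (tendsto_extChartAt_symm F a).eventually
      ((contMDiffAt_iff_contMDiffAt_nhds (by simp)).1 hX),
    (tendsto_extChartAt_symm F a).eventually
      ((contMDiffAt_iff_contMDiffAt_nhds (by simp)).1 hY)] with x hx hXx hYx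
  rw [lieBracket_chartField hx hXx hYx, ← mfderiv_chartField hx (VectorField.mlieBracket _ X Y)]
  exact map_eq_zero_iff _ (isInvertible_mfderiv_extChartAt_symm_of_mem hx).injective

end VectorFields

section Reflection

variable {κ : Type*}

/-- The antilinear map `z ↦ -conj z` on `ℂ^κ`. -/
def negConj : (κ → ℂ) →L[ℝ] κ → ℂ :=
  -(ofRealPi ∘L rePi) + Complex.I • ofRealPi ∘L imPi

theorem negConj_apply (z : κ → ℂ) :
    negConj z = -ofRealPi (rePi z) + Complex.I • ofRealPi (imPi z) := rfl

@[simp] theorem rePi_negConj (z : κ → ℂ) : rePi (negConj z) = -rePi z := by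
  simp [negConj_apply]

@[simp] theorem imPi_negConj (z : κ → ℂ) : imPi (negConj z) = imPi z := by
  simp [negConj_apply]

theorem negConj_I_smul (z : κ → ℂ) : negConj (Complex.I • z) = -Complex.I • negConj z :=
  ext_rePi_imPi (by simp) (by simp)

theorem negConj_ofRealPi (v : κ → ℝ) : negConj (ofRealPi v) = -ofRealPi v :=
  ext_rePi_imPi (by simp) (by simp)

/-- The reflection `x + iy ↦ 2c - x + iy` of `ℂ^κ`, which fixes exactly the points with real part
`c`. -/
def reflect (c : κ → ℝ) (z : κ → ℂ) : κ → ℂ := negConj z + ofRealPi (c + c)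

@[simp] theorem rePi_reflect (c : κ → ℝ) (z : κ → ℂ) :
    rePi (reflect c z) = -rePi z + (c + c) := by
  simp only [reflect, map_add, rePi_negConj, rePi_ofRealPi]

@[simp] theorem imPi_reflect (c : κ → ℝ) (z : κ → ℂ) : imPi (reflect c z) = imPi z := by
  simp only [reflect, map_add, imPi_negConj, imPi_ofRealPi, add_zero]

theorem reflect_reflect (c : κ → ℝ) (z : κ → ℂ) : reflect c (reflect c z) = z :=
  ext_rePi_imPi (by simp only [rePi_reflect]; abel) (by simp only [imPi_reflect])

theorem reflect_eq_iff {c : κ → ℝ} {z : κ → ℂ} : reflect c z = z ↔ rePi z = c := by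
  refine ⟨fun h => ?_, fun h => ext_rePi_imPi ?_ (imPi_reflect c z)⟩
  · ext k
    have hk := congrFun (congrArg rePi h) k
    rw [rePi_reflect, Pi.add_apply, Pi.neg_apply, Pi.add_apply] at hk
    linarith
  · rw [rePi_reflect, h, neg_add_cancel_left]

theorem hasFDerivAt_reflect [Finite κ] (c : κ → ℝ) (z : κ → ℂ) :
    HasFDerivAt (reflect c) negConj z := by
  have := Fintype.ofFinite κ
  exact negConj.hasFDerivAt.add_const _

theorem contDiff_reflect [Fintype κ] (c : κ → ℝ) : ContDiff ℝ ω (reflect c) :=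
  (negConj (κ := κ)).contDiff.add contDiff_const

end Reflection

section Generic

variable {E : Type*} [NormedAddCommGroup E] [NormedSpace ℂ E]

theorem range_sup_range_I_smul_eq_top {V : Type*} [AddCommGroup V] [Module ℝ V] {L : V →ₗ[ℝ] E}
    (hL : Submodule.span ℂ (range L) = ⊤) :
    LinearMap.range L ⊔ LinearMap.range (Complex.I • L) = ⊤ := by
  refine eq_top_iff.2 fun x _ => ?_
  have hx : x ∈ Submodule.span ℂ (range L) := hL ▸ Submodule.mem_top
  induction hx using Submodule.span_induction with
  | mem x hx => exact Submodule.mem_sup_left hx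
  | zero => exact zero_mem _
  | add x y _ _ hx hy => exact add_mem (hx trivial) (hy trivial)
  | smul c x _ hx =>
    obtain ⟨_, ⟨u, rfl⟩, _, ⟨v, rfl⟩, rfl⟩ := Submodule.mem_sup.1 (hx trivial)
    refine Submodule.mem_sup.2 ⟨_, ⟨c.re • u - c.im • v, rfl⟩, _, ⟨c.re • v + c.im • u, rfl⟩, ?_⟩
    simp only [smul_eq_re_smul_add_I_smul_im_smul c, map_add, map_sub, map_smul,
      LinearMap.smul_apply, smul_add, smul_comm Complex.I c.im, smul_smul Complex.I Complex.I,
      Complex.I_mul_I, neg_one_smul, smul_neg]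
    abel

variable {Z : Type*} [TopologicalSpace Z] [ChartedSpace E Z]
  {F : Type*} [NormedAddCommGroup F] [NormedSpace ℝ F]
  {M : Type*} [TopologicalSpace M] [ChartedSpace F M]

theorem crDim_add_finrank [FiniteDimensional ℝ F] (ι : GenericEmbedding E Z F M) (p : M) :
    crDim ι p + Module.finrank ℂ E = Module.finrank ℝ F := by
  let D : F →L[ℝ] E := ι.d p
  let T : Submodule ℝ E := LinearMap.range (D : F →ₗ[ℝ] E)
  let IT : Submodule ℝ E := LinearMap.range (Complex.I • (D : F →ₗ[ℝ] E))
  have hD : Function.Injective D := ι.injective_dEmb p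
  have hsup : T ⊔ IT = ⊤ := range_sup_range_I_smul_eq_top (ι.generic p)
  have hinf : T ⊓ IT = (holTangent ι p).restrictScalars ℝ := by
    ext x
    refine and_congr_right (a := x ∈ T) fun _ => ⟨?_, ?_⟩
    · rintro ⟨v, rfl⟩
      refine ⟨(-v : F), (map_neg D v).trans ?_⟩
      rw [LinearMap.smul_apply, smul_smul, Complex.I_mul_I, neg_one_smul]
      rfl
    · rintro ⟨(v : F), hv : D v = _⟩
      refine ⟨-v, ?_⟩
      rw [map_neg, LinearMap.smul_apply, ContinuousLinearMap.coe_coe, hv, smul_smul,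
        Complex.I_mul_I, neg_one_smul, neg_neg]
  have hIT : Module.finrank ℝ IT = Module.finrank ℝ F :=
    LinearMap.finrank_range_of_inj fun u v huv => hD (smul_right_injective E Complex.I_ne_zero huv)
  have hhol : Module.finrank ℝ ((holTangent ι p).restrictScalars ℝ) = 2 * crDim ι p :=
    finrank_real_of_complex (holTangent ι p)
  have hdim := Submodule.finrank_sup_add_finrank_inf_eq T IT
  rw [hsup, hinf, hhol, hIT, finrank_top, finrank_real_of_complex,
    LinearMap.finrank_range_of_inj hD] at hdim
  omega

end Generic

section TubeFrame

variable {E : Type*} [NormedAddCommGroup E] [NormedSpace ℂ E]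
  {Z : Type*} [TopologicalSpace Z] [ChartedSpace E Z]
  {F : Type*} [NormedAddCommGroup F] [NormedSpace ℝ F]
  {M : Type*} [TopologicalSpace M] [ChartedSpace F M]
  {ι : GenericEmbedding E Z F M} {p : M} {r : ℕ} {φ : M → Fin r → ℂ}

/-- At `p`, the map `φ` is an immersive CR-map whose image is tangent to all real translations:
the infinitesimal form of being a tube realization. -/
structure IsTubeFrame (ι : GenericEmbedding E Z F M) (φ : M → Fin r → ℂ) (p : M) : Prop where
  mdiff : MDifferentiableAt 𝓘(ℝ, F) 𝓘(ℝ, Fin r → ℂ) φ p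
  inj : ∀ u v : TangentSpace 𝓘(ℝ, F) p,
    dEmb (Fin r → ℂ) F φ p u = dEmb (Fin r → ℂ) F φ p v → u = v
  exists_real : ∀ v : Fin r → ℝ, ∃ u : TangentSpace 𝓘(ℝ, F) p,
    dEmb (Fin r → ℂ) F φ p u = ofRealPi v
  cr : ∀ v w : TangentSpace 𝓘(ℝ, F) p,
    IsJ ι p v w ↔ dEmb (Fin r → ℂ) F φ p w = Complex.I • dEmb (Fin r → ℂ) F φ p v

namespace IsTubeFrame

theorem exists_split (h : IsTubeFrame ι φ p) (u : TangentSpace 𝓘(ℝ, F) p) :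
    ∃ x y k : TangentSpace 𝓘(ℝ, F) p,
      dEmb (Fin r → ℂ) F φ p x = ofRealPi (rePi (dEmb (Fin r → ℂ) F φ p u)) ∧
      dEmb (Fin r → ℂ) F φ p y = ofRealPi (imPi (dEmb (Fin r → ℂ) F φ p u)) ∧
      u = x + k ∧ IsJ ι p y k := by
  obtain ⟨x, hx⟩ := h.exists_real (rePi (dEmb (Fin r → ℂ) F φ p u))
  obtain ⟨y, hy⟩ := h.exists_real (imPi (dEmb (Fin r → ℂ) F φ p u))
  refine ⟨x, y, u - x, hx, hy, (add_sub_cancel x u).symm, (h.cr y (u - x)).2 ?_⟩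
  rw [map_sub, hx, hy, sub_eq_iff_eq_add, add_comm]
  exact (ofRealPi_rePi_add_I_smul_ofRealPi_imPi _).symm

theorem apply_eq (h : IsTubeFrame ι φ p) {V : Type*} [AddCommGroup V] [Module ℂ V]
    {Q : TangentSpace 𝓘(ℝ, F) p →ₗ[ℝ] V} (hQ : ∀ v w, IsJ ι p v w → Q w = Complex.I • Q v)
    {A : (Fin r → ℂ) →ₗ[ℂ] V}
    (hA : ∀ v u, dEmb (Fin r → ℂ) F φ p u = ofRealPi v → Q u = A (ofRealPi v))
    (u : TangentSpace 𝓘(ℝ, F) p) : Q u = A (dEmb (Fin r → ℂ) F φ p u) := by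
  obtain ⟨x, y, k, hx, hy, rfl, hyk⟩ := h.exists_split u
  conv_rhs => rw [← ofRealPi_rePi_add_I_smul_ofRealPi_imPi (dEmb (Fin r → ℂ) F φ p (x + k))]
  rw [map_add, map_add, map_smul, hQ y k hyk, hA _ x hx, hA _ y hy]

theorem eq_sum (h : IsTubeFrame ι φ p) {x : Fin r → TangentSpace 𝓘(ℝ, F) p}
    (hx : ∀ k, dEmb (Fin r → ℂ) F φ p (x k) = ofRealPi (Pi.single k 1)) {v : Fin r → ℝ}
    {u : TangentSpace 𝓘(ℝ, F) p} (hu : dEmb (Fin r → ℂ) F φ p u = ofRealPi v) :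
    u = ∑ k, v k • x k := by
  refine h.inj _ _ (hu.trans ?_)
  conv_lhs => rw [pi_eq_sum_univ' v]
  simp only [map_sum, map_smul, hx]

theorem apply_eq_linearCombination (h : IsTubeFrame ι φ p) {V : Type*} [AddCommGroup V] [Module ℂ V]
    {Q : TangentSpace 𝓘(ℝ, F) p →ₗ[ℝ] V} (hQ : ∀ v w, IsJ ι p v w → Q w = Complex.I • Q v)
    {x : Fin r → TangentSpace 𝓘(ℝ, F) p}
    (hx : ∀ k, dEmb (Fin r → ℂ) F φ p (x k) = ofRealPi (Pi.single k 1))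
    (u : TangentSpace 𝓘(ℝ, F) p) :
    Q u = Fintype.linearCombination ℂ (fun k => Q (x k)) (dEmb (Fin r → ℂ) F φ p u) := by
  refine h.apply_eq hQ (fun v u hu => ?_) u
  rw [h.eq_sum hx hu, Fintype.linearCombination_apply]
  simp

theorem exists_linearMap (h : IsTubeFrame ι φ p) :
    ∃ A : (Fin r → ℂ) →ₗ[ℂ] E, ∀ u, ι.d p u = A (dEmb (Fin r → ℂ) F φ p u) := by
  choose x hx using fun k : Fin r => h.exists_real (Pi.single k 1)
  exact ⟨_, h.apply_eq_linearCombination (Q := (ι.d p : TangentSpace 𝓘(ℝ, F) p →ₗ[ℝ] E))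
    (fun _ _ hvw => hvw) hx⟩

theorem injective_of_d_eq (h : IsTubeFrame ι φ p) {A : (Fin r → ℂ) →ₗ[ℂ] E}
    (hA : ∀ u, ι.d p u = A (dEmb (Fin r → ℂ) F φ p u)) : Function.Injective A := by
  refine (injective_iff_map_eq_zero A).2 fun z hz => ?_
  obtain ⟨s, hs⟩ := h.exists_real (rePi z)
  obtain ⟨t, ht⟩ := h.exists_real (imPi z)
  have hJ : IsJ ι p t (-s) := by
    change ι.d p (-s) = Complex.I • ι.d p t
    rw [map_neg, hA, hA, hs, ht, ← map_smul, neg_eq_iff_add_eq_zero, ← map_add,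
      ofRealPi_rePi_add_I_smul_ofRealPi_imPi, hz]
  have hφ := (h.cr _ _).1 hJ
  rwa [map_neg, hs, ht, neg_eq_iff_add_eq_zero, ofRealPi_rePi_add_I_smul_ofRealPi_imPi] at hφ

theorem exists_linearEquiv (h : IsTubeFrame ι φ p) :
    ∃ A : (Fin r → ℂ) ≃ₗ[ℂ] E, ∀ u, ι.d p u = A (dEmb (Fin r → ℂ) F φ p u) := by
  obtain ⟨A, hA⟩ := h.exists_linearMap
  refine ⟨LinearEquiv.ofBijective A ⟨h.injective_of_d_eq hA, ?_⟩, hA⟩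
  rw [← LinearMap.range_eq_top, eq_top_iff, ← ι.generic p, Submodule.span_le]
  rintro _ ⟨u, rfl⟩
  exact ⟨_, (hA u).symm⟩

theorem finrank_eq (h : IsTubeFrame ι φ p) : Module.finrank ℂ E = r := by
  obtain ⟨A, -⟩ := h.exists_linearEquiv
  rw [← A.finrank_eq, Module.finrank_fin_fun]

theorem finrank_ker_rePi_comp [FiniteDimensional ℝ F] (h : IsTubeFrame ι φ p) :
    Module.finrank ℝ (rePi ∘L dEmb (Fin r → ℂ) F φ p : F →L[ℝ] Fin r → ℝ).ker = crDim ι p := by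
  have hsurj : (rePi ∘L dEmb (Fin r → ℂ) F φ p : F →L[ℝ] Fin r → ℝ).range = ⊤ := by
    refine LinearMap.range_eq_top.2 fun v => ?_
    obtain ⟨u, hu⟩ := h.exists_real v
    exact ⟨u, (congrArg rePi hu).trans (rePi_ofRealPi v)⟩
  have hrank := LinearMap.finrank_range_add_finrank_ker
    (rePi ∘L dEmb (Fin r → ℂ) F φ p : F →L[ℝ] Fin r → ℝ).toLinearMap
  rw [hsurj, finrank_top, Module.finrank_fin_fun, ← crDim_add_finrank ι p, h.finrank_eq] at hrank
  omega

end IsTubeFrame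

end TubeFrame

section CRIso

variable {E : Type*} [NormedAddCommGroup E] [NormedSpace ℂ E]
  {Z : Type*} [TopologicalSpace Z] [ChartedSpace E Z]
  {F : Type*} [NormedAddCommGroup F] [NormedSpace ℝ F]
  {M : Type*} [TopologicalSpace M] [ChartedSpace F M]
  {ι : GenericEmbedding E Z F M} {a : M} {r r' : ℕ} {φ : M → Fin r → ℂ} {φ' : M → Fin r' → ℂ}
  {T : Set (Fin r → ℂ)} {T' : Set (Fin r' → ℂ)} {B : Set (Fin r → ℝ)} {ψ : (Fin r → ℂ) → M}

theorem add_ofRealPi_mem_tube_iff {z : Fin r → ℂ} (v : Fin r → ℝ) :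
    z + ofRealPi v ∈ tube B ↔ z ∈ tube B := by
  rw [mem_tube_iff, mem_tube_iff, map_add, imPi_ofRealPi, add_zero]

theorem tendsto_nhds_of_map_eq {g : M → M} (hg : ContinuousAt g a) (hga : g a = a) :
    Tendsto g (𝓝 a) (𝓝 a) := by
  simpa only [ContinuousAt, hga] using hg

theorem IsCRGerm.tendsto {g : M → M} (hg : IsCRGerm ι a g) : Tendsto g (𝓝 a) (𝓝 a) :=
  tendsto_nhds_of_map_eq hg.analytic.continuousAt hg.map_base

theorem IsInvolution.tendsto {τ : M → M} (hτ : IsInvolution ι a τ) : Tendsto τ (𝓝 a) (𝓝 a) :=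
  tendsto_nhds_of_map_eq hτ.analytic.continuousAt hτ.map_base

/-- `ψ` represents the inverse of the germ `φ : (M, a) → (T, φ a)`. It is defined and analytic near
`φ a` in the whole of `ℂ^r`, but inverts `φ` only along `T`. -/
structure IsInverseGerm (F : Type*) [NormedAddCommGroup F] [NormedSpace ℝ F] {M : Type*}
    [TopologicalSpace M] [ChartedSpace F M] (a : M) (φ : M → Fin r → ℂ) (T : Set (Fin r → ℂ))
    (ψ : (Fin r → ℂ) → M) : Prop where
  analytic : ContMDiffAt 𝓘(ℝ, Fin r → ℂ) 𝓘(ℝ, F) ω ψ (φ a)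
  left_inv : ∀ᶠ p in 𝓝 a, ψ (φ p) = p
  right_inv : ∀ᶠ z in 𝓝[T] (φ a), φ (ψ z) = z

theorem IsInverseGerm.tendsto (hψ : IsInverseGerm F a φ T ψ) : Tendsto ψ (𝓝 (φ a)) (𝓝 a) := by
  simpa only [ContinuousAt, hψ.left_inv.self_of_nhds] using hψ.analytic.continuousAt

namespace IsCRIsoOnto

theorem exists_isInverseGerm (H : IsCRIsoOnto ι a φ T) : ∃ ψ, IsInverseGerm F a φ T ψ :=
  let ⟨ψ, hψ, hleft, hright⟩ := H.inverse
  ⟨ψ, hψ, hleft, hright⟩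

theorem tendsto (H : IsCRIsoOnto ι a φ T) : Tendsto φ (𝓝 a) (𝓝[T] (φ a)) :=
  tendsto_nhdsWithin_iff.2 ⟨H.analytic.continuousAt, H.mapsTo⟩

theorem eventually_eq (H : IsCRIsoOnto ι a φ T) {Y : Type*} {l : Filter Y} {f g : Y → M}
    (hf : Tendsto f l (𝓝 a)) (hg : Tendsto g l (𝓝 a))
    (h : ∀ᶠ y in l, φ (f y) = φ (g y)) : f =ᶠ[l] g := by
  obtain ⟨ψ, hψ⟩ := H.exists_isInverseGerm
  filter_upwards [hf.eventually hψ.left_inv, hg.eventually hψ.left_inv, h] with y hfy hgy hy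
  rw [← hfy, hy, hgy]

theorem exists_lift (H : IsCRIsoOnto ι a φ T) (H' : IsCRIsoOnto ι a φ' T')
    {S : (Fin r → ℂ) → Fin r' → ℂ} (hS : ContDiffAt ℝ ω S (φ a)) (hSa : S (φ a) = φ' a)
    (hST : ∀ᶠ z in 𝓝[T] (φ a), S z ∈ T') :
    ∃ g : M → M, g a = a ∧ ContMDiffAt 𝓘(ℝ, F) 𝓘(ℝ, F) ω g a ∧
      ∀ᶠ p in 𝓝 a, φ' (g p) = S (φ p) := by
  obtain ⟨ψ, hψ⟩ := H'.exists_isInverseGerm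
  have hStendsto : Tendsto S (𝓝[T] (φ a)) (𝓝[T'] (φ' a)) :=
    tendsto_nhdsWithin_iff.2
      ⟨hSa ▸ hS.continuousAt.tendsto.mono_left nhdsWithin_le_nhds, hST⟩
  refine ⟨fun p => ψ (S (φ p)), ?_, ?_, (hStendsto.comp H.tendsto).eventually hψ.right_inv⟩
  · simpa only [hSa] using hψ.left_inv.self_of_nhds
  · exact ContMDiffAt.comp_of_eq (g := ψ) (f := S ∘ φ) hψ.analytic
      (hS.contMDiffAt.comp a H.analytic) hSa

end IsCRIsoOnto

/-- The pullback of the real translation `v` along `φ`, with local inverse `ψ`. -/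
def translationField (F : Type*) [NormedAddCommGroup F] [NormedSpace ℝ F] {M : Type*}
    [TopologicalSpace M] [ChartedSpace F M] (φ : M → Fin r → ℂ) (ψ : (Fin r → ℂ) → M)
    (v : Fin r → ℝ) (p : M) : F :=
  mfderiv 𝓘(ℝ, Fin r → ℂ) 𝓘(ℝ, F) ψ (φ p) (ofRealPi v)

theorem fderiv_apply_eq_self_of_eventually {V : Type*} [NormedAddCommGroup V] [NormedSpace ℝ V]
    {g : V → V} {z v : V} (hg : DifferentiableAt ℝ g z)
    (h : ∀ᶠ t : ℝ in 𝓝 0, g (z + t • v) = z + t • v) : fderiv ℝ g z v = v := by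
  have hline : HasDerivAt (fun t : ℝ => z + t • v) v 0 := by
    simpa using ((hasDerivAt_id (0 : ℝ)).smul_const v).const_add z
  exact (hg.hasFDerivAt.hasLineDerivAt v).unique (hline.congr_of_eventuallyEq h)

variable [IsManifold 𝓘(ℝ, F) ω M]

theorem IsCRIsoOnto.eventually_dEmb_translationField (H : IsCRIsoOnto ι a φ (tube B))
    (hψ : IsInverseGerm F a φ (tube B) ψ) :
    ∀ᶠ p in 𝓝 a, ∀ v : Fin r → ℝ,
      dEmb (Fin r → ℂ) F φ p (translationField F φ ψ v p) = ofRealPi v := by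
  have hright : ∀ᶠ z in 𝓝 (φ a), ∀ᶠ y in 𝓝 z, y ∈ tube B → φ (ψ y) = y :=
    (eventually_nhdsWithin_iff.1 hψ.right_inv).eventually_nhds
  filter_upwards [H.mapsTo, hψ.left_inv, eventually_mdifferentiableAt H.analytic,
    H.analytic.continuousAt.eventually (eventually_mdifferentiableAt hψ.analytic),
    H.analytic.continuousAt.eventually hright] with p hp hψφ hφd hψd hφψ v
  have hφd' : MDifferentiableAt 𝓘(ℝ, F) 𝓘(ℝ, Fin r → ℂ) φ (ψ (φ p)) := by rwa [hψφ]
  have hline : Tendsto (fun t : ℝ => φ p + t • ofRealPi v) (𝓝 0) (𝓝 (φ p)) :=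
    Continuous.tendsto' (by fun_prop) _ _ (by simp)
  have hself : fderiv ℝ (φ ∘ ψ) (φ p) (ofRealPi v) = ofRealPi v := by
    refine fderiv_apply_eq_self_of_eventually (hφd'.comp _ hψd).differentiableAt ?_
    filter_upwards [hline.eventually hφψ] with t ht
    refine ht ?_
    rw [← map_smul]
    exact (add_ofRealPi_mem_tube_iff _).2 hp
  calc dEmb (Fin r → ℂ) F φ p (translationField F φ ψ v p)
      = dEmb (Fin r → ℂ) F φ (ψ (φ p)) (translationField F φ ψ v p) := by rw [hψφ]
    _ = dEmb (Fin r → ℂ) (Fin r → ℂ) (φ ∘ ψ) (φ p) (ofRealPi v) := (dEmb_comp hφd' hψd _).symm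
    _ = ofRealPi v := (congrArg (fun A : (Fin r → ℂ) →L[ℝ] Fin r → ℂ => A (ofRealPi v))
      mfderiv_eq_fderiv).trans hself

theorem IsCRIsoOnto.eventually_isTubeFrame (H : IsCRIsoOnto ι a φ (tube B)) :
    ∀ᶠ p in 𝓝 a, IsTubeFrame ι φ p := by
  obtain ⟨ψ, hψ⟩ := H.exists_isInverseGerm
  filter_upwards [hψ.left_inv.eventually_nhds, eventually_mdifferentiableAt H.analytic,
    H.analytic.continuousAt.eventually (eventually_mdifferentiableAt hψ.analytic), H.cr,
    H.eventually_dEmb_translationField hψ] with p hψφ hφd hψd hcr htranslation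
  refine ⟨hφd, fun u v huv => ?_, fun v => ⟨_, htranslation v⟩, hcr⟩
  have hid : HasMFDerivAt 𝓘(ℝ, F) 𝓘(ℝ, F) id p _ :=
    (hψd.hasMFDerivAt.comp p hφd.hasMFDerivAt).congr_of_eventuallyEq (hψφ.mono fun _ hq => hq.symm)
  have hleft : ∀ w : F, (mfderiv 𝓘(ℝ, Fin r → ℂ) 𝓘(ℝ, F) ψ (φ p) : (Fin r → ℂ) →L[ℝ] F)
      (dEmb (Fin r → ℂ) F φ p w) = w := fun w =>
    congrArg (fun A : F →L[ℝ] F => A w) (hasMFDerivAt_unique hid (hasMFDerivAt_id p))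
  rw [← hleft u, ← hleft v, huv]

end CRIso

section Reflections

variable {E : Type*} [NormedAddCommGroup E] [NormedSpace ℂ E]
  {Z : Type*} [TopologicalSpace Z] [ChartedSpace E Z]
  {F : Type*} [NormedAddCommGroup F] [NormedSpace ℝ F]
  {M : Type*} [TopologicalSpace M] [ChartedSpace F M] [IsManifold 𝓘(ℝ, F) ω M]
  {ι : GenericEmbedding E Z F M} {a : M} {r r' : ℕ} {φ : M → Fin r → ℂ} {φ' : M → Fin r' → ℂ}
  {B : Set (Fin r → ℝ)}

theorem eventually_dEmb_lift (hφ : ContMDiffAt 𝓘(ℝ, F) 𝓘(ℝ, Fin r → ℂ) ω φ a)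
    (hφ' : ContMDiffAt 𝓘(ℝ, F) 𝓘(ℝ, Fin r' → ℂ) ω φ' a) {g : M → M} (hga : g a = a)
    (hg : ContMDiffAt 𝓘(ℝ, F) 𝓘(ℝ, F) ω g a) {S : (Fin r → ℂ) → Fin r' → ℂ}
    {S' : (Fin r → ℂ) →L[ℝ] Fin r' → ℂ} (hS : ∀ z, HasFDerivAt S S' z)
    (h : ∀ᶠ p in 𝓝 a, φ' (g p) = S (φ p)) :
    ∀ᶠ p in 𝓝 a, ∀ u : TangentSpace 𝓘(ℝ, F) p,
      dEmb (Fin r' → ℂ) F φ' (g p) (mfderiv 𝓘(ℝ, F) 𝓘(ℝ, F) g p u) =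
        S' (dEmb (Fin r → ℂ) F φ p u) := by
  filter_upwards [h.eventually_nhds, eventually_mdifferentiableAt hφ,
    (tendsto_nhds_of_map_eq hg.continuousAt hga).eventually (eventually_mdifferentiableAt hφ'),
    eventually_mdifferentiableAt hg] with p hcomp hφp hφ'p hgp u
  rw [← dEmb_comp hφ'p hgp, dEmb_congr (f := φ' ∘ g) (f' := S ∘ φ) hcomp,
    dEmb_comp_left (hS _).differentiableAt hφp, (hS _).fderiv]

/-- `τ` reverses the real translations of the tube realization `φ`. -/
def ReversesTranslations (φ : M → Fin r → ℂ) (τ : M → M) (p : M) : Prop :=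
  ∀ (v : Fin r → ℝ) (u : TangentSpace 𝓘(ℝ, F) p), dEmb (Fin r → ℂ) F φ p u = ofRealPi v →
    dEmb (Fin r → ℂ) F φ (τ p) (mfderiv 𝓘(ℝ, F) 𝓘(ℝ, F) τ p u) = -ofRealPi v

namespace IsCRIsoOnto

theorem exists_reflection (H : IsCRIsoOnto ι a φ (tube B)) :
    ∃ τ : M → M, IsInvolution ι a τ ∧ ∀ᶠ p in 𝓝 a, φ (τ p) = reflect (rePi (φ a)) (φ p) := by
  have hpreserves : ∀ᶠ z in 𝓝[tube B] (φ a), reflect (rePi (φ a)) z ∈ tube B := by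
    filter_upwards [self_mem_nhdsWithin] with z hz
    rw [mem_tube_iff, imPi_reflect]
    exact hz
  obtain ⟨τ, hτa, hτ, hφτ⟩ := H.exists_lift H (S := reflect (rePi (φ a)))
    (contDiff_reflect _).contDiffAt (reflect_eq_iff.2 rfl) hpreserves
  have hτtendsto := tendsto_nhds_of_map_eq hτ.continuousAt hτa
  refine ⟨τ, ⟨hτa, hτ, ?_, ?_⟩, hφτ⟩
  · filter_upwards [H.eventually_isTubeFrame, hτtendsto.eventually H.eventually_isTubeFrame,
      eventually_dEmb_lift H.analytic H.analytic hτa hτ (hasFDerivAt_reflect _) hφτ]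
      with p hp hτp hd v w hvw
    rw [hτp.cr, map_neg, hd, hd, (hp.cr v w).1 hvw, negConj_I_smul, neg_smul, neg_neg]
  · refine H.eventually_eq (hτtendsto.comp hτtendsto) tendsto_id ?_
    filter_upwards [hφτ, hτtendsto.eventually hφτ] with p hp hτp
    exact hτp.trans ((congrArg _ hp).trans (reflect_reflect _ _))

theorem eventually_reversesTranslations (H : IsCRIsoOnto ι a φ (tube B)) {τ : M → M}
    (hτ : IsInvolution ι a τ) {c : Fin r → ℝ} (hφτ : ∀ᶠ p in 𝓝 a, φ (τ p) = reflect c (φ p)) :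
    ∀ᶠ p in 𝓝 a, ReversesTranslations (F := F) φ τ p := by
  filter_upwards [eventually_dEmb_lift H.analytic H.analytic hτ.map_base hτ.analytic
    (hasFDerivAt_reflect c) hφτ] with p hp v u hu
  rw [hp, hu, negConj_ofRealPi]

theorem eventually_eq_reflect (H : IsCRIsoOnto ι a φ (tube B)) {τ : M → M}
    (hτ : IsInvolution ι a τ) (hneg : ∀ᶠ p in 𝓝 a, ReversesTranslations (F := F) φ τ p) :
    ∀ᶠ p in 𝓝 a, φ (τ p) = reflect (rePi (φ a)) (φ p) := by
  set c := rePi (φ a)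
  have hframe := H.eventually_isTubeFrame
  have hτd := eventually_mdifferentiableAt hτ.analytic
  refine eventually_eq_of_dEmb_eq (F := F) (f := φ ∘ τ) (f' := reflect c ∘ φ) ?_ ?_ ?_ ?_
  · filter_upwards [hτ.tendsto.eventually hframe, hτd] with p hp hτp using hp.mdiff.comp p hτp
  · filter_upwards [hframe] with p hp
    exact (hasFDerivAt_reflect c _).differentiableAt.mdifferentiableAt.comp p hp.mdiff
  · filter_upwards [hframe, hτ.tendsto.eventually hframe, hneg, hτ.antiCR, hτd]
      with p hp hτp hnegp hanti hτdp u
    rw [dEmb_comp hτp.mdiff hτdp,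
      dEmb_comp_left (hasFDerivAt_reflect c _).differentiableAt hp.mdiff,
      (hasFDerivAt_reflect c _).fderiv]
    obtain ⟨x, y, k, hx, hy, hu, hyk⟩ := hp.exists_split u
    have hk := (hτp.cr _ _).1 (hanti y k hyk)
    rw [map_neg, hnegp _ y hy, smul_neg, neg_inj] at hk
    rw [negConj_apply, ← hnegp _ x hx, ← hk, ← map_add, ← map_add, ← hu]
  · rw [Function.comp_apply, Function.comp_apply, hτ.map_base, reflect_eq_iff.2 rfl]

end IsCRIsoOnto

end Reflections

section TranslationFlow

variable {E : Type*} [NormedAddCommGroup E] [NormedSpace ℂ E]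
  {Z : Type*} [TopologicalSpace Z] [ChartedSpace E Z]
  {F : Type*} [NormedAddCommGroup F] [NormedSpace ℝ F]
  {M : Type*} [TopologicalSpace M] [ChartedSpace F M]
  {ι : GenericEmbedding E Z F M} {a p : M} {r : ℕ} {φ : M → Fin r → ℂ} {B : Set (Fin r → ℝ)}
  {ψ : (Fin r → ℂ) → M} {v : Fin r → ℝ} {t : ℝ}

/-- The flow of `translationField`: translation by `t • v`, read through `φ` with local inverse
`ψ`. -/
def translationFlow (φ : M → Fin r → ℂ) (ψ : (Fin r → ℂ) → M) (v : Fin r → ℝ) (t : ℝ) (p : M) :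
    M :=
  ψ (φ p + t • ofRealPi v)

/-- The translate of `p` by `t • v` exists in the domain of the tube realization `φ` with local
inverse `ψ`. This is an open condition on `(t, p)`, under which the flow can be studied
pointwise. -/
structure IsTranslatableAt (ι : GenericEmbedding E Z F M) (φ : M → Fin r → ℂ)
    (ψ : (Fin r → ℂ) → M) (v : Fin r → ℝ) (t : ℝ) (p : M) : Prop where
  analytic : ContMDiffAt 𝓘(ℝ, F) 𝓘(ℝ, Fin r → ℂ) ω φ p
  analytic_inverse : ContMDiffAt 𝓘(ℝ, Fin r → ℂ) 𝓘(ℝ, F) ω ψ (φ p + t • ofRealPi v)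
  left_inv : ψ (φ p) = p
  right_inv : φ (translationFlow φ ψ v t p) = φ p + t • ofRealPi v
  isTubeFrame : IsTubeFrame ι φ p
  isTubeFrame_flow : IsTubeFrame ι φ (translationFlow φ ψ v t p)

namespace IsTranslatableAt

theorem hasMFDerivAt_translationFlow (h : IsTranslatableAt ι φ ψ v t p) :
    HasMFDerivAt 𝓘(ℝ, ℝ) 𝓘(ℝ, F) (fun s => translationFlow φ ψ v s p) t
      ((1 : ℝ →L[ℝ] ℝ).smulRight
        (translationField F φ ψ v (translationFlow φ ψ v t p) : F)) := by
  have hline : HasFDerivAt (fun s : ℝ => φ p + s • ofRealPi v)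
      ((1 : ℝ →L[ℝ] ℝ).smulRight (ofRealPi v)) t :=
    ((hasFDerivAt_id t).smul_const (ofRealPi v)).const_add (φ p)
  refine (HasMFDerivAt.comp t (h.analytic_inverse.mdifferentiableAt (by simp)).hasMFDerivAt
    hline.hasMFDerivAt).congr_mfderiv ?_
  rw [translationField, h.right_inv]
  exact ContinuousLinearMap.ext fun s =>
    (mfderiv 𝓘(ℝ, Fin r → ℂ) 𝓘(ℝ, F) ψ (φ p + t • ofRealPi v) : (Fin r → ℂ) →L[ℝ] F).map_smul
      s (ofRealPi v)

theorem contMDiffAt_translationFlow (h : IsTranslatableAt ι φ ψ v t p) :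
    ContMDiffAt (𝓘(ℝ, ℝ).prod 𝓘(ℝ, F)) 𝓘(ℝ, F) ω
      (fun q : ℝ × M => translationFlow φ ψ v q.1 q.2) (t, p) :=
  ContMDiffAt.comp (g := ψ) (f := fun q : ℝ × M => φ q.2 + q.1 • ofRealPi v) (t, p)
    h.analytic_inverse ((h.analytic.comp (t, p) contMDiffAt_snd).add
      (contMDiffAt_fst.smul contMDiffAt_const))

theorem mdifferentiableAt_translationFlow (h : IsTranslatableAt ι φ ψ v t p) :
    MDifferentiableAt 𝓘(ℝ, F) 𝓘(ℝ, F) (translationFlow φ ψ v t) p :=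
  MDifferentiableAt.comp p (h.analytic_inverse.mdifferentiableAt (by simp))
    ((h.analytic.add contMDiffAt_const).mdifferentiableAt (by simp))

theorem dEmb_mfderiv_translationFlow (h : ∀ᶠ q in 𝓝 p, IsTranslatableAt ι φ ψ v t q)
    (u : TangentSpace 𝓘(ℝ, F) p) :
    dEmb (Fin r → ℂ) F φ (translationFlow φ ψ v t p)
      (mfderiv 𝓘(ℝ, F) 𝓘(ℝ, F) (translationFlow φ ψ v t) p u) = dEmb (Fin r → ℂ) F φ p u := by
  have hp := h.self_of_nhds
  rw [← dEmb_comp hp.isTubeFrame_flow.mdiff hp.mdifferentiableAt_translationFlow,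
    dEmb_congr (f := φ ∘ translationFlow φ ψ v t) (f' := (fun z => z + t • ofRealPi v) ∘ φ)
      (h.mono fun q hq => hq.right_inv),
    dEmb_comp_left (S := fun z => z + t • ofRealPi v) (by fun_prop) hp.isTubeFrame.mdiff,
    fderiv_add_const, fderiv_fun_id, ContinuousLinearMap.id_apply]

theorem isCRAt_translationFlow (h : ∀ᶠ q in 𝓝 p, IsTranslatableAt ι φ ψ v t q) :
    IsCRAt ι (translationFlow φ ψ v t) p := by
  intro x y hxy
  rw [h.self_of_nhds.isTubeFrame_flow.cr, dEmb_mfderiv_translationFlow h,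
    dEmb_mfderiv_translationFlow h]
  exact (h.self_of_nhds.isTubeFrame.cr x y).1 hxy

end IsTranslatableAt

variable [IsManifold 𝓘(ℝ, F) ω M]

theorem IsCRIsoOnto.eventually_isTranslatableAt (H : IsCRIsoOnto ι a φ (tube B))
    (hψ : IsInverseGerm F a φ (tube B) ψ) (v : Fin r → ℝ) :
    ∀ᶠ q in 𝓝 ((0 : ℝ), a), IsTranslatableAt ι φ ψ v q.1 q.2 := by
  have hsnd : Tendsto (fun q : ℝ × M => q.2) (𝓝 ((0 : ℝ), a)) (𝓝 a) :=
    continuousAt_snd.tendsto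
  have htranslate : Tendsto (fun q : ℝ × M => φ q.2 + q.1 • ofRealPi v) (𝓝 ((0 : ℝ), a))
      (𝓝 (φ a)) := by
    have hcont : ContinuousAt (fun q : ℝ × M => φ q.2 + q.1 • ofRealPi v) ((0 : ℝ), a) :=
      (ContinuousAt.comp (f := fun q : ℝ × M => q.2) H.analytic.continuousAt
        continuousAt_snd).add (continuousAt_fst.smul continuousAt_const)
    simpa only [ContinuousAt, zero_smul, add_zero] using hcont
  filter_upwards [hsnd.eventually ((contMDiffAt_iff_contMDiffAt_nhds (by simp)).1 H.analytic),
    htranslate.eventually ((contMDiffAt_iff_contMDiffAt_nhds (by simp)).1 hψ.analytic),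
    hsnd.eventually hψ.left_inv, hsnd.eventually H.mapsTo,
    htranslate.eventually (eventually_nhdsWithin_iff.1 hψ.right_inv),
    hsnd.eventually H.eventually_isTubeFrame,
    (hψ.tendsto.comp htranslate).eventually H.eventually_isTubeFrame]
    with q hφ hψq hleft hmem hright hframe hframe'
  refine ⟨hφ, hψq, hleft, hright ?_, hframe, hframe'⟩
  rw [← map_smul]
  exact (add_ofRealPi_mem_tube_iff _).2 hmem

theorem contDiffAt_comp_extChartAt_symm {V : Type*} [NormedAddCommGroup V] [NormedSpace ℝ V]
    {f : M → V} (hf : ContMDiffAt 𝓘(ℝ, F) 𝓘(ℝ, V) ω f a) :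
    ContDiffAt ℝ ω (f ∘ (extChartAt 𝓘(ℝ, F) a).symm) (extChartAt 𝓘(ℝ, F) a a) :=
  (ContMDiffAt.comp_of_eq (g := f) hf
    (contMDiffAt_extChartAt_symm_of_mem (mem_extChartAt_target a))
    (extChartAt_to_inv a)).contDiffAt

variable [CompleteSpace F]

theorem isAnalyticFieldAt_translationField {T : Set (Fin r → ℂ)}
    (hφ : ContMDiffAt 𝓘(ℝ, F) 𝓘(ℝ, Fin r → ℂ) ω φ a) (hψ : IsInverseGerm F a φ T ψ)
    (v : Fin r → ℝ) : IsAnalyticFieldAt (F := F) a (translationField F φ ψ v) := by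
  set κ := extChartAt 𝓘(ℝ, F) a
  have hκψ : ContDiffAt ℝ ω (κ ∘ ψ) (φ a) :=
    (ContMDiffAt.comp_of_eq (g := κ) (f := ψ) contMDiffAt_extChartAt hψ.analytic
      hψ.left_inv.self_of_nhds).contDiffAt
  have hfield : ContDiffAt ℝ ω (fun x => fderiv ℝ (κ ∘ ψ) (φ (κ.symm x)) (ofRealPi v)) (κ a) := by
    refine (ContDiffAt.comp (g := fderiv ℝ (κ ∘ ψ)) (f := φ ∘ κ.symm) (κ a) ?_
      (contDiffAt_comp_extChartAt_symm hφ)).clm_apply contDiffAt_const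
    rw [Function.comp_apply, extChartAt_to_inv]
    exact hκψ.fderiv_right (m := ω) le_rfl
  refine isAnalyticFieldAt_of_mfderiv_extChartAt hfield ?_
  filter_upwards [extChartAt_source_mem_nhds (I := 𝓘(ℝ, F)) a, hψ.left_inv,
    hφ.continuousAt.eventually (eventually_mdifferentiableAt hψ.analytic)] with p hp hψφ hψp
  have hκp : MDifferentiableAt 𝓘(ℝ, F) 𝓘(ℝ, F) κ (ψ (φ p)) := by
    rw [hψφ]
    exact mdifferentiableAt_extChartAt (by simpa using hp)
  have hchain := congrArg (fun A : (Fin r → ℂ) →L[ℝ] F => A (ofRealPi v))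
    (mfderiv_eq_fderiv.symm.trans (mfderiv_comp (φ p) hκp hψp))
  rw [κ.left_inv hp]
  refine Eq.trans ?_ hchain.symm
  change mfderiv 𝓘(ℝ, F) 𝓘(ℝ, F) κ p (translationField F φ ψ v p) =
    mfderiv 𝓘(ℝ, F) 𝓘(ℝ, F) κ (ψ (φ p)) (translationField F φ ψ v p)
  rw [hψφ]

theorem IsCRIsoOnto.isInfinitesimalCR (H : IsCRIsoOnto ι a φ (tube B))
    (hψ : IsInverseGerm F a φ (tube B) ψ) (v : Fin r → ℝ) :
    IsInfinitesimalCR ι a (translationField F φ ψ v) := by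
  obtain ⟨I, hI, U, hU, hIU⟩ := mem_nhds_prod_iff.1 (H.eventually_isTranslatableAt hψ v)
  obtain ⟨ε, hε, hεI⟩ := Metric.mem_nhds_iff.1 hI
  obtain ⟨W, hWU, hW, haW⟩ := mem_nhds_iff.1 hU
  rw [Real.ball_eq_Ioo, zero_sub, zero_add] at hεI
  have hflow : ∀ t ∈ Ioo (-ε) ε, ∀ p ∈ W, IsTranslatableAt ι φ ψ v t p := fun t ht p hp =>
    hIU (mk_mem_prod (hεI ht) (hWU hp))
  refine ⟨isAnalyticFieldAt_translationField H.analytic hψ v, translationFlow φ ψ v, W, ε, hW,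
    haW, hε, fun p hp => ?_, fun p hp t ht =>
      (hflow t ht p hp).hasMFDerivAt_translationFlow.hasMFDerivWithinAt,
    fun q hq => (hflow q.1 hq.1 q.2 hq.2).contMDiffAt_translationFlow.contMDiffWithinAt,
    fun t ht p hp => IsTranslatableAt.isCRAt_translationFlow ?_⟩
  · rw [translationFlow, zero_smul, add_zero]
    exact (hflow 0 ⟨neg_lt_zero.2 hε, hε⟩ p hp).left_inv
  · filter_upwards [hW.mem_nhds hp] with q hq using hflow t ht q hq

end TranslationFlow

section ConstantFields

variable {V : Type*} [NormedAddCommGroup V] [NormedSpace ℂ V]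
  {F : Type*} [NormedAddCommGroup F] [NormedSpace ℝ F]
  {M : Type*} [TopologicalSpace M] [ChartedSpace F M] [IsManifold 𝓘(ℝ, F) ω M]
  {f : M → V} {a : M} {X Y : ∀ p : M, TangentSpace 𝓘(ℝ, F) p} {v w : V}

theorem along_chartField {x : F} (hx : x ∈ (extChartAt 𝓘(ℝ, F) a).target)
    (hf : MDifferentiableAt 𝓘(ℝ, F) 𝓘(ℝ, V) f ((extChartAt 𝓘(ℝ, F) a).symm x)) :
    along (f ∘ (extChartAt 𝓘(ℝ, F) a).symm) (chartField a X) x =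
      dEmb V F f ((extChartAt 𝓘(ℝ, F) a).symm x) (X ((extChartAt 𝓘(ℝ, F) a).symm x)) := by
  rw [along, fderiv_comp_extChartAt_symm_apply hx hf, mfderiv_chartField hx]

theorem eventually_along_chartField_eq (hf : ContMDiffAt 𝓘(ℝ, F) 𝓘(ℝ, V) ω f a)
    (hv : ∀ᶠ p in 𝓝 a, dEmb V F f p (X p) = v) :
    ∀ᶠ x in 𝓝 (extChartAt 𝓘(ℝ, F) a a),
      along (f ∘ (extChartAt 𝓘(ℝ, F) a).symm) (chartField a X) x = v := by
  filter_upwards [eventually_mem_extChartAt_target F a,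
    (tendsto_extChartAt_symm F a).eventually hv,
    (tendsto_extChartAt_symm F a).eventually (eventually_mdifferentiableAt hf)]
    with x hx hvx hfx
  rw [along_chartField hx hfx, hvx]

theorem mlieBracket_eq_zero_of_dEmb_eq [CompleteSpace F]
    (hf : ContMDiffAt 𝓘(ℝ, F) 𝓘(ℝ, V) ω f a)
    (hinj : ∀ᶠ p in 𝓝 a, ∀ u v : TangentSpace 𝓘(ℝ, F) p, dEmb V F f p u = dEmb V F f p v → u = v)
    (hX : IsAnalyticFieldAt a X) (hY : IsAnalyticFieldAt a Y)
    (hv : ∀ᶠ p in 𝓝 a, dEmb V F f p (X p) = v) (hw : ∀ᶠ p in 𝓝 a, dEmb V F f p (Y p) = w) :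
    ∀ᶠ p in 𝓝 a, VectorField.mlieBracket 𝓘(ℝ, F) X Y p = 0 := by
  rw [mlieBracket_eq_zero_iff_chartField hX hY]
  filter_upwards [(eventually_along_chartField_eq hf hv).eventually_nhds,
    (eventually_along_chartField_eq hf hw).eventually_nhds,
    (contDiffAt_comp_extChartAt_symm hf).eventually (by simp),
    (contDiffAt_chartField hX).eventually (by simp),
    (contDiffAt_chartField hY).eventually (by simp), eventually_mem_extChartAt_target F a,
    (tendsto_extChartAt_symm F a).eventually hinj,
    (tendsto_extChartAt_symm F a).eventually (eventually_mdifferentiableAt hf)]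
    with x hvx hwx hfx hXx hYx hx hinjx hfdx
  have hbracket := fderiv_lieBracket_apply (hfx.of_le le_top) (hXx.differentiableAt (by simp))
    (hYx.differentiableAt (by simp))
  rw [EventuallyEq.fderiv_eq (f := fun _ => w) hwx, EventuallyEq.fderiv_eq (f := fun _ => v) hvx,
    fderiv_const_apply, fderiv_const_apply, zero_apply,
    zero_apply, sub_zero,
    fderiv_comp_extChartAt_symm_apply hx hfdx] at hbracket
  refine (isInvertible_mfderiv_extChartAt_symm_of_mem hx).injective
    (hinjx _ _ (hbracket.trans ?_))
  exact (map_zero (dEmb V F f ((extChartAt 𝓘(ℝ, F) a).symm x) ∘L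
    mfderiv 𝓘(ℝ, F) 𝓘(ℝ, F) (extChartAt 𝓘(ℝ, F) a).symm x : F →L[ℝ] V)).symm

end ConstantFields

section TranslationAlgebra

variable {E : Type*} [NormedAddCommGroup E] [NormedSpace ℂ E]
  {Z : Type*} [TopologicalSpace Z] [ChartedSpace E Z]
  {F : Type*} [NormedAddCommGroup F] [NormedSpace ℝ F]
  {M : Type*} [TopologicalSpace M] [ChartedSpace F M]
  {ι : GenericEmbedding E Z F M} {a : M}

namespace TubeRealization

theorem germ_mem_iff (R : TubeRealization ι a) {X : ∀ p : M, TangentSpace 𝓘(ℝ, F) p} :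
    germ a X ∈ R.translationAlgebra ↔
      ∃ v : Fin R.r → ℝ, ∀ᶠ p in 𝓝 a, dEmb (Fin R.r → ℂ) F R.toFun p (X p) = ofRealPi v := by
  constructor
  · rintro ⟨X', hX', v, hv⟩
    refine ⟨v, ?_⟩
    filter_upwards [hv, germ_eq_iff.1 hX'] with p hp hXp
    rw [← hXp]
    exact hp
  · rintro ⟨v, hv⟩
    exact ⟨X, rfl, v, hv⟩

variable [IsManifold 𝓘(ℝ, F) ω M]

theorem exists_eventually_dEmb_eq (R : TubeRealization ι a) (v : Fin R.r → ℝ) :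
    ∃ X : ∀ p : M, TangentSpace 𝓘(ℝ, F) p, germ a X ∈ R.translationAlgebra ∧
      ∀ᶠ p in 𝓝 a, dEmb (Fin R.r → ℂ) F R.toFun p (X p) = ofRealPi v := by
  obtain ⟨ψ, hψ⟩ := R.isCRIsoOnto.exists_isInverseGerm
  have hX := (R.isCRIsoOnto.eventually_dEmb_translationField hψ).mono fun p hp => hp v
  exact ⟨_, R.germ_mem_iff.2 ⟨v, hX⟩, hX⟩

theorem inNegEigenspace_iff (R : TubeRealization ι a) {τ : M → M}
    (hτ : Tendsto τ (𝓝 a) (𝓝 a)) :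
    InNegEigenspace a τ R.translationAlgebra ↔
      ∀ᶠ p in 𝓝 a, ReversesTranslations (F := F) R.toFun τ p := by
  have hframe := R.isCRIsoOnto.eventually_isTubeFrame
  constructor
  · intro hneg
    choose X hX hXd using fun k => R.exists_eventually_dEmb_eq (Pi.single k 1)
    filter_upwards [hframe, eventually_all.2 hXd, hτ.eventually (eventually_all.2 hXd),
      eventually_all.2 fun k => hneg (X k) (hX k)] with p hp hXp hXτp hnegp v u hu
    have hmap : mfderiv 𝓘(ℝ, F) 𝓘(ℝ, F) τ p u = ∑ k, v k • -X k (τ p) := by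
      rw [hp.eq_sum hXp hu, map_sum]
      exact Finset.sum_congr rfl fun k _ =>
        ((mfderiv 𝓘(ℝ, F) 𝓘(ℝ, F) τ p).map_smul (v k) _).trans (congrArg (v k • ·) (hnegp k))
    rw [hmap, map_sum]
    conv_rhs => rw [pi_eq_sum_univ' v]
    simp only [map_smul, map_neg, hXτp, map_sum, smul_neg, Finset.sum_neg_distrib]
  · intro hrev X hX
    obtain ⟨v, hv⟩ := R.germ_mem_iff.1 hX
    filter_upwards [hrev, hv, hτ.eventually hv, hτ.eventually hframe] with p hrevp hp hτp hframep
    refine hframep.inj _ _ ?_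
    rw [hrevp v _ hp, map_neg, hτp]

theorem exists_isInvolutionFor (R : TubeRealization ι a) :
    ∃ τ, IsInvolutionFor ι a R.translationAlgebra τ := by
  obtain ⟨τ, hτ, hφτ⟩ := R.isCRIsoOnto.exists_reflection
  exact ⟨τ, hτ, (R.inNegEigenspace_iff hτ.tendsto).2
    (R.isCRIsoOnto.eventually_reversesTranslations hτ hφτ)⟩

theorem spansTangent (R : TubeRealization ι a) : SpansTangent ι a R.translationAlgebra := by
  obtain ⟨A, hA⟩ := R.isCRIsoOnto.eventually_isTubeFrame.self_of_nhds.exists_linearEquiv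
  have hreal : ∀ v : Fin R.r → ℝ, A (ofRealPi v) ∈ Submodule.span ℂ {x : E |
      ∃ X : (∀ p : M, TangentSpace 𝓘(ℝ, F) p), germ a X ∈ R.translationAlgebra ∧
        x = ι.d a (X a)} := by
    intro v
    obtain ⟨X, hX, hXv⟩ := R.exists_eventually_dEmb_eq v
    exact Submodule.subset_span ⟨X, hX, by rw [hA, hXv.self_of_nhds]⟩
  refine eq_top_iff.2 fun x _ => ?_
  obtain ⟨z, rfl⟩ := A.surjective x
  rw [← ofRealPi_rePi_add_I_smul_ofRealPi_imPi z, map_add, map_smul]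
  exact Submodule.add_mem _ (hreal _) (Submodule.smul_mem _ _ (hreal _))

variable [CompleteSpace F]

theorem exists_isInfinitesimalCR (R : TubeRealization ι a)
    {X : ∀ p : M, TangentSpace 𝓘(ℝ, F) p} (hX : germ a X ∈ R.translationAlgebra) :
    ∃ Y, germ a Y = germ a X ∧ IsInfinitesimalCR ι a Y := by
  obtain ⟨v, hv⟩ := R.germ_mem_iff.1 hX
  obtain ⟨ψ, hψ⟩ := R.isCRIsoOnto.exists_isInverseGerm
  refine ⟨_, germ_eq_iff.2 ?_, R.isCRIsoOnto.isInfinitesimalCR hψ v⟩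
  filter_upwards [hv, R.isCRIsoOnto.eventually_dEmb_translationField hψ,
    R.isCRIsoOnto.eventually_isTubeFrame] with p hp hψp hframe
  exact hframe.inj _ _ ((hψp v).trans hp.symm)

theorem isAnalyticFieldAt (R : TubeRealization ι a) {X : ∀ p : M, TangentSpace 𝓘(ℝ, F) p}
    (hX : germ a X ∈ R.translationAlgebra) : IsAnalyticFieldAt a X := by
  obtain ⟨Y, hYX, hY⟩ := R.exists_isInfinitesimalCR hX
  refine hY.analytic.congr_of_eventuallyEq ?_
  filter_upwards [germ_eq_iff.1 hYX] with p hp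
  rw [hp]

theorem isAbelianSubalgebra (R : TubeRealization ι a) :
    IsAbelianSubalgebra ι a R.translationAlgebra := by
  refine ⟨fun ξ hξ => ?_, fun X Y hX hY => ?_⟩
  · obtain ⟨X, rfl⟩ := Submodule.mkQ_surjective _ ξ
    exact R.exists_isInfinitesimalCR hξ
  · obtain ⟨v, hv⟩ := R.germ_mem_iff.1 hX
    obtain ⟨w, hw⟩ := R.germ_mem_iff.1 hY
    exact mlieBracket_eq_zero_of_dEmb_eq R.isCRIsoOnto.analytic
      (R.isCRIsoOnto.eventually_isTubeFrame.mono fun p hp => hp.inj)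
      (R.isAnalyticFieldAt hX) (R.isAnalyticFieldAt hY) hv hw

theorem isTubeSubalgebra (R : TubeRealization ι a) : IsTubeSubalgebra ι a R.translationAlgebra :=
  ⟨R.isAbelianSubalgebra, R.exists_isInvolutionFor, R.spansTangent⟩

end TubeRealization

end TranslationAlgebra

section EmbeddingChart

variable {E : Type*} [NormedAddCommGroup E] [NormedSpace ℂ E]
  {Z : Type*} [TopologicalSpace Z] [ChartedSpace E Z]

theorem exists_hasMFDerivAt_extChartAt [IsManifold 𝓘(ℂ, E) ω Z] {z₀ z : Z}
    (hz : z ∈ (chartAt E z₀).source) :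
    ∃ C : E ≃L[ℂ] E, HasMFDerivAt 𝓘(ℝ, E) 𝓘(ℝ, E) (extChartAt 𝓘(ℝ, E) z₀) z
      ((C : E →L[ℂ] E).restrictScalars ℝ) := by
  have hz' : z ∈ (extChartAt 𝓘(ℂ, E) z₀).source := by rwa [extChartAt_source]
  have hholo := (mdifferentiableAt_extChartAt (I := 𝓘(ℂ, E)) hz).hasMFDerivAt
  obtain ⟨C, hC⟩ := isInvertible_mfderiv_extChartAt (I := 𝓘(ℂ, E)) hz'
  rw [← hC] at hholo
  exact ⟨C, hholo.1, hholo.2.restrictScalars ℝ⟩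

variable {F : Type*} [NormedAddCommGroup F] [NormedSpace ℝ F]
  {M : Type*} [TopologicalSpace M] [ChartedSpace F M]

theorem hasDerivAt_comp_integralCurve {V : Type*} [NormedAddCommGroup V] [NormedSpace ℂ V]
    {X : ∀ p : M, TangentSpace 𝓘(ℝ, F) p} {f : M → V} {γ : ℝ → M} {t : ℝ}
    (hf : MDifferentiableAt 𝓘(ℝ, F) 𝓘(ℝ, V) f (γ t)) (hγ : IsMIntegralCurveAt γ X t) :
    HasDerivAt (f ∘ γ) (dEmb V F f (γ t) (X (γ t))) t := by
  have hcomp : HasFDerivAt (f ∘ γ) ((dEmb V F f (γ t) : F →L[ℝ] V) ∘L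
      ((1 : ℝ →L[ℝ] ℝ).smulRight (X (γ t) : F))) t :=
    (HasMFDerivAt.comp t hf.hasMFDerivAt hγ.hasMFDerivAt).hasFDerivAt
  have hderiv : HasDerivAt (f ∘ γ) (dEmb V F f (γ t) ((1 : ℝ) • X (γ t))) t := hcomp.hasDerivAt
  rwa [one_smul] at hderiv

/-- The embedding `M → Z`, read in the chart of `Z` at the image of `a`. -/
def embChart (ι : GenericEmbedding E Z F M) (a : M) : M → E :=
  extChartAt 𝓘(ℝ, E) (ι.toFun a) ∘ ι.toFun

/-- At `p`, the chart expression of the embedding is analytic and induces the CR-structure of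
`M`. -/
structure IsEmbChartAt (ι : GenericEmbedding E Z F M) (a p : M) : Prop where
  analytic : ContMDiffAt 𝓘(ℝ, F) 𝓘(ℝ, E) ω (embChart ι a) p
  isJ_iff : ∀ v w, IsJ ι p v w ↔
    dEmb E F (embChart ι a) p w = Complex.I • dEmb E F (embChart ι a) p v

variable {ι : GenericEmbedding E Z F M} {a : M}

theorem IsEmbChartAt.mdifferentiableAt {p : M} (h : IsEmbChartAt ι a p) :
    MDifferentiableAt 𝓘(ℝ, F) 𝓘(ℝ, E) (embChart ι a) p :=
  h.analytic.mdifferentiableAt (by simp)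

variable (ι a)

theorem contMDiffAt_embChart : ContMDiffAt 𝓘(ℝ, F) 𝓘(ℝ, E) ω (embChart ι a) a :=
  (contMDiffAt_iff_target.1 (ι.analytic a)).2

theorem eventually_dEmb_embChart [IsManifold 𝓘(ℂ, E) ω Z] : ∀ᶠ p in 𝓝 a, ∃ C : E ≃L[ℂ] E,
    ∀ u, dEmb E F (embChart ι a) p u = C (ι.d p u) := by
  filter_upwards [(ι.analytic a).continuousAt.eventually (chart_source_mem_nhds E (ι.toFun a))]
    with p hp
  obtain ⟨C, hC⟩ := exists_hasMFDerivAt_extChartAt hp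
  have hcomp := (hC.comp p ((ι.analytic p).mdifferentiableAt (by simp)).hasMFDerivAt).mfderiv
  exact ⟨C, fun u => congrArg (fun A : F →L[ℝ] E => A u) hcomp⟩

variable [IsManifold 𝓘(ℝ, F) ω M]

theorem eventually_isEmbChartAt [IsManifold 𝓘(ℂ, E) ω Z] :
    ∀ᶠ p in 𝓝 a, IsEmbChartAt ι a p := by
  filter_upwards [(contMDiffAt_iff_contMDiffAt_nhds (by simp)).1 (contMDiffAt_embChart ι a),
    eventually_dEmb_embChart ι a] with p hp ⟨C, hC⟩
  refine ⟨hp, fun v w => ?_⟩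
  rw [hC, hC, ← map_smul]
  exact C.injective.eq_iff.symm

/-- The embedding `M → Z`, read in the charts of `M` at `a` and of `Z` at the image of `a`. -/
def localEmb (ι : GenericEmbedding E Z F M) (a : M) : F → E :=
  embChart ι a ∘ (extChartAt 𝓘(ℝ, F) a).symm

theorem contDiffAt_localEmb : ContDiffAt ℝ ω (localEmb ι a) (extChartAt 𝓘(ℝ, F) a a) :=
  contDiffAt_comp_extChartAt_symm (contMDiffAt_embChart ι a)

variable {ι a} {x : F}

theorem fderiv_localEmb_eq_I_smul_iff (hx : x ∈ (extChartAt 𝓘(ℝ, F) a).target)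
    (h : IsEmbChartAt ι a ((extChartAt 𝓘(ℝ, F) a).symm x)) {v w : F} :
    fderiv ℝ (localEmb ι a) x w = Complex.I • fderiv ℝ (localEmb ι a) x v ↔
      IsJ ι ((extChartAt 𝓘(ℝ, F) a).symm x)
        (mfderiv 𝓘(ℝ, F) 𝓘(ℝ, F) (extChartAt 𝓘(ℝ, F) a).symm x v)
        (mfderiv 𝓘(ℝ, F) 𝓘(ℝ, F) (extChartAt 𝓘(ℝ, F) a).symm x w) := by
  rw [h.isJ_iff, localEmb, fderiv_comp_extChartAt_symm_apply hx h.mdifferentiableAt,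
    fderiv_comp_extChartAt_symm_apply hx h.mdifferentiableAt]

theorem IsCRAt.isCRLinear_fderiv {f : M → M} (hx : x ∈ (extChartAt 𝓘(ℝ, F) a).target)
    (hcr : IsCRAt ι f ((extChartAt 𝓘(ℝ, F) a).symm x))
    (hf : MDifferentiableAt 𝓘(ℝ, F) 𝓘(ℝ, F) f ((extChartAt 𝓘(ℝ, F) a).symm x))
    (h : IsEmbChartAt ι a ((extChartAt 𝓘(ℝ, F) a).symm x))
    (h' : IsEmbChartAt ι a (f ((extChartAt 𝓘(ℝ, F) a).symm x))) :
    IsCRLinear (fderiv ℝ (localEmb ι a) x)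
      (fderiv ℝ (fun y => embChart ι a (f ((extChartAt 𝓘(ℝ, F) a).symm y))) x) := by
  intro v w hvw
  have hchain : ∀ u, fderiv ℝ ((embChart ι a ∘ f) ∘ (extChartAt 𝓘(ℝ, F) a).symm) x u =
      dEmb E F (embChart ι a) (f ((extChartAt 𝓘(ℝ, F) a).symm x))
        (mfderiv 𝓘(ℝ, F) 𝓘(ℝ, F) f ((extChartAt 𝓘(ℝ, F) a).symm x)
          (mfderiv 𝓘(ℝ, F) 𝓘(ℝ, F) (extChartAt 𝓘(ℝ, F) a).symm x u)) := fun u =>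
    (fderiv_comp_extChartAt_symm_apply hx (h'.mdifferentiableAt.comp _ hf) u).trans
      (dEmb_comp h'.mdifferentiableAt hf _)
  exact (hchain w).trans (((h'.isJ_iff _ _).1
    (hcr _ _ ((fderiv_localEmb_eq_I_smul_iff hx h).1 hvw))).trans
      (congrArg (Complex.I • ·) (hchain v)).symm)

theorem contDiffAt_embChart_flow {Φ : ℝ → M → M} {t : ℝ}
    (hx : x ∈ (extChartAt 𝓘(ℝ, F) a).target)
    (hΦ : ContMDiffAt (𝓘(ℝ, ℝ).prod 𝓘(ℝ, F)) 𝓘(ℝ, F) ω (fun q : ℝ × M => Φ q.1 q.2)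
      (t, (extChartAt 𝓘(ℝ, F) a).symm x))
    (h : IsEmbChartAt ι a (Φ t ((extChartAt 𝓘(ℝ, F) a).symm x))) :
    ContDiffAt ℝ ω
      (fun q : ℝ × F => embChart ι a (Φ q.1 ((extChartAt 𝓘(ℝ, F) a).symm q.2))) (t, x) := by
  have hparam : ContMDiffAt 𝓘(ℝ, ℝ × F) (𝓘(ℝ, ℝ).prod 𝓘(ℝ, F)) ω
      (fun q : ℝ × F => (q.1, (extChartAt 𝓘(ℝ, F) a).symm q.2)) (t, x) :=
    contDiffAt_fst.contMDiffAt.prodMk (ContMDiffAt.comp (g := (extChartAt 𝓘(ℝ, F) a).symm) (t, x)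
      (contMDiffAt_extChartAt_symm_of_mem hx) contDiffAt_snd.contMDiffAt)
  exact (ContMDiffAt.comp (g := embChart ι a) (t, x) h.analytic
    (ContMDiffAt.comp (g := fun q : ℝ × M => Φ q.1 q.2) (t, x) hΦ hparam)).contDiffAt

variable {X : ∀ p : M, TangentSpace 𝓘(ℝ, F) p}

theorem along_localEmb_chartField (hx : x ∈ (extChartAt 𝓘(ℝ, F) a).target)
    (h : IsEmbChartAt ι a ((extChartAt 𝓘(ℝ, F) a).symm x)) :
    along (localEmb ι a) (chartField a X) x =
      dEmb E F (embChart ι a) ((extChartAt 𝓘(ℝ, F) a).symm x)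
        (X ((extChartAt 𝓘(ℝ, F) a).symm x)) :=
  along_chartField hx h.mdifferentiableAt

/-- `Φ` is a flow of `X` by CR-maps at `p`, defined for times near `0`. -/
structure IsCRFlowAt (ι : GenericEmbedding E Z F M) (X : ∀ p : M, TangentSpace 𝓘(ℝ, F) p)
    (Φ : ℝ → M → M) (p : M) : Prop where
  map_zero : Φ 0 p = p
  isMIntegralCurveAt : IsMIntegralCurveAt (fun t => Φ t p) X 0
  analytic : ∀ᶠ t in 𝓝 0, ContMDiffAt (𝓘(ℝ, ℝ).prod 𝓘(ℝ, F)) 𝓘(ℝ, F) ω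
    (fun q : ℝ × M => Φ q.1 q.2) (t, p)
  cr : ∀ᶠ t in 𝓝 0, IsCRAt ι (Φ t) p

theorem IsInfinitesimalCR.exists_isCRFlowAt (hX : IsInfinitesimalCR ι a X) :
    ∃ Φ, ∀ᶠ p in 𝓝 a, IsCRFlowAt ι X Φ p := by
  obtain ⟨Φ, U, ε, hU, haU, hε, hΦ0, hΦX, hΦ, hΦcr⟩ := hX.flow
  have hIoo : Ioo (-ε) ε ∈ 𝓝 (0 : ℝ) := isOpen_Ioo.mem_nhds (by simpa using hε)
  refine ⟨Φ, ?_⟩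
  filter_upwards [hU.mem_nhds haU] with p hp
  refine ⟨hΦ0 p hp, (hΦX p hp).isMIntegralCurveAt hIoo, ?_, ?_⟩
  · filter_upwards [hIoo] with t ht using
      hΦ.contMDiffAt (prod_mem_nhds (isOpen_Ioo.mem_nhds ht) (hU.mem_nhds hp))
  · filter_upwards [hIoo] with t ht using hΦcr t ht p hp

omit [IsManifold 𝓘(ℝ, F) ω M] in
theorem IsCRFlowAt.deriv_embChart {Φ : ℝ → M → M} {p : M} (hΦ : IsCRFlowAt ι X Φ p)
    (h : IsEmbChartAt ι a p) :
    deriv (fun t => embChart ι a (Φ t p)) 0 = dEmb E F (embChart ι a) p (X p) := by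
  have hderiv := hasDerivAt_comp_integralCurve (f := embChart ι a) (t := 0)
    (by rw [hΦ.map_zero]; exact h.mdifferentiableAt) hΦ.isMIntegralCurveAt
  rw [hΦ.map_zero] at hderiv
  exact hderiv.deriv

theorem IsCRFlowAt.eventually_isCRLinear_fderiv {Φ : ℝ → M → M}
    (hx : x ∈ (extChartAt 𝓘(ℝ, F) a).target)
    (hΦ : IsCRFlowAt ι X Φ ((extChartAt 𝓘(ℝ, F) a).symm x))
    (h : ∀ᶠ p in 𝓝 ((extChartAt 𝓘(ℝ, F) a).symm x), IsEmbChartAt ι a p) :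
    ∀ᶠ t in 𝓝 (0 : ℝ), IsCRLinear (fderiv ℝ (localEmb ι a) x)
      (fderiv ℝ (fun y => embChart ι a (Φ t ((extChartAt 𝓘(ℝ, F) a).symm y))) x) := by
  have hcurve : Tendsto (fun t => Φ t ((extChartAt 𝓘(ℝ, F) a).symm x)) (𝓝 0)
      (𝓝 ((extChartAt 𝓘(ℝ, F) a).symm x)) := by
    simpa only [ContinuousAt, hΦ.map_zero] using hΦ.isMIntegralCurveAt.continuousAt
  filter_upwards [hΦ.analytic, hΦ.cr, hcurve.eventually h] with t han hcr ht
  have hΦt : ContMDiffAt 𝓘(ℝ, F) 𝓘(ℝ, F) ω (Φ t) ((extChartAt 𝓘(ℝ, F) a).symm x) :=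
    ContMDiffAt.comp (g := fun q : ℝ × M => Φ q.1 q.2) _ han
      (contMDiffAt_const.prodMk contMDiffAt_id)
  exact hcr.isCRLinear_fderiv hx (hΦt.mdifferentiableAt (by simp)) h.self_of_nhds ht

theorem IsInfinitesimalCR.isCRField [CompleteSpace F] [IsManifold 𝓘(ℂ, E) ω Z]
    (hX : IsInfinitesimalCR ι a X) :
    IsCRField (localEmb ι a) (chartField a X) (extChartAt 𝓘(ℝ, F) a a) := by
  obtain ⟨Φ, hΦ⟩ := hX.exists_isCRFlowAt
  have hchart := eventually_isEmbChartAt ι a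
  refine ⟨contDiffAt_chartField hX.analytic, ?_⟩
  filter_upwards [eventually_mem_extChartAt_target F a,
    (eventually_mem_extChartAt_target F a).eventually_nhds,
    (tendsto_extChartAt_symm F a).eventually hΦ,
    ((tendsto_extChartAt_symm F a).eventually hΦ).eventually_nhds,
    (tendsto_extChartAt_symm F a).eventually hchart.eventually_nhds,
    ((tendsto_extChartAt_symm F a).eventually hchart).eventually_nhds]
    with x hx hx' hΦx hΦx' hchartx hchartx'
  have hvelocity : along (localEmb ι a) (chartField a X) =ᶠ[𝓝 x]
      fun y => deriv (fun t => embChart ι a (Φ t ((extChartAt 𝓘(ℝ, F) a).symm y))) 0 := by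
    filter_upwards [hx', hΦx', hchartx'] with y hy hΦy hcharty
    rw [along_localEmb_chartField hy hcharty, hΦy.deriv_embChart hcharty]
  rw [hvelocity.fderiv_eq]
  refine isCRLinear_fderiv_velocity
    ((contDiffAt_embChart_flow hx hΦx.analytic.self_of_nhds ?_).of_le le_top)
    (hΦx.eventually_isCRLinear_fderiv hx hchartx)
  rw [hΦx.map_zero]
  exact hchartx.self_of_nhds

end EmbeddingChart

section Realization

variable {E : Type*} [NormedAddCommGroup E] [NormedSpace ℂ E]
  {Z : Type*} [TopologicalSpace Z] [ChartedSpace E Z]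
  {F : Type*} [NormedAddCommGroup F] [NormedSpace ℝ F]
  {M : Type*} [TopologicalSpace M] [ChartedSpace F M]
  {ι : GenericEmbedding E Z F M} {a : M} {𝔳 : Submodule ℝ (VFGerm F a)}

theorem isTotallyReal_of_isInvolutionFor {τ : M → M} (hτ : IsInvolutionFor ι a 𝔳 τ) :
    IsTotallyReal ι a 𝔳 := by
  intro X Y hX hY hXY
  have hvanish : ∀ᶠ p in 𝓝 a, X (τ p) = 0 := by
    filter_upwards [hXY, hτ.1.tendsto.eventually hXY, hτ.1.antiCR, hτ.2 X hX, hτ.2 Y hY]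
      with p hJ hJτ hanti hXp hYp
    have hantilinear : ι.d (τ p) (Y (τ p)) = -(Complex.I • ι.d (τ p) (X (τ p))) := by
      have h : ι.d (τ p) (-(mfderiv 𝓘(ℝ, F) 𝓘(ℝ, F) τ p (Y p))) =
        Complex.I • ι.d (τ p) (mfderiv 𝓘(ℝ, F) 𝓘(ℝ, F) τ p (X p)) := hanti _ _ hJ
      rwa [hXp, hYp, neg_neg, map_neg, smul_neg] at h
    have hzero : Complex.I • ι.d (τ p) (X (τ p)) = 0 :=
      have := IsAddTorsionFree.of_isTorsionFree ℂ E
      self_eq_neg.1 (hJτ.symm.trans hantilinear)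
    exact ι.injective_dEmb _
      (((smul_eq_zero_iff_right Complex.I_ne_zero).1 hzero).trans (map_zero (ι.d (τ p))).symm)
  rw [germ_eq_zero_iff]
  filter_upwards [hτ.1.tendsto.eventually hvanish, hτ.1.involutive] with p hp hττ
  rwa [hττ] at hp

variable {κ : Type*} [Fintype κ] {X : κ → ∀ p : M, TangentSpace 𝓘(ℝ, F) p}

theorem germ_sum_smul_mem (hX : ∀ k, germ a (X k) ∈ 𝔳) (v : κ → ℝ) :
    germ a (∑ k, v k • X k) ∈ 𝔳 := by
  change (nullFields F a).mkQ _ ∈ 𝔳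
  rw [map_sum]
  refine Submodule.sum_mem _ fun k _ => ?_
  rw [map_smul]
  exact Submodule.smul_mem _ _ (hX k)

theorem dEmb_sum_smul_eq_ofRealPi [DecidableEq κ] {φ : M → κ → ℂ} {p : M}
    (hX : ∀ k, dEmb (κ → ℂ) F φ p (X k p) = Pi.single k 1) (v : κ → ℝ) :
    dEmb (κ → ℂ) F φ p ((∑ k, v k • X k) p) = ofRealPi v := by
  rw [Finset.sum_apply, map_sum]
  simp only [Pi.smul_apply, map_smul, hX]
  ext j
  simp [Finset.sum_apply, Pi.single_apply, apply_ite]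

variable [IsManifold 𝓘(ℝ, F) ω M]

theorem IsAbelianSubalgebra.exists_frame [FiniteDimensional ℂ E]
    (h𝔳 : IsAbelianSubalgebra ι a 𝔳) (hspan : SpansTangent ι a 𝔳) :
    ∃ (n : ℕ) (X : Fin n → ∀ p : M, TangentSpace 𝓘(ℝ, F) p),
      (∀ k, germ a (X k) ∈ 𝔳) ∧ (∀ k, IsInfinitesimalCR ι a (X k)) ∧
      ∃ b : Module.Basis (Fin n) ℂ E, ∀ k, b k = ι.d a (X k a) := by
  obtain ⟨f, hf, hfspan, hli⟩ := Submodule.exists_fun_fin_finrank_span_eq ℂ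
    {x : E | ∃ X : (∀ p : M, TangentSpace 𝓘(ℝ, F) p), germ a X ∈ 𝔳 ∧ x = ι.d a (X a)}
  have hX : ∀ k, ∃ X : ∀ p : M, TangentSpace 𝓘(ℝ, F) p, germ a X ∈ 𝔳 ∧
      IsInfinitesimalCR ι a X ∧ f k = ι.d a (X a) := by
    intro k
    obtain ⟨X, hX, hfk⟩ := hf k
    obtain ⟨Y, hY, hYcr⟩ := h𝔳.subset_hol hX
    refine ⟨Y, hY ▸ hX, hYcr, ?_⟩
    rw [hfk, (germ_eq_iff.1 hY).self_of_nhds]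
  choose X hX𝔳 hXcr hXf using hX
  refine ⟨_, X, hX𝔳, hXcr, Module.Basis.mk hli (by rw [hfspan]; exact hspan.ge), fun k => ?_⟩
  rw [Module.Basis.mk_apply, hXf]

section ChartMaps

variable {n : ℕ} {φ : F → Fin n → ℂ}

theorem eventually_dEmb_comp_extChartAt (hφ : ContDiffAt ℝ ω φ (extChartAt 𝓘(ℝ, F) a a)) :
    ∀ᶠ x in 𝓝 (extChartAt 𝓘(ℝ, F) a a), ∀ u : F,
      dEmb (Fin n → ℂ) F (φ ∘ extChartAt 𝓘(ℝ, F) a) ((extChartAt 𝓘(ℝ, F) a).symm x)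
        (mfderiv 𝓘(ℝ, F) 𝓘(ℝ, F) (extChartAt 𝓘(ℝ, F) a).symm x u) = fderiv ℝ φ x u := by
  have hφκ : ContMDiffAt 𝓘(ℝ, F) 𝓘(ℝ, Fin n → ℂ) ω (φ ∘ extChartAt 𝓘(ℝ, F) a) a :=
    ContMDiffAt.comp a hφ.contMDiffAt contMDiffAt_extChartAt
  filter_upwards [eventually_mem_extChartAt_target F a,
    (eventually_mem_extChartAt_target F a).eventually_nhds,
    (tendsto_extChartAt_symm F a).eventually (eventually_mdifferentiableAt hφκ)] with x hx hx' hd u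
  rw [← fderiv_comp_extChartAt_symm_apply hx hd u]
  refine congrArg (fun A : F →L[ℝ] Fin n → ℂ => A u) (EventuallyEq.fderiv_eq ?_)
  exact hx'.mono fun y hy => congrArg φ ((extChartAt 𝓘(ℝ, F) a).right_inv hy)

theorem eventually_dEmb_comp_extChartAt_eq {Y : ∀ p : M, TangentSpace 𝓘(ℝ, F) p} {c : Fin n → ℂ}
    (hφ : ContDiffAt ℝ ω φ (extChartAt 𝓘(ℝ, F) a a))
    (hc : ∀ᶠ x in 𝓝 (extChartAt 𝓘(ℝ, F) a a), fderiv ℝ φ x (chartField a Y x) = c) :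
    ∀ᶠ p in 𝓝 a, dEmb (Fin n → ℂ) F (φ ∘ extChartAt 𝓘(ℝ, F) a) p (Y p) = c := by
  rw [← eventually_extChartAt_symm_iff F]
  filter_upwards [hc, eventually_dEmb_comp_extChartAt hφ, eventually_mem_extChartAt_target F a]
    with x hcx hd hx
  rw [← hcx, ← hd, mfderiv_chartField hx]

theorem isCRIsoOnto_comp_extChartAt [IsManifold 𝓘(ℂ, E) ω Z] {T : Set (Fin n → ℂ)}
    {ψ : (Fin n → ℂ) → F} (hφ : ContDiffAt ℝ ω φ (extChartAt 𝓘(ℝ, F) a a))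
    (hmaps : ∀ᶠ x in 𝓝 (extChartAt 𝓘(ℝ, F) a a), φ x ∈ T)
    (hψ : ContDiffAt ℝ ω ψ (φ (extChartAt 𝓘(ℝ, F) a a)))
    (hψφ : ∀ᶠ x in 𝓝 (extChartAt 𝓘(ℝ, F) a a), ψ (φ x) = x)
    (hφψ : ∀ᶠ z in 𝓝[T] (φ (extChartAt 𝓘(ℝ, F) a a)), φ (ψ z) = z)
    (hcr : ∀ᶠ x in 𝓝 (extChartAt 𝓘(ℝ, F) a a), ∀ v w,
      fderiv ℝ φ x w = Complex.I • fderiv ℝ φ x v ↔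
        fderiv ℝ (localEmb ι a) x w = Complex.I • fderiv ℝ (localEmb ι a) x v) :
    IsCRIsoOnto ι a (φ ∘ extChartAt 𝓘(ℝ, F) a) T := by
  have hκ : Tendsto (extChartAt 𝓘(ℝ, F) a) (𝓝 a) (𝓝 (extChartAt 𝓘(ℝ, F) a a)) :=
    continuousAt_extChartAt a
  have hψtendsto : Tendsto ψ (𝓝 (φ (extChartAt 𝓘(ℝ, F) a a))) (𝓝 (extChartAt 𝓘(ℝ, F) a a)) := by
    simpa only [ContinuousAt, hψφ.self_of_nhds] using hψ.continuousAt
  refine ⟨ContMDiffAt.comp a hφ.contMDiffAt contMDiffAt_extChartAt, hκ.eventually hmaps,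
    ⟨(extChartAt 𝓘(ℝ, F) a).symm ∘ ψ, ?_, ?_, ?_⟩, ?_⟩
  · exact ContMDiffAt.comp_of_eq (contMDiffAt_extChartAt_symm_of_mem (mem_extChartAt_target a))
      hψ.contMDiffAt hψφ.self_of_nhds
  · filter_upwards [hκ.eventually hψφ, extChartAt_source_mem_nhds (I := 𝓘(ℝ, F)) a]
      with p hp hsource
    exact (congrArg _ hp).trans ((extChartAt 𝓘(ℝ, F) a).left_inv hsource)
  · filter_upwards [hφψ, (hψtendsto.eventually (eventually_mem_extChartAt_target F a)).filter_mono
      nhdsWithin_le_nhds] with z hz htarget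
    exact (congrArg φ ((extChartAt 𝓘(ℝ, F) a).right_inv htarget)).trans hz
  · rw [← eventually_extChartAt_symm_iff F]
    filter_upwards [eventually_dEmb_comp_extChartAt hφ, eventually_mem_extChartAt_target F a, hcr,
      (tendsto_extChartAt_symm F a).eventually (eventually_isEmbChartAt ι a)]
      with x hd hx hcrx hchart v w
    obtain ⟨v, rfl⟩ := (isInvertible_mfderiv_extChartAt_symm_of_mem hx).surjective v
    obtain ⟨w, rfl⟩ := (isInvertible_mfderiv_extChartAt_symm_of_mem hx).surjective w
    exact (fderiv_localEmb_eq_I_smul_iff hx hchart).symm.trans ((hcrx v w).symm.trans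
      (Iff.of_eq (congrArg₂ (fun s t : Fin n → ℂ => s = Complex.I • t) (hd w) (hd v)).symm))

end ChartMaps

theorem injective_fderiv_localEmb [IsManifold 𝓘(ℂ, E) ω Z] (ι : GenericEmbedding E Z F M)
    (a : M) : Function.Injective (fderiv ℝ (localEmb ι a) (extChartAt 𝓘(ℝ, F) a a)) := by
  have ha := mem_extChartAt_target (I := 𝓘(ℝ, F)) a
  obtain ⟨C, hC⟩ := ((tendsto_extChartAt_symm F a).eventually
    (eventually_dEmb_embChart ι a)).self_of_nhds
  have hchain : ∀ u, fderiv ℝ (localEmb ι a) (extChartAt 𝓘(ℝ, F) a a) u =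
      C (ι.d _ (mfderiv 𝓘(ℝ, F) 𝓘(ℝ, F) (extChartAt 𝓘(ℝ, F) a).symm _ u)) := fun u =>
    (fderiv_comp_extChartAt_symm_apply ha (by
      rw [extChartAt_to_inv]
      exact (contMDiffAt_embChart ι a).mdifferentiableAt (by simp)) u).trans (hC _)
  intro v w hvw
  rw [hchain, hchain] at hvw
  exact (isInvertible_mfderiv_extChartAt_symm_of_mem ha).injective
    (ι.injective_dEmb _ (C.injective hvw))

theorem isCommutingCRFrame_chartField [CompleteSpace F] [IsManifold 𝓘(ℂ, E) ω Z]
    (hX : ∀ k, IsInfinitesimalCR ι a (X k)) {b : Module.Basis κ ℂ E}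
    (hb : ∀ k, b k = ι.d a (X k a))
    (hcomm : ∀ k l, ∀ᶠ p in 𝓝 a, VectorField.mlieBracket 𝓘(ℝ, F) (X k) (X l) p = 0) :
    IsCommutingCRFrame (localEmb ι a) (fun k => chartField a (X k)) (extChartAt 𝓘(ℝ, F) a a) := by
  obtain ⟨C, hC⟩ := (eventually_dEmb_embChart ι a).self_of_nhds
  refine ⟨contDiffAt_localEmb ι a, fun k => (hX k).isCRField, fun k l =>
    (mlieBracket_eq_zero_iff_chartField (hX k).analytic (hX l).analytic).1 (hcomm k l), ?_⟩
  convert isInvertible_frameMap_basis (b.map C.toLinearEquiv) using 2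
  ext1 k
  rw [along_localEmb_chartField (mem_extChartAt_target a) (by
    rw [extChartAt_to_inv]
    exact (eventually_isEmbChartAt ι a).self_of_nhds), extChartAt_to_inv, hC,
    Module.Basis.map_apply, hb]
  rfl

theorem exists_tube_of_frame [FiniteDimensional ℝ F] [IsManifold 𝓘(ℂ, E) ω Z] {n : ℕ}
    {X : Fin n → ∀ p : M, TangentSpace 𝓘(ℝ, F) p}
    (hX : ∀ k, IsInfinitesimalCR ι a (X k)) {b : Module.Basis (Fin n) ℂ E}
    (hb : ∀ k, b k = ι.d a (X k a))
    (hcomm : ∀ k l, ∀ᶠ p in 𝓝 a, VectorField.mlieBracket 𝓘(ℝ, F) (X k) (X l) p = 0) :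
    ∃ (B : Set (Fin n → ℝ)) (φ : M → Fin n → ℂ), IsConnected B ∧
      (∃ d, ∀ y ∈ B, IsAnalyticSubmanifoldAt (Fin n → ℝ) B d y) ∧
      IsCRIsoOnto ι a φ (tube B) ∧
      (∀ᶠ p in 𝓝 a, ∀ k, dEmb (Fin n → ℂ) F φ p (X k p) = Pi.single k 1) ∧
      ∀ Y : ∀ p : M, TangentSpace 𝓘(ℝ, F) p, IsInfinitesimalCR ι a Y →
        (∀ k, ∀ᶠ p in 𝓝 a, VectorField.mlieBracket 𝓘(ℝ, F) (X k) Y p = 0) →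
        ∃ c : Fin n → ℂ, ∀ᶠ p in 𝓝 a, dEmb (Fin n → ℂ) F φ p (Y p) = c := by
  have : CompleteSpace F := FiniteDimensional.complete ℝ F
  have hframe := isCommutingCRFrame_chartField hX hb hcomm
  obtain ⟨φ, hφ, hφ'⟩ := hframe.exists_hasFDerivAt_coframe
  have hφX : ∀ᶠ x in 𝓝 (extChartAt 𝓘(ℝ, F) a a), ∀ k,
      fderiv ℝ φ x (chartField a (X k) x) = Pi.single k 1 := by
    filter_upwards [hframe.eventually, hφ'] with x hx hφx k
    rw [hφx.fderiv, hx.coframe_apply_self]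
  have hinj : Function.Injective (fderiv ℝ φ (extChartAt 𝓘(ℝ, F) a a)) := by
    rw [hφ'.self_of_nhds.fderiv]
    exact hframe.injective_coframe (injective_fderiv_localEmb ι a)
  have htan : ∀ᶠ x in 𝓝 (extChartAt 𝓘(ℝ, F) a a), ∀ α, ofRealPi α ∈ range (fderiv ℝ φ x) := by
    filter_upwards [hφX] with x hx α
    refine ⟨∑ k, α k • chartField a (X k) x, ?_⟩
    simp only [map_sum, map_smul, hx]
    ext j
    simp [Finset.sum_apply, Pi.single_apply, apply_ite]
  obtain ⟨B, ψ, hBconn, hBsub, hφB, hψ, hψφ, hφψ⟩ := exists_tube_of_immersion hφ hinj htan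
  refine ⟨B, φ ∘ extChartAt 𝓘(ℝ, F) a, hBconn, hBsub,
    isCRIsoOnto_comp_extChartAt hφ hφB hψ hψφ hφψ ?_, eventually_all.2 fun k =>
      eventually_dEmb_comp_extChartAt_eq hφ (hφX.mono fun x hx => hx k), fun Y hY hYcomm => ?_⟩
  · filter_upwards [hframe.eventually, hφ'] with x hx hφx v w
    rw [hφx.fderiv, hx.coframe_eq_I_smul_iff]
  · have hconst := hframe.eventually_coframe_eq hY.isCRField fun k =>
      (mlieBracket_eq_zero_iff_chartField (hX k).analytic hY.analytic).1 (hYcomm k)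
    exact ⟨_, eventually_dEmb_comp_extChartAt_eq hφ ((hconst.and hφ').mono fun x ⟨hx, hφx⟩ =>
      (congrArg (fun A : F →L[ℝ] Fin n → ℂ => A _) hφx.fderiv).trans hx)⟩

namespace TubeRealization

variable {R : TubeRealization ι a} {X : Fin R.r → ∀ p : M, TangentSpace 𝓘(ℝ, F) p}

theorem translationAlgebra_le (hX𝔳 : ∀ k, germ a (X k) ∈ 𝔳)
    (hX : ∀ᶠ p in 𝓝 a, ∀ k, dEmb (Fin R.r → ℂ) F R.toFun p (X k p) = Pi.single k 1) :
    R.translationAlgebra ≤ 𝔳 := by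
  intro ξ hξ
  obtain ⟨Y, rfl⟩ := Submodule.mkQ_surjective _ ξ
  obtain ⟨v, hv⟩ := R.germ_mem_iff.1 hξ
  have heq : germ a Y = germ a (∑ k, v k • X k) := by
    rw [germ_eq_iff]
    filter_upwards [hv, hX, R.isCRIsoOnto.eventually_isTubeFrame] with p hY hXp hframe
    exact hframe.inj _ _ (hY.trans (dEmb_sum_smul_eq_ofRealPi hXp v).symm)
  change germ a Y ∈ 𝔳
  rw [heq]
  exact germ_sum_smul_mem hX𝔳 v

omit [IsManifold 𝓘(ℝ, F) ω M] in
theorem imPi_eq_zero_of_isTotallyReal (hreal : IsTotallyReal ι a 𝔳)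
    (hX𝔳 : ∀ k, germ a (X k) ∈ 𝔳)
    (hX : ∀ᶠ p in 𝓝 a, ∀ k, dEmb (Fin R.r → ℂ) F R.toFun p (X k p) = Pi.single k 1)
    {Y : ∀ p : M, TangentSpace 𝓘(ℝ, F) p} (hY : germ a Y ∈ 𝔳) {c : Fin R.r → ℂ}
    (hc : ∀ᶠ p in 𝓝 a, dEmb (Fin R.r → ℂ) F R.toFun p (Y p) = c) : imPi c = 0 := by
  have hdiff : germ a (Y - ∑ k, rePi c k • X k) ∈ 𝔳 := by
    change (nullFields F a).mkQ _ ∈ 𝔳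
    rw [map_sub]
    exact Submodule.sub_mem _ hY (germ_sum_smul_mem hX𝔳 _)
  have hzero : germ a (∑ k, imPi c k • X k) = 0 := by
    refine hreal _ _ (germ_sum_smul_mem hX𝔳 _) hdiff ?_
    filter_upwards [hc, hX, R.isCRIsoOnto.cr] with p hYp hXp hcr
    refine (hcr _ _).2 ?_
    rw [dEmb_sum_smul_eq_ofRealPi hXp, Pi.sub_apply, map_sub, hYp,
      dEmb_sum_smul_eq_ofRealPi hXp, sub_eq_iff_eq_add, add_comm]
    exact (ofRealPi_rePi_add_I_smul_ofRealPi_imPi c).symm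
  have hvalue := dEmb_sum_smul_eq_ofRealPi hX.self_of_nhds (imPi c)
  rw [(germ_eq_zero_iff.1 hzero).self_of_nhds, map_zero] at hvalue
  rw [← rePi_ofRealPi (imPi c), ← hvalue, map_zero]

omit [IsManifold 𝓘(ℝ, F) ω M] in
theorem le_translationAlgebra (hreal : IsTotallyReal ι a 𝔳) (hX𝔳 : ∀ k, germ a (X k) ∈ 𝔳)
    (hX : ∀ᶠ p in 𝓝 a, ∀ k, dEmb (Fin R.r → ℂ) F R.toFun p (X k p) = Pi.single k 1)
    (hconst : ∀ ξ ∈ 𝔳, ∃ Y, germ a Y = ξ ∧ ∃ c : Fin R.r → ℂ,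
      ∀ᶠ p in 𝓝 a, dEmb (Fin R.r → ℂ) F R.toFun p (Y p) = c) :
    𝔳 ≤ R.translationAlgebra := by
  intro ξ hξ
  obtain ⟨Y, rfl, c, hc⟩ := hconst ξ hξ
  have him := imPi_eq_zero_of_isTotallyReal hreal hX𝔳 hX hξ hc
  refine R.germ_mem_iff.2 ⟨rePi c, hc.mono fun p hp => hp.trans ?_⟩
  conv_lhs => rw [← ofRealPi_rePi_add_I_smul_ofRealPi_imPi c, him, map_zero, smul_zero, add_zero]

end TubeRealization

variable [FiniteDimensional ℂ E] [FiniteDimensional ℝ F] [IsManifold 𝓘(ℂ, E) ω Z]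

theorem IsAbelianSubalgebra.exists_tubeRealization (h𝔳 : IsAbelianSubalgebra ι a 𝔳)
    (hspan : SpansTangent ι a 𝔳) (hreal : IsTotallyReal ι a 𝔳) :
    ∃ R : TubeRealization ι a, R.translationAlgebra = 𝔳 := by
  obtain ⟨n, X, hX𝔳, hX, b, hb⟩ := h𝔳.exists_frame hspan
  obtain ⟨B, φ, hBconn, hBsub, hφ, hφX, hφY⟩ := exists_tube_of_frame hX hb
    fun k l => h𝔳.abelian _ _ (hX𝔳 k) (hX𝔳 l)
  let R : TubeRealization ι a := ⟨n, B, hBconn, hBsub, φ, hφ⟩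
  refine ⟨R, le_antisymm (TubeRealization.translationAlgebra_le hX𝔳 hφX)
    (TubeRealization.le_translationAlgebra hreal hX𝔳 hφX fun ξ hξ => ?_)⟩
  obtain ⟨Y, rfl, hY⟩ := h𝔳.subset_hol hξ
  exact ⟨Y, rfl, hφY Y hY fun k => h𝔳.abelian _ _ (hX𝔳 k) hξ⟩

theorem IsAbelianSubalgebra.isTotallyReal_iff (h𝔳 : IsAbelianSubalgebra ι a 𝔳)
    (hspan : SpansTangent ι a 𝔳) :
    IsTotallyReal ι a 𝔳 ↔ ∃ τ, IsInvolutionFor ι a 𝔳 τ := by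
  have : CompleteSpace F := FiniteDimensional.complete ℝ F
  refine ⟨fun hreal => ?_, fun ⟨τ, hτ⟩ => isTotallyReal_of_isInvolutionFor hτ⟩
  obtain ⟨R, rfl⟩ := h𝔳.exists_tubeRealization hspan hreal
  exact R.isTubeSubalgebra.exists_involution

end Realization

section FixedPoints

variable {F : Type*} [NormedAddCommGroup F] [NormedSpace ℝ F]
  {M : Type*} [TopologicalSpace M] [ChartedSpace F M] {a : M}

theorem chartAt_trans_mem_maximalAtlas [IsManifold 𝓘(ℝ, F) ω M] {e : OpenPartialHomeomorph F F}
    (he : ContDiffOn ℝ ω e e.source) (he' : ContDiffOn ℝ ω e.symm e.target) (a : M) :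
    (chartAt F a) ≫ₕ e ∈ IsManifold.maximalAtlas 𝓘(ℝ, F) ω M := by
  have hchart := IsManifold.chart_mem_maximalAtlas (I := 𝓘(ℝ, F)) (n := ω) a
  refine ((chartAt F a) ≫ₕ e).mem_maximalAtlas_of_contMDiffOn ?_ ?_
  · rw [OpenPartialHomeomorph.coe_trans, OpenPartialHomeomorph.trans_source]
    exact he.contMDiffOn.comp ((contMDiffOn_of_mem_maximalAtlas hchart).mono inter_subset_left)
      inter_subset_right
  · rw [OpenPartialHomeomorph.coe_trans_symm, OpenPartialHomeomorph.trans_target]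
    exact (contMDiffOn_symm_of_mem_maximalAtlas hchart).comp
      (he'.contMDiffOn.mono inter_subset_left) inter_subset_right

theorem isAnalyticSubmanifoldAt_of_fderiv_surjective [CompleteSpace F]
    [IsManifold 𝓘(ℝ, F) ω M] {V : Type*} [NormedAddCommGroup V] [NormedSpace ℝ V]
    [FiniteDimensional ℝ V] {f : M → V} {S : Set M} (hf : ContMDiffAt 𝓘(ℝ, F) 𝓘(ℝ, V) ω f a)
    (hsurj : Function.Surjective
      (fderiv ℝ (f ∘ (extChartAt 𝓘(ℝ, F) a).symm) (extChartAt 𝓘(ℝ, F) a a)))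
    (hS : ∀ᶠ p in 𝓝 a, p ∈ S ↔ f p = f a) :
    IsAnalyticSubmanifoldAt F S (Module.finrank ℝ
      (fderiv ℝ (f ∘ (extChartAt 𝓘(ℝ, F) a).symm) (extChartAt 𝓘(ℝ, F) a a)).ker) a := by
  obtain ⟨e, hae, he, he', hlevel⟩ :=
    exists_linearization (contDiffAt_comp_extChartAt_symm hf) hsurj
  obtain ⟨U, hU, hUopen, haU⟩ := eventually_nhds_iff.1 hS
  have hsource : ∀ {p}, p ∈ (((chartAt F a) ≫ₕ e).restr U).source ↔
      (p ∈ (chartAt F a).source ∧ chartAt F a p ∈ e.source) ∧ p ∈ U := by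
    intro p
    rw [OpenPartialHomeomorph.restr_source' _ _ hUopen, OpenPartialHomeomorph.trans_source]
    rfl
  refine ⟨(hU a haU).2 rfl, ((chartAt F a) ≫ₕ e).restr U,
    restr_mem_maximalAtlas _ (chartAt_trans_mem_maximalAtlas he he' a) hUopen,
    hsource.2 ⟨⟨mem_chart_source F a, hae⟩, haU⟩, _, rfl, fun p hp => ?_⟩
  obtain ⟨⟨hp_chart, hp_e⟩, hpU⟩ := hsource.1 hp
  have hleft : (extChartAt 𝓘(ℝ, F) a).symm (chartAt F a p) = p := (chartAt F a).left_inv hp_chart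
  have hp := hlevel _ hp_e
  rw [Function.comp_apply, Function.comp_apply, hleft, extChartAt_to_inv] at hp
  exact (hU p hpU).trans hp

variable {E : Type*} [NormedAddCommGroup E] [NormedSpace ℂ E]
  {Z : Type*} [TopologicalSpace Z] [ChartedSpace E Z]
  {ι : GenericEmbedding E Z F M} {r : ℕ} {φ : M → Fin r → ℂ}

theorem IsTubeFrame.exists_fderiv_rePi_comp_eq [IsManifold 𝓘(ℝ, F) ω M] (h : IsTubeFrame ι φ a)
    (hφ : ContMDiffAt 𝓘(ℝ, F) 𝓘(ℝ, Fin r → ℂ) ω φ a) :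
    ∃ P : F ≃L[ℝ] F,
      fderiv ℝ ((rePi ∘ φ) ∘ (extChartAt 𝓘(ℝ, F) a).symm) (extChartAt 𝓘(ℝ, F) a a) =
        (rePi ∘L dEmb (Fin r → ℂ) F φ a : F →L[ℝ] Fin r → ℝ) ∘L (P : F →L[ℝ] F) := by
  obtain ⟨P, hP⟩ := isInvertible_mfderiv_extChartAt_symm_of_mem
    (mem_extChartAt_target (I := 𝓘(ℝ, F)) a)
  refine ⟨P, ?_⟩
  have hchain := (rePi.hasFDerivAt.comp _
    ((contDiffAt_comp_extChartAt_symm hφ).differentiableAt (by simp)).hasFDerivAt).fderiv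
  refine hchain.trans ?_
  ext1 u
  have hu := fderiv_comp_extChartAt_symm_apply (f := φ) (mem_extChartAt_target a)
    (by rw [extChartAt_to_inv]; exact h.mdiff) u
  rw [extChartAt_to_inv] at hu
  refine (congrArg rePi hu).trans ?_
  exact congrArg (fun A : F →L[ℝ] F => rePi (dEmb (Fin r → ℂ) F φ a (A u))) hP.symm

namespace TubeRealization

variable [IsManifold 𝓘(ℝ, F) ω M] {R : TubeRealization ι a} {τ τ' : M → M}

theorem eventually_eq_reflect (hτ : IsInvolutionFor ι a R.translationAlgebra τ) :
    ∀ᶠ p in 𝓝 a, R.toFun (τ p) = reflect (rePi (R.toFun a)) (R.toFun p) :=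
  R.isCRIsoOnto.eventually_eq_reflect hτ.1 ((R.inNegEigenspace_iff hτ.1.tendsto).1 hτ.2)

theorem involution_unique (hτ : IsInvolutionFor ι a R.translationAlgebra τ)
    (hτ' : IsInvolutionFor ι a R.translationAlgebra τ') : τ' =ᶠ[𝓝 a] τ :=
  R.isCRIsoOnto.eventually_eq hτ'.1.tendsto hτ.1.tendsto <|
    EventuallyEq.trans (eventually_eq_reflect hτ') (EventuallyEq.symm (eventually_eq_reflect hτ))

theorem eventually_fixed_iff (hτ : IsInvolutionFor ι a R.translationAlgebra τ) :
    ∀ᶠ p in 𝓝 a, τ p = p ↔ rePi (R.toFun p) = rePi (R.toFun a) := by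
  obtain ⟨ψ, hψ⟩ := R.isCRIsoOnto.exists_isInverseGerm
  filter_upwards [eventually_eq_reflect hτ, hψ.left_inv, hτ.1.tendsto.eventually hψ.left_inv]
    with p hp hψp hψτp
  rw [← reflect_eq_iff, ← hp]
  exact ⟨fun h => congrArg R.toFun h, fun h => hψτp.symm.trans ((congrArg ψ h).trans hψp)⟩

theorem isAnalyticSubmanifoldAt_fixed [FiniteDimensional ℝ F]
    (hτ : IsInvolutionFor ι a R.translationAlgebra τ) :
    IsAnalyticSubmanifoldAt F {p : M | τ p = p} (crDim ι a) a := by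
  have : CompleteSpace F := FiniteDimensional.complete ℝ F
  have hφ := R.isCRIsoOnto.analytic
  have hframe := R.isCRIsoOnto.eventually_isTubeFrame.self_of_nhds
  obtain ⟨P, hP⟩ := hframe.exists_fderiv_rePi_comp_eq hφ
  have hrePiφ : ContMDiffAt 𝓘(ℝ, F) 𝓘(ℝ, Fin R.r → ℝ) ω (rePi ∘ R.toFun) a :=
    rePi.contDiff.contMDiff.contMDiffAt.comp a hφ
  have hker : Module.finrank ℝ (fderiv ℝ ((rePi ∘ R.toFun) ∘ (extChartAt 𝓘(ℝ, F) a).symm)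
      (extChartAt 𝓘(ℝ, F) a a)).ker = crDim ι a := by
    rw [hP, ← hframe.finrank_ker_rePi_comp]
    exact (P.toLinearEquiv.ofSubmodule'
      (rePi ∘L dEmb (Fin R.r → ℂ) F R.toFun a : F →L[ℝ] Fin R.r → ℝ).ker).finrank_eq
  rw [← hker]
  refine isAnalyticSubmanifoldAt_of_fderiv_surjective (S := {p | τ p = p}) hrePiφ (fun v => ?_)
    (eventually_fixed_iff hτ)
  obtain ⟨u, hu⟩ := hframe.exists_real v
  refine ⟨P.symm u, ?_⟩
  rw [hP]
  exact (congrArg (fun w : F => rePi (dEmb (Fin R.r → ℂ) F R.toFun a w))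
    (P.apply_symm_apply u)).trans ((congrArg rePi hu).trans (rePi_ofRealPi v))

theorem mem_negTangent_iff (hτ : IsInvolutionFor ι a R.translationAlgebra τ) {u : F} :
    u ∈ negTangent F a τ ↔ imPi (dEmb (Fin R.r → ℂ) F R.toFun a u) = 0 := by
  set D : F →L[ℝ] Fin R.r → ℂ := dEmb (Fin R.r → ℂ) F R.toFun a
  set A : F →L[ℝ] F := mfderiv 𝓘(ℝ, F) 𝓘(ℝ, F) τ a
  have hDinj : Function.Injective D :=
    R.isCRIsoOnto.eventually_isTubeFrame.self_of_nhds.inj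
  have hDA : D (A u) = negConj (D u) := by
    have hbase : ∀ q, q = a → ∀ w : F, D w = dEmb (Fin R.r → ℂ) F R.toFun q w := by
      rintro _ rfl w; rfl
    exact (hbase _ hτ.1.map_base _).trans
      ((eventually_dEmb_lift R.isCRIsoOnto.analytic R.isCRIsoOnto.analytic hτ.1.map_base
        hτ.1.analytic (hasFDerivAt_reflect _) (eventually_eq_reflect hτ)).self_of_nhds u)
  calc u ∈ negTangent F a τ ↔ A u = -u := by
        rw [← neg_one_smul ℝ u]
        exact Module.End.mem_eigenspace_iff
    _ ↔ negConj (D u) = -D u := by rw [← hDA, ← map_neg, hDinj.eq_iff]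
    _ ↔ imPi (D u) = 0 := by
        refine ⟨fun h => ?_, fun h => ext_rePi_imPi ?_ ?_⟩
        · have him := congrArg imPi h
          rw [imPi_negConj, map_neg] at him
          exact self_eq_neg.1 him
        · rw [rePi_negConj, map_neg]
        · rw [imPi_negConj, map_neg, h, neg_zero]

theorem finrank_negTangent [FiniteDimensional ℝ F]
    (hτ : IsInvolutionFor ι a R.translationAlgebra τ) :
    Module.finrank ℝ (negTangent F a τ) = Module.finrank ℂ E := by
  have hframe := R.isCRIsoOnto.eventually_isTubeFrame.self_of_nhds
  let realPart : negTangent F a τ →ₗ[ℝ] (Fin R.r → ℝ) :=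
    (rePi ∘L dEmb (Fin R.r → ℂ) F R.toFun a : F →L[ℝ] Fin R.r → ℝ).toLinearMap ∘ₗ
      (negTangent F a τ).subtype
  have hbij : Function.Bijective realPart := by
    constructor
    · rintro ⟨u, hu⟩ ⟨v, hv⟩ huv
      refine Subtype.ext (hframe.inj _ _ (ext_rePi_imPi huv ?_))
      rw [(mem_negTangent_iff hτ).1 hu, (mem_negTangent_iff hτ).1 hv]
    · intro v
      obtain ⟨u, hu⟩ := hframe.exists_real v
      exact ⟨⟨u, (mem_negTangent_iff hτ).2 ((congrArg imPi hu).trans (imPi_ofRealPi v))⟩,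
        (congrArg rePi hu).trans (rePi_ofRealPi v)⟩
  rw [(LinearEquiv.ofBijective realPart hbij).finrank_eq, Module.finrank_fin_fun,
    hframe.finrank_eq]

end TubeRealization

end FixedPoints

section Automorphisms

variable {E : Type*} [NormedAddCommGroup E] [NormedSpace ℂ E]
  {Z : Type*} [TopologicalSpace Z] [ChartedSpace E Z]
  {F : Type*} [NormedAddCommGroup F] [NormedSpace ℝ F]
  {M : Type*} [TopologicalSpace M] [ChartedSpace F M]
  {ι : GenericEmbedding E Z F M} {a : M} {g h g' h' τ : M → M}

theorem IsAutPair.symm (H : IsAutPair ι a g h) : IsAutPair ι a h g :=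
  ⟨H.right, H.left, H.right_inv, H.left_inv⟩

theorem isAutPair_id : IsAutPair ι a id id := by
  have hid : IsCRGerm ι a id := by
    refine ⟨rfl, contMDiffAt_id, Eventually.of_forall fun p v w hvw => ?_⟩
    rw [mfderiv_id]
    exact hvw
  exact ⟨hid, hid, Eventually.of_forall fun _ => rfl, Eventually.of_forall fun _ => rfl⟩

/-- `Y = g_* X` near `a`: the values of `X` and `Y` correspond to each other under the differential
of `g`. -/
def Related (a : M) (g : M → M) (X Y : ∀ p : M, TangentSpace 𝓘(ℝ, F) p) : Prop :=
  ∀ᶠ p in 𝓝 a, mfderiv 𝓘(ℝ, F) 𝓘(ℝ, F) g p (X p) = Y (g p)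

variable {X X' Y W : ∀ p : M, TangentSpace 𝓘(ℝ, F) p} {𝔳 𝔳' 𝔳'' : Submodule ℝ (VFGerm F a)}

theorem IsAutPair.exists_related (H : IsAutPair ι a g h)
    (X : ∀ p : M, TangentSpace 𝓘(ℝ, F) p) : ∃ Y, Related a g X Y := by
  refine ⟨fun p => (mfderiv 𝓘(ℝ, F) 𝓘(ℝ, F) g (h p) (X (h p)) : F), ?_⟩
  filter_upwards [H.left_inv] with p hp
  rw [hp]

theorem related_id_iff : Related a id X Y ↔ germ a X = germ a Y := by
  rw [germ_eq_iff]
  refine eventually_congr (Eventually.of_forall fun p => ?_)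
  rw [mfderiv_id]
  rfl

theorem isPushforward_id : IsPushforward a id 𝔳 𝔳 := fun Y =>
  ⟨fun hY => ⟨Y, hY, related_id_iff.2 rfl⟩,
    fun ⟨_, hX, hXY⟩ => (related_id_iff.1 hXY) ▸ hX⟩

theorem IsPushforward.unique (hg : IsPushforward a g 𝔳 𝔳') (hg' : IsPushforward a g 𝔳 𝔳'') :
    𝔳' = 𝔳'' := by
  ext ξ
  obtain ⟨Y, rfl⟩ := Submodule.mkQ_surjective _ ξ
  exact (hg Y).trans (hg' Y).symm

variable [IsManifold 𝓘(ℝ, F) ω M]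

theorem eventually_mfderiv_comp (hg' : ContMDiffAt 𝓘(ℝ, F) 𝓘(ℝ, F) ω g' (g a))
    (hg : ContMDiffAt 𝓘(ℝ, F) 𝓘(ℝ, F) ω g a) :
    ∀ᶠ p in 𝓝 a, ∀ u : TangentSpace 𝓘(ℝ, F) p, mfderiv 𝓘(ℝ, F) 𝓘(ℝ, F) (g' ∘ g) p u =
      mfderiv 𝓘(ℝ, F) 𝓘(ℝ, F) g' (g p) (mfderiv 𝓘(ℝ, F) 𝓘(ℝ, F) g p u) := by
  filter_upwards [eventually_mdifferentiableAt hg,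
    hg.continuousAt.eventually (eventually_mdifferentiableAt hg')] with p hgp hg'p u
  exact mfderiv_comp_apply p hg'p hgp u

theorem IsCRGerm.eventually_mfderiv_comp (H' : IsCRGerm ι a g') (H : IsCRGerm ι a g) :
    ∀ᶠ p in 𝓝 a, ∀ u : TangentSpace 𝓘(ℝ, F) p, mfderiv 𝓘(ℝ, F) 𝓘(ℝ, F) (g' ∘ g) p u =
      mfderiv 𝓘(ℝ, F) 𝓘(ℝ, F) g' (g p) (mfderiv 𝓘(ℝ, F) 𝓘(ℝ, F) g p u) :=
  CRTube.eventually_mfderiv_comp (H.map_base.symm ▸ H'.analytic) H.analytic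

theorem IsCRGerm.comp (H' : IsCRGerm ι a g') (H : IsCRGerm ι a g) : IsCRGerm ι a (g' ∘ g) := by
  refine ⟨(congrArg g' H.map_base).trans H'.map_base,
    ContMDiffAt.comp_of_eq H'.analytic H.analytic H.map_base, ?_⟩
  filter_upwards [H.cr, H.tendsto.eventually H'.cr, H'.eventually_mfderiv_comp H]
    with p hg hg' hcomp v w hvw
  rw [hcomp, hcomp]
  exact hg' _ _ (hg v w hvw)

theorem IsAutPair.comp (H' : IsAutPair ι a g' h') (H : IsAutPair ι a g h) :
    IsAutPair ι a (g' ∘ g) (h ∘ h') := by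
  refine ⟨H'.left.comp H.left, H.right.comp H'.right, ?_, ?_⟩
  · filter_upwards [H.left_inv, H.left.tendsto.eventually H'.left_inv] with p hp hgp
    exact (congrArg h hgp).trans hp
  · filter_upwards [H'.right_inv, H'.right.tendsto.eventually H.right_inv] with p hp hhp
    exact (congrArg g' hhp).trans hp

theorem IsAutPair.eventually_mfderiv (H : IsAutPair ι a g h) :
    ∀ᶠ p in 𝓝 a, ∀ u : F,
      (mfderiv 𝓘(ℝ, F) 𝓘(ℝ, F) h (g p) (mfderiv 𝓘(ℝ, F) 𝓘(ℝ, F) g p u) : F) = u := by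
  filter_upwards [H.right.eventually_mfderiv_comp H.left, H.left_inv.eventually_nhds]
    with p hcomp hid u
  have hderiv : HasMFDerivAt 𝓘(ℝ, F) 𝓘(ℝ, F) (h ∘ g) p
      (ContinuousLinearMap.id ℝ (TangentSpace 𝓘(ℝ, F) p)) :=
    (hasMFDerivAt_id p).congr_of_eventuallyEq hid
  exact (hcomp u).symm.trans (congrArg (fun A : F →L[ℝ] F => A u) hderiv.mfderiv)

theorem Related.symm (H : IsAutPair ι a g h) (hXY : Related a g X Y) : Related a h Y X := by
  filter_upwards [H.right.tendsto.eventually hXY, H.right_inv,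
    H.right.tendsto.eventually H.eventually_mfderiv] with p hp hgh hinv
  have hX := hinv (X (h p))
  rw [hp] at hX
  refine Eq.trans ?_ hX
  rw [hgh]

theorem Related.of_comp (H : IsAutPair ι a g h) (H' : IsCRGerm ι a g') (hXY : Related a g X Y)
    (hXW : Related a (g' ∘ g) X W) : Related a g' Y W := by
  have hcomp : ∀ᶠ p in 𝓝 a, mfderiv 𝓘(ℝ, F) 𝓘(ℝ, F) g' (g p) (Y (g p)) = W (g' (g p)) := by
    filter_upwards [hXW, hXY, H'.eventually_mfderiv_comp H.left] with p hpW hpY hp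
    rw [← hpY, ← hp, hpW]
    rfl
  filter_upwards [H.right.tendsto.eventually hcomp, H.right_inv] with p hp hgh
  rwa [hgh] at hp

theorem Related.germ_eq (H : IsAutPair ι a g h) (hXY : Related a g X Y)
    (hXY' : Related a g X' Y) : germ a X = germ a X' := by
  rw [germ_eq_iff]
  filter_upwards [hXY, hXY', H.eventually_mfderiv] with p hX hX' hinv
  refine (hinv (X p)).symm.trans (Eq.trans ?_ (hinv (X' p)))
  rw [hX, hX']

theorem isPushforward_iff (H : IsAutPair ι a g h) : IsPushforward a g 𝔳 𝔳' ↔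
    ∀ X Y : (∀ p : M, TangentSpace 𝓘(ℝ, F) p), Related a g X Y →
      (germ a X ∈ 𝔳 ↔ germ a Y ∈ 𝔳') := by
  constructor
  · intro hg X Y hXY
    refine ⟨fun hX => (hg Y).2 ⟨X, hX, hXY⟩, fun hY => ?_⟩
    obtain ⟨X', hX', hXY'⟩ := (hg Y).1 hY
    rwa [hXY.germ_eq H hXY']
  · intro hg Y
    refine ⟨fun hY => ?_, fun ⟨X, hX, hXY⟩ => (hg X Y hXY).1 hX⟩
    obtain ⟨X, hX⟩ := H.symm.exists_related Y
    exact ⟨X, (hg X Y (hX.symm H.symm)).2 hY, hX.symm H.symm⟩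

theorem IsPushforward.symm (H : IsAutPair ι a g h) (hg : IsPushforward a g 𝔳 𝔳') :
    IsPushforward a h 𝔳' 𝔳 := by
  rw [isPushforward_iff H.symm]
  exact fun X Y hXY => ((isPushforward_iff H).1 hg Y X (hXY.symm H.symm)).symm

theorem IsPushforward.comp (H : IsAutPair ι a g h) (H' : IsAutPair ι a g' h')
    (hg : IsPushforward a g 𝔳 𝔳') (hg' : IsPushforward a g' 𝔳' 𝔳'') :
    IsPushforward a (g' ∘ g) 𝔳 𝔳'' := by
  rw [isPushforward_iff (H'.comp H)]
  intro X W hXW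
  obtain ⟨Y, hXY⟩ := H.exists_related X
  rw [(isPushforward_iff H).1 hg X Y hXY]
  exact (isPushforward_iff H').1 hg' Y W (hXY.of_comp H H'.left hXW)

theorem TubeSubalgebra.equivalence_conjugate :
    Equivalence (TubeSubalgebra.Conjugate (ι := ι) (a := a)) where
  refl _ := ⟨id, ⟨id, isAutPair_id⟩, isPushforward_id⟩
  symm := fun ⟨_, ⟨h, H⟩, hg⟩ => ⟨h, ⟨_, H.symm⟩, hg.symm H⟩
  trans := fun ⟨_, ⟨_, H⟩, hg⟩ ⟨_, ⟨_, H'⟩, hg'⟩ => ⟨_, ⟨_, H'.comp H⟩, hg.comp H H' hg'⟩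

theorem IsAutPair.eventually_isJ_iff (H : IsAutPair ι a g h) :
    ∀ᶠ p in 𝓝 a, ∀ v w : TangentSpace 𝓘(ℝ, F) p,
      IsJ ι p v w ↔
        IsJ ι (g p) (mfderiv 𝓘(ℝ, F) 𝓘(ℝ, F) g p v) (mfderiv 𝓘(ℝ, F) 𝓘(ℝ, F) g p w) := by
  filter_upwards [H.left.cr, H.left.tendsto.eventually H.right.cr, H.left_inv,
    H.eventually_mfderiv] with p hg hh hp hinv v w
  have transport : ∀ q, q = p → ∀ v' w' : F, v' = v → w' = w → IsJ ι q v' w' → IsJ ι p v w := by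
    rintro _ rfl _ _ rfl rfl hJ
    exact hJ
  exact ⟨hg v w, fun hJ => transport _ hp _ _ (hinv v) (hinv w) (hh _ _ hJ)⟩

theorem IsCRIsoOnto.comp_aut {r : ℕ} {φ : M → Fin r → ℂ} {T : Set (Fin r → ℂ)}
    (hφ : IsCRIsoOnto ι a φ T) (H : IsAutPair ι a g h) : IsCRIsoOnto ι a (φ ∘ h) T := by
  refine ⟨ContMDiffAt.comp_of_eq hφ.analytic H.right.analytic H.right.map_base,
    H.right.tendsto.eventually hφ.mapsTo, ?_, ?_⟩
  · obtain ⟨ψ, hψ⟩ := hφ.exists_isInverseGerm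
    rw [Function.comp_apply, H.right.map_base]
    refine ⟨g ∘ ψ, ContMDiffAt.comp_of_eq H.left.analytic hψ.analytic hψ.left_inv.self_of_nhds,
      ?_, ?_⟩
    · filter_upwards [H.right_inv, H.right.tendsto.eventually hψ.left_inv] with p hp hψp
      exact (congrArg g hψp).trans hp
    · filter_upwards [hψ.right_inv,
        (hψ.tendsto.eventually H.left_inv).filter_mono nhdsWithin_le_nhds] with z hz hhz
      exact (congrArg φ hhz).trans hz
  · filter_upwards [H.symm.eventually_isJ_iff, H.right.tendsto.eventually hφ.cr,
      eventually_mdifferentiableAt H.right.analytic,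
      H.right.tendsto.eventually (eventually_mdifferentiableAt hφ.analytic)]
      with p hJ hcr hh hφd v w
    rw [dEmb_comp hφd hh, dEmb_comp hφd hh, ← hcr, hJ]

/-- The tube realization `φ ∘ g⁻¹`, where `h = g⁻¹`, with the same tube as `φ`. -/
def TubeRealization.compAut (R : TubeRealization ι a) (H : IsAutPair ι a g h) :
    TubeRealization ι a where
  r := R.r
  base := R.base
  isConnected_base := R.isConnected_base
  submanifold_base := R.submanifold_base
  toFun := R.toFun ∘ h
  isCRIsoOnto := R.isCRIsoOnto.comp_aut H

theorem TubeRealization.isPushforward_compAut (R : TubeRealization ι a) (H : IsAutPair ι a g h) :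
    IsPushforward a g R.translationAlgebra (R.compAut H).translationAlgebra := by
  rw [isPushforward_iff H]
  intro X Y hXY
  rw [R.germ_mem_iff, (R.compAut H).germ_mem_iff]
  refine exists_congr fun v => ?_
  have hcomp : ∀ᶠ p in 𝓝 a, dEmb (Fin R.r → ℂ) F (R.toFun ∘ h) p (Y p) =
      dEmb (Fin R.r → ℂ) F R.toFun (h p) (X (h p)) := by
    filter_upwards [hXY.symm H, eventually_mdifferentiableAt H.right.analytic,
      H.right.tendsto.eventually (eventually_mdifferentiableAt R.isCRIsoOnto.analytic)]
      with p hp hh hφ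
    rw [dEmb_comp hφ hh, hp]
  constructor
  · intro hX
    filter_upwards [hcomp, H.right.tendsto.eventually hX] with p hp hXp
    exact hp.trans hXp
  · intro hY
    filter_upwards [H.left.tendsto.eventually hcomp, H.left.tendsto.eventually hY, H.left_inv]
      with p hp hYp hinv
    rw [hinv] at hp
    exact hp.symm.trans hYp

theorem IsAutPair.eventually_mfderiv_conj (H : IsAutPair ι a g h)
    (hτ : IsInvolution ι a τ) :
    ∀ᶠ p in 𝓝 a, ∀ u : TangentSpace 𝓘(ℝ, F) p,
      mfderiv 𝓘(ℝ, F) 𝓘(ℝ, F) (g ∘ τ ∘ h) p u = mfderiv 𝓘(ℝ, F) 𝓘(ℝ, F) g (τ (h p))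
        (mfderiv 𝓘(ℝ, F) 𝓘(ℝ, F) τ (h p) (mfderiv 𝓘(ℝ, F) 𝓘(ℝ, F) h p u)) := by
  have hτ_at : ContMDiffAt 𝓘(ℝ, F) 𝓘(ℝ, F) ω τ (h a) := H.right.map_base.symm ▸ hτ.analytic
  have hτh : (τ ∘ h) a = a := (congrArg τ H.right.map_base).trans hτ.map_base
  filter_upwards [eventually_mfderiv_comp hτ_at H.right.analytic,
    eventually_mfderiv_comp (hτh.symm ▸ H.left.analytic) (hτ_at.comp a H.right.analytic)]
    with p hinner houter u
  rw [houter, hinner]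
  rfl

theorem IsInvolution.conj (H : IsAutPair ι a g h) (hτ : IsInvolution ι a τ) :
    IsInvolution ι a (g ∘ τ ∘ h) := by
  have hτh := hτ.tendsto.comp H.right.tendsto
  refine ⟨?_, ?_, ?_, ?_⟩
  · simp only [Function.comp_apply, H.right.map_base, hτ.map_base, H.left.map_base]
  · refine ContMDiffAt.comp_of_eq H.left.analytic
      (ContMDiffAt.comp_of_eq hτ.analytic H.right.analytic H.right.map_base) ?_
    simp only [Function.comp_apply, H.right.map_base, hτ.map_base]
  · filter_upwards [H.eventually_mfderiv_conj hτ, H.right.cr,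
      H.right.tendsto.eventually hτ.antiCR, hτh.eventually H.left.cr]
      with p hderiv hh hanti hg v w hvw
    have hJ := hg _ _ (hanti _ _ (hh v w hvw))
    rw [map_neg] at hJ
    rw [hderiv, hderiv]
    exact hJ
  · filter_upwards [H.right_inv, H.right.tendsto.eventually hτ.involutive,
      hτh.eventually H.left_inv] with p hgh hττ hhg
    simp only [Function.comp_apply] at hhg ⊢
    rw [hhg, hττ, hgh]

theorem IsInvolutionFor.conj (H : IsAutPair ι a g h) (hg : IsPushforward a g 𝔳 𝔳')
    (hτ : IsInvolutionFor ι a 𝔳 τ) : IsInvolutionFor ι a 𝔳' (g ∘ τ ∘ h) := by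
  refine ⟨hτ.1.conj H, fun Y hY => ?_⟩
  obtain ⟨X, hX, hXY⟩ := (hg Y).1 hY
  filter_upwards [H.eventually_mfderiv_conj hτ.1, Related.symm H hXY,
    H.right.tendsto.eventually (hτ.2 X hX), (hτ.1.tendsto.comp H.right.tendsto).eventually hXY]
    with p hderiv hYX hneg hgX
  rw [hderiv, hYX, hneg, map_neg]
  exact congrArg Neg.neg hgX

end Automorphisms

section Complexification

variable {κ κ' : Type*}

theorem rePi_smul (c : ℂ) (z : κ → ℂ) : rePi (c • z) = c.re • rePi z - c.im • imPi z := by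
  ext; simp

theorem imPi_smul (c : ℂ) (z : κ → ℂ) : imPi (c • z) = c.re • imPi z + c.im • rePi z := by
  ext; simp

/-- The complex linear extension of a real linear map. -/
def complexify (Q : (κ → ℝ) →ₗ[ℝ] κ' → ℝ) : (κ → ℂ) →ₗ[ℂ] κ' → ℂ where
  toFun z := ofRealPi (Q (rePi z)) + Complex.I • ofRealPi (Q (imPi z))
  map_add' z w := by
    simp only [map_add, smul_add]
    abel
  map_smul' c z := by
    refine ext_rePi_imPi ?_ ?_
    · simp [rePi_smul, imPi_smul, sub_eq_add_neg]
    · simp [rePi_smul, imPi_smul, add_comm]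

variable (Q : (κ → ℝ) →ₗ[ℝ] κ' → ℝ)

theorem complexify_apply (z : κ → ℂ) :
    complexify Q z = ofRealPi (Q (rePi z)) + Complex.I • ofRealPi (Q (imPi z)) := rfl

@[simp] theorem rePi_complexify (z : κ → ℂ) : rePi (complexify Q z) = Q (rePi z) := by
  simp [complexify_apply]

@[simp] theorem imPi_complexify (z : κ → ℂ) : imPi (complexify Q z) = Q (imPi z) := by
  simp [complexify_apply]

@[simp] theorem complexify_ofRealPi (v : κ → ℝ) : complexify Q (ofRealPi v) = ofRealPi (Q v) := by
  simp [complexify_apply]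

@[simp] theorem complexify_symm_complexify (Q : (κ → ℝ) ≃ₗ[ℝ] κ' → ℝ) (z : κ → ℂ) :
    complexify Q.symm.toLinearMap (complexify Q.toLinearMap z) = z :=
  ext_rePi_imPi (by simp) (by simp)

@[simp] theorem complexify_complexify_symm (Q : (κ → ℝ) ≃ₗ[ℝ] κ' → ℝ) (z : κ' → ℂ) :
    complexify Q.toLinearMap (complexify Q.symm.toLinearMap z) = z :=
  complexify_symm_complexify Q.symm z

theorem isUnit_toMatrix'_linearEquiv {R n : Type*} [CommRing R] [Fintype n] [DecidableEq n]
    (A : (n → R) ≃ₗ[R] n → R) : IsUnit (LinearMap.toMatrix' A.toLinearMap) := by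
  refine IsUnit.of_mul_eq_one (LinearMap.toMatrix' A.symm.toLinearMap) ?_
  rw [← LinearMap.toMatrix'_comp, A.comp_symm, LinearMap.toMatrix'_id]

theorem exists_linearEquiv_eq_rePi_add_smul_imPi [Finite κ] (A : (κ → ℂ) ≃ₗ[ℂ] κ → ℂ) :
    ∃ (s : ℝ) (Q : (κ → ℝ) ≃ₗ[ℝ] κ → ℝ), ∀ v,
      Q v = rePi (A (ofRealPi v)) + s • imPi (A (ofRealPi v)) := by
  have := Fintype.ofFinite κ
  classical
  set P := LinearMap.toMatrix' A.toLinearMap with hP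
  have hPsplit : (P.map Complex.re).map (algebraMap ℝ ℂ) +
      Complex.I • (P.map Complex.im).map (algebraMap ℝ ℂ) = P := by
    ext i j
    simp [mul_comm Complex.I]
  obtain ⟨s, hs⟩ := exists_isUnit_add_smul (A := P.map Complex.re) (B := P.map Complex.im)
    (z := Complex.I) (by rw [hPsplit]; exact isUnit_toMatrix'_linearEquiv A)
  refine ⟨s, Matrix.toLinearEquiv' _ hs.invertible, fun v => ?_⟩
  have hA : ∀ z, A z = P.mulVec z := fun z => by
    rw [hP, ← Matrix.toLin'_apply, Matrix.toLin'_toMatrix']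
    rfl
  ext k
  change ((P.map Complex.re + s • P.map Complex.im).mulVec v) k = _
  simp [hA, Matrix.mulVec, dotProduct, add_mul, Finset.sum_add_distrib, Finset.mul_sum, mul_assoc]

end Complexification

section TubeMaps

variable {r : ℕ} {B B' : Set (Fin r → ℝ)}

-- If `Q = re A + s im A` on real vectors, then `im (A ((s + i) y)) = Q y`. Translating `z - c` by a
-- real vector, which preserves the tube, turns it into `(s + i) im (z - c)`.
theorem exists_real_affine_of_affineEquiv (l : (Fin r → ℂ) ≃ᵃ[ℂ] Fin r → ℂ)
    {c : Fin r → ℂ} (h : ∀ᶠ z in 𝓝 c, z ∈ tube B ↔ l z ∈ tube B') :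
    ∃ Q : (Fin r → ℝ) ≃ₗ[ℝ] Fin r → ℝ,
      ∀ᶠ z in 𝓝 c, z ∈ tube B ↔ l c + complexify Q.toLinearMap (z - c) ∈ tube B' := by
  obtain ⟨s, Q, hQ⟩ := exists_linearEquiv_eq_rePi_add_smul_imPi l.linear
  refine ⟨Q, ?_⟩
  let S : (Fin r → ℂ) → Fin r → ℂ := fun z =>
    z + ofRealPi (s • imPi (z - c) - rePi (z - c))
  have hS : Tendsto S (𝓝 c) (𝓝 c) := Continuous.tendsto' (by fun_prop) _ _ (by simp [S])
  have hSz : ∀ z, S z - c = ((s : ℂ) + Complex.I) • ofRealPi (imPi (z - c)) := fun z =>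
    ext_rePi_imPi (by simp [S, rePi_smul]; abel) (by simp [S, imPi_smul])
  have hlS : ∀ z, l (S z) = l c + l.linear (S z - c) := fun z => by
    simpa [add_comm] using l.map_vadd c (S z - c)
  filter_upwards [hS.eventually h] with z hz
  rw [← add_ofRealPi_mem_tube_iff, hz, mem_tube_iff, mem_tube_iff, hlS, hSz, map_smul]
  suffices him : imPi (((s : ℂ) + Complex.I) • l.linear (ofRealPi (imPi (z - c)))) =
      Q (imPi (z - c)) by
    rw [map_add, map_add, him, imPi_complexify, LinearEquiv.coe_coe]
  rw [hQ, imPi_smul, add_comm]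
  simp

end TubeMaps

section AffineEquivalence

variable {E : Type*} [NormedAddCommGroup E] [NormedSpace ℂ E]
  {Z : Type*} [TopologicalSpace Z] [ChartedSpace E Z]
  {F : Type*} [NormedAddCommGroup F] [NormedSpace ℝ F]
  {M : Type*} [TopologicalSpace M] [ChartedSpace F M]
  {ι : GenericEmbedding E Z F M} {a : M}

theorem TubeRealization.equivalence_affinelyEquivalent :
    Equivalence (TubeRealization.AffinelyEquivalent (ι := ι) (a := a)) where
  refl R := ⟨AffineEquiv.refl ℂ _, rfl, Eventually.of_forall fun _ => Iff.rfl⟩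
  symm := by
    rintro R R' ⟨l, hl, hmem⟩
    have hl' : l.symm (R'.toFun a) = R.toFun a := by rw [← hl, l.symm_apply_apply]
    have hsymm : Tendsto l.symm (𝓝 (R'.toFun a)) (𝓝 (R.toFun a)) :=
      l.symm.toAffineMap.continuous_of_finiteDimensional.tendsto' _ _ hl'
    refine ⟨l.symm, hl', ?_⟩
    filter_upwards [hsymm.eventually hmem] with z hz
    rw [hz, l.apply_symm_apply]
  trans := by
    rintro R R' R'' ⟨l, hl, hmem⟩ ⟨l', hl', hmem'⟩
    have hl_tendsto : Tendsto l (𝓝 (R.toFun a)) (𝓝 (R'.toFun a)) :=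
      l.toAffineMap.continuous_of_finiteDimensional.tendsto' _ _ hl
    refine ⟨l.trans l', by simp [hl, hl'], ?_⟩
    filter_upwards [hmem, hl_tendsto.eventually hmem'] with z hz hlz
    exact hz.trans hlz

theorem linearMap_eq_of_frequently_apply_smul_eq {𝕜 V W : Type*} [NontriviallyNormedField 𝕜]
    [AddCommGroup V] [Module 𝕜 V] [AddCommGroup W] [Module 𝕜 W] {A A' : V →ₗ[𝕜] W} {v : V}
    (h : ∃ᶠ t in 𝓝[≠] (0 : 𝕜), A (t • v) = A' (t • v)) : A v = A' v := by
  obtain ⟨t, ht, ht0⟩ := (h.and_eventually self_mem_nhdsWithin).exists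
  rw [map_smul, map_smul] at ht
  exact smul_right_injective W ht0 ht

theorem IsCRIsoOnto.eventually_of_eventually_apply {r : ℕ} {φ : M → Fin r → ℂ}
    {T : Set (Fin r → ℂ)} (H : IsCRIsoOnto ι a φ T) {P : (Fin r → ℂ) → Prop}
    (h : ∀ᶠ p in 𝓝 a, P (φ p)) : ∀ᶠ z in 𝓝[T] (φ a), P z := by
  obtain ⟨ψ, hψ⟩ := H.exists_isInverseGerm
  filter_upwards [hψ.right_inv, nhdsWithin_le_nhds (hψ.tendsto.eventually h)] with z hz hψz
  rwa [hz] at hψz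

theorem TubeRealization.linearMap_ext (R : TubeRealization ι a) {V : Type*} [AddCommGroup V]
    [Module ℂ V] {A A' : (Fin R.r → ℂ) →ₗ[ℂ] V}
    (h : ∀ᶠ p in 𝓝 a, A (R.toFun p - R.toFun a) = A' (R.toFun p - R.toFun a)) : A = A' := by
  have htube : ∀ᶠ z in 𝓝[tube R.base] (R.toFun a), A (z - R.toFun a) = A' (z - R.toFun a) :=
    R.isCRIsoOnto.eventually_of_eventually_apply h
  have hreal : ∀ v, A (ofRealPi v) = A' (ofRealPi v) := fun v => by
    have hline : Tendsto (fun t : ℝ => R.toFun a + t • ofRealPi v) (𝓝[≠] 0)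
        (𝓝[tube R.base] (R.toFun a)) := by
      refine tendsto_nhdsWithin_iff.2 ⟨(Continuous.tendsto' (by fun_prop) _ _ (by simp)).mono_left
        nhdsWithin_le_nhds, Eventually.of_forall fun t => ?_⟩
      rw [← map_smul, add_ofRealPi_mem_tube_iff]
      exact R.isCRIsoOnto.mapsTo.self_of_nhds
    refine linearMap_eq_of_frequently_apply_smul_eq (A := A.restrictScalars ℝ)
      (A' := A'.restrictScalars ℝ) (Eventually.frequently ?_)
    filter_upwards [hline.eventually htube] with t ht
    rwa [add_sub_cancel_left] at ht
  refine LinearMap.ext fun z => ?_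
  rw [← ofRealPi_rePi_add_I_smul_ofRealPi_imPi z, map_add, map_add, map_smul, map_smul, hreal,
    hreal]

theorem hasFDerivAt_add_linearMap_sub {V W : Type*} [NormedAddCommGroup V] [NormedSpace ℂ V]
    [FiniteDimensional ℂ V] [NormedAddCommGroup W] [NormedSpace ℂ W] (A : V →ₗ[ℂ] W) (c z : V)
    (c' : W) : HasFDerivAt (fun z => c' + A (z - c))
      ((LinearMap.toContinuousLinearMap A).restrictScalars ℝ) z :=
  (((LinearMap.toContinuousLinearMap A).restrictScalars ℝ).hasFDerivAt.comp z
    ((hasFDerivAt_id z).sub_const c)).const_add c'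

variable [IsManifold 𝓘(ℝ, F) ω M]

theorem TubeRealization.exists_isCRGerm_lift (R R' : TubeRealization ι a)
    {Q : (Fin R.r → ℝ) →ₗ[ℝ] Fin R'.r → ℝ}
    (h : ∀ᶠ z in 𝓝[tube R.base] (R.toFun a),
      R'.toFun a + complexify Q (z - R.toFun a) ∈ tube R'.base) :
    ∃ g : M → M, IsCRGerm ι a g ∧
      (∀ᶠ p in 𝓝 a, R'.toFun (g p) = R'.toFun a + complexify Q (R.toFun p - R.toFun a)) ∧
      ∀ᶠ p in 𝓝 a, ∀ u : TangentSpace 𝓘(ℝ, F) p,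
        dEmb (Fin R'.r → ℂ) F R'.toFun (g p) (mfderiv 𝓘(ℝ, F) 𝓘(ℝ, F) g p u) =
          complexify Q (dEmb (Fin R.r → ℂ) F R.toFun p u) := by
  have hS : ContDiff ℝ ω (fun z => R'.toFun a + complexify Q (z - R.toFun a)) :=
    contDiff_const.add
      (((LinearMap.toContinuousLinearMap (complexify Q)).restrictScalars ℝ).contDiff.comp
        (contDiff_id.sub contDiff_const))
  obtain ⟨g, hga, hg, hgφ⟩ := R.isCRIsoOnto.exists_lift R'.isCRIsoOnto hS.contDiffAt (by simp) h
  have hgd : ∀ᶠ p in 𝓝 a, ∀ u : TangentSpace 𝓘(ℝ, F) p,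
      dEmb (Fin R'.r → ℂ) F R'.toFun (g p) (mfderiv 𝓘(ℝ, F) 𝓘(ℝ, F) g p u) =
        complexify Q (dEmb (Fin R.r → ℂ) F R.toFun p u) :=
    eventually_dEmb_lift R.isCRIsoOnto.analytic R'.isCRIsoOnto.analytic hga hg
      (fun z => hasFDerivAt_add_linearMap_sub (complexify Q) (R.toFun a) z (R'.toFun a)) hgφ
  refine ⟨g, ⟨hga, hg, ?_⟩, hgφ, hgd⟩
  filter_upwards [hgd, R.isCRIsoOnto.cr,
    (tendsto_nhds_of_map_eq hg.continuousAt hga).eventually R'.isCRIsoOnto.cr]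
    with p hp hcr hcr' v w hvw
  rw [hcr', hp, hp, (hcr v w).1 hvw, map_smul]

omit [IsManifold 𝓘(ℝ, F) ω M] in
theorem TubeRealization.isAutPair_of_lifts {R R' : TubeRealization ι a} {g h : M → M}
    (hg : IsCRGerm ι a g) (hh : IsCRGerm ι a h) {Q : (Fin R.r → ℝ) ≃ₗ[ℝ] Fin R'.r → ℝ}
    (hgφ : ∀ᶠ p in 𝓝 a,
      R'.toFun (g p) = R'.toFun a + complexify Q.toLinearMap (R.toFun p - R.toFun a))
    (hhφ : ∀ᶠ p in 𝓝 a,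
      R.toFun (h p) = R.toFun a + complexify Q.symm.toLinearMap (R'.toFun p - R'.toFun a)) :
    IsAutPair ι a g h := by
  refine ⟨hg, hh, ?_, ?_⟩
  · refine R.isCRIsoOnto.eventually_eq (hh.tendsto.comp hg.tendsto) tendsto_id ?_
    filter_upwards [hgφ, hg.tendsto.eventually hhφ] with p hp hhp
    rw [hhp, hp, add_sub_cancel_left, complexify_symm_complexify, add_sub_cancel]
  · refine R'.isCRIsoOnto.eventually_eq (hg.tendsto.comp hh.tendsto) tendsto_id ?_
    filter_upwards [hhφ, hh.tendsto.eventually hgφ] with p hp hgp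
    rw [hgp, hp, add_sub_cancel_left, complexify_complexify_symm, add_sub_cancel]

theorem TubeRealization.isPushforward_of_dEmb_eq {R R' : TubeRealization ι a} {g h : M → M}
    (H : IsAutPair ι a g h) {Q : (Fin R.r → ℝ) ≃ₗ[ℝ] Fin R'.r → ℝ}
    (hgd : ∀ᶠ p in 𝓝 a, ∀ u : TangentSpace 𝓘(ℝ, F) p,
      dEmb (Fin R'.r → ℂ) F R'.toFun (g p) (mfderiv 𝓘(ℝ, F) 𝓘(ℝ, F) g p u) =
        complexify Q.toLinearMap (dEmb (Fin R.r → ℂ) F R.toFun p u)) :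
    IsPushforward a g R.translationAlgebra R'.translationAlgebra := by
  refine (isPushforward_iff H).2 fun X Y hXY => ?_
  rw [R.germ_mem_iff, R'.germ_mem_iff]
  constructor
  · rintro ⟨v, hv⟩
    refine ⟨Q v, ?_⟩
    have hY : ∀ᶠ p in 𝓝 a,
        dEmb (Fin R'.r → ℂ) F R'.toFun (g p) (Y (g p)) = ofRealPi (Q v) := by
      filter_upwards [hXY, hgd, hv] with p hXYp hgdp hvp
      rw [← hXYp, hgdp, hvp, complexify_ofRealPi, LinearEquiv.coe_coe]
    filter_upwards [H.right.tendsto.eventually hY, H.right_inv] with p hYp hgh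
    rwa [hgh] at hYp
  · rintro ⟨w, hw⟩
    refine ⟨Q.symm w, ?_⟩
    filter_upwards [hXY, hgd, H.left.tendsto.eventually hw] with p hXYp hgdp hwp
    rw [← complexify_symm_complexify Q (dEmb (Fin R.r → ℂ) F R.toFun p (X p)), ← hgdp, hXYp, hwp,
      complexify_ofRealPi, LinearEquiv.coe_coe]

theorem TubeRealization.exists_conjugation (R R' : TubeRealization ι a)
    {Q : (Fin R.r → ℝ) ≃ₗ[ℝ] Fin R'.r → ℝ}
    (h : ∀ᶠ z in 𝓝 (R.toFun a), z ∈ tube R.base ↔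
      R'.toFun a + complexify Q.toLinearMap (z - R.toFun a) ∈ tube R'.base) :
    ∃ g, IsAut ι a g ∧ IsPushforward a g R.translationAlgebra R'.translationAlgebra := by
  have hinv : Tendsto (fun z => R.toFun a + complexify Q.symm.toLinearMap (z - R'.toFun a))
      (𝓝 (R'.toFun a)) (𝓝 (R.toFun a)) :=
    (hasFDerivAt_add_linearMap_sub _ _ _ _).continuousAt.tendsto.trans (by simp)
  obtain ⟨g, hg, hgφ, hgd⟩ := R.exists_isCRGerm_lift R' (Q := Q.toLinearMap)
    (eventually_nhdsWithin_iff.2 (h.mono fun _ hz => hz.1))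
  obtain ⟨k, hk, hkφ, -⟩ := R'.exists_isCRGerm_lift R (Q := Q.symm.toLinearMap) <| by
    filter_upwards [nhdsWithin_le_nhds (hinv.eventually h), self_mem_nhdsWithin] with z hz hzB
    rwa [hz, add_sub_cancel_left, complexify_complexify_symm, add_sub_cancel]
  have H : IsAutPair ι a g k := isAutPair_of_lifts hg hk hgφ hkφ
  exact ⟨g, ⟨k, H⟩, isPushforward_of_dEmb_eq H hgd⟩

theorem TubeRealization.r_eq_finrank (R : TubeRealization ι a) : R.r = Module.finrank ℂ E :=
  R.isCRIsoOnto.eventually_isTubeFrame.self_of_nhds.finrank_eq.symm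

theorem TubeRealization.AffinelyEquivalent.exists_conjugation {R R' : TubeRealization ι a}
    (h : R.AffinelyEquivalent R') :
    ∃ g, IsAut ι a g ∧ IsPushforward a g R.translationAlgebra R'.translationAlgebra := by
  have hr : R.r = R'.r := R.r_eq_finrank.trans R'.r_eq_finrank.symm
  obtain ⟨r, B, hB, hB', φ, H⟩ := R
  obtain ⟨r', B₁, hB₁, hB₁', φ₁, H₁⟩ := R'
  obtain rfl : r = r' := hr
  obtain ⟨l, hl, hmem⟩ := h
  obtain ⟨Q, hQ⟩ := exists_real_affine_of_affineEquiv l hmem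
  rw [hl] at hQ
  exact TubeRealization.exists_conjugation _ _ hQ

theorem IsCRIsoOnto.eventually_eq_add_linearCombination {r : ℕ} {φ : M → Fin r → ℂ}
    {B : Set (Fin r → ℝ)} (H : IsCRIsoOnto ι a φ (tube B)) {V : Type*} [NormedAddCommGroup V]
    [NormedSpace ℂ V] {f : M → V} (hf : ∀ᶠ p in 𝓝 a, MDifferentiableAt 𝓘(ℝ, F) 𝓘(ℝ, V) f p)
    (hcr : ∀ᶠ p in 𝓝 a, ∀ v w, IsJ ι p v w → dEmb V F f p w = Complex.I • dEmb V F f p v)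
    {X : Fin r → ∀ p : M, TangentSpace 𝓘(ℝ, F) p}
    (hX : ∀ k, ∀ᶠ p in 𝓝 a, dEmb (Fin r → ℂ) F φ p (X k p) = ofRealPi (Pi.single k 1))
    {w : Fin r → V} (hw : ∀ k, ∀ᶠ p in 𝓝 a, dEmb V F f p (X k p) = w k) :
    ∀ᶠ p in 𝓝 a, f p = f a + Fintype.linearCombination ℂ w (φ p - φ a) := by
  have hS := hasFDerivAt_add_linearMap_sub (Fintype.linearCombination ℂ w) (φ a) (c' := f a)
  refine eventually_eq_of_dEmb_eq (F := F)
    (f' := (fun z => f a + Fintype.linearCombination ℂ w (z - φ a)) ∘ φ) hf ?_ ?_ (by simp)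
  · filter_upwards [H.eventually_isTubeFrame] with p hp
    exact (hS _).differentiableAt.mdifferentiableAt.comp p hp.mdiff
  · filter_upwards [hcr, H.eventually_isTubeFrame, eventually_all.2 hX, eventually_all.2 hw]
      with p hcrp hp hXp hwp u
    rw [dEmb_comp_left (hS _).differentiableAt hp.mdiff, (hS _).fderiv]
    refine (hp.apply_eq_linearCombination (Q := (dEmb V F f p : TangentSpace 𝓘(ℝ, F) p →ₗ[ℝ] V))
      hcrp hXp u).trans ?_
    exact congrArg (fun w' => Fintype.linearCombination ℂ w' (dEmb (Fin r → ℂ) F φ p u))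
      (funext hwp)

theorem TubeRealization.exists_dEmb_comp_eq (R R' : TubeRealization ι a) {g h : M → M}
    (H : IsAutPair ι a g h) (hg : IsPushforward a g R.translationAlgebra R'.translationAlgebra)
    (v : Fin R.r → ℝ) :
    ∃ (X : ∀ p : M, TangentSpace 𝓘(ℝ, F) p) (w : Fin R'.r → ℝ),
      (∀ᶠ p in 𝓝 a, dEmb (Fin R.r → ℂ) F R.toFun p (X p) = ofRealPi v) ∧
      ∀ᶠ p in 𝓝 a, dEmb (Fin R'.r → ℂ) F (R'.toFun ∘ g) p (X p) = ofRealPi w := by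
  obtain ⟨X, hX, hXv⟩ := R.exists_eventually_dEmb_eq v
  obtain ⟨Y, hXY⟩ := H.exists_related X
  obtain ⟨w, hw⟩ := R'.germ_mem_iff.1 (((isPushforward_iff H).1 hg X Y hXY).1 hX)
  refine ⟨X, w, hXv, ?_⟩
  filter_upwards [hXY, H.left.tendsto.eventually hw,
    H.left.tendsto.eventually (eventually_mdifferentiableAt R'.isCRIsoOnto.analytic),
    eventually_mdifferentiableAt H.left.analytic] with p hXYp hwp hφ' hgp
  rw [dEmb_comp hφ' hgp, hXYp, hwp]

theorem TubeRealization.exists_affine_of_isPushforward (R R' : TubeRealization ι a) {g h : M → M}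
    (H : IsAutPair ι a g h)
    (hg : IsPushforward a g R.translationAlgebra R'.translationAlgebra) :
    ∃ A : (Fin R.r → ℂ) →ₗ[ℂ] Fin R'.r → ℂ,
      ∀ᶠ p in 𝓝 a, R'.toFun (g p) = R'.toFun a + A (R.toFun p - R.toFun a) := by
  choose X w hX hXw using fun k : Fin R.r => R.exists_dEmb_comp_eq R' H hg (Pi.single k 1)
  have hφ' := H.left.tendsto.eventually (eventually_mdifferentiableAt R'.isCRIsoOnto.analytic)
  have hgd := eventually_mdifferentiableAt H.left.analytic
  have hcr : ∀ᶠ p in 𝓝 a, ∀ v w, IsJ ι p v w → dEmb (Fin R'.r → ℂ) F (R'.toFun ∘ g) p w =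
      Complex.I • dEmb (Fin R'.r → ℂ) F (R'.toFun ∘ g) p v := by
    filter_upwards [hφ', hgd, H.left.cr, H.left.tendsto.eventually R'.isCRIsoOnto.cr]
      with p hφ'p hgp hcr hcr' v w hvw
    rw [dEmb_comp hφ'p hgp, dEmb_comp hφ'p hgp]
    exact (hcr' _ _).1 (hcr v w hvw)
  have haffine := R.isCRIsoOnto.eventually_eq_add_linearCombination
    (f := R'.toFun ∘ g) ((hφ'.and hgd).mono fun p hp => hp.1.comp p hp.2) hcr hX hXw
  rw [Function.comp_apply, H.left.map_base] at haffine
  exact ⟨_, haffine⟩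

section AffineAutomorphism

variable {R R' : TubeRealization ι a} {g h : M → M} {A : (Fin R.r → ℂ) →ₗ[ℂ] Fin R'.r → ℂ}
  {A' : (Fin R'.r → ℂ) →ₗ[ℂ] Fin R.r → ℂ}

omit [IsManifold 𝓘(ℝ, F) ω M] in
theorem TubeRealization.comp_eq_id_of_isAutPair (H : IsAutPair ι a g h)
    (hA : ∀ᶠ p in 𝓝 a, R'.toFun (g p) = R'.toFun a + A (R.toFun p - R.toFun a))
    (hA' : ∀ᶠ p in 𝓝 a, R.toFun (h p) = R.toFun a + A' (R'.toFun p - R'.toFun a)) :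
    A' ∘ₗ A = LinearMap.id := by
  refine R.linearMap_ext ?_
  filter_upwards [hA, H.left.tendsto.eventually hA', H.left_inv] with p hp hgp hhg
  rw [hhg, hp, add_sub_cancel_left] at hgp
  exact (sub_eq_iff_eq_add'.2 hgp).symm

omit [IsManifold 𝓘(ℝ, F) ω M] in
theorem TubeRealization.eventually_affine_mem_tube (hg : IsCRGerm ι a g)
    (hA : ∀ᶠ p in 𝓝 a, R'.toFun (g p) = R'.toFun a + A (R.toFun p - R.toFun a)) :
    ∀ᶠ z in 𝓝 (R.toFun a), z ∈ tube R.base → R'.toFun a + A (z - R.toFun a) ∈ tube R'.base := by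
  refine eventually_nhdsWithin_iff.1 (R.isCRIsoOnto.eventually_of_eventually_apply ?_)
  filter_upwards [hA, hg.tendsto.eventually R'.isCRIsoOnto.mapsTo] with p hp hgp
  rwa [← hp]

end AffineAutomorphism

theorem TubeRealization.affinelyEquivalent_of_isPushforward {R R' : TubeRealization ι a}
    {g : M → M} (hgaut : IsAut ι a g)
    (hg : IsPushforward a g R.translationAlgebra R'.translationAlgebra) :
    R.AffinelyEquivalent R' := by
  obtain ⟨h, H⟩ := hgaut
  obtain ⟨A, hA⟩ := R.exists_affine_of_isPushforward R' H hg
  obtain ⟨A', hA'⟩ := R'.exists_affine_of_isPushforward R H.symm (hg.symm H)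
  have hA'A : A' ∘ₗ A = LinearMap.id := comp_eq_id_of_isAutPair H hA hA'
  have hAA' : A ∘ₗ A' = LinearMap.id := comp_eq_id_of_isAutPair H.symm hA' hA
  let l : (Fin R.r → ℂ) ≃ᵃ[ℂ] Fin R'.r → ℂ :=
    AffineEquiv.mk' (fun z => R'.toFun a + A (z - R.toFun a))
      (LinearEquiv.ofLinearMap A A' hAA' hA'A) (R.toFun a) fun z => by simp [add_comm]
  have hl : ∀ z, l z = R'.toFun a + A (z - R.toFun a) := fun _ => rfl
  have hla : l (R.toFun a) = R'.toFun a := by rw [hl, sub_self, map_zero, add_zero]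
  have hl_tendsto : Tendsto l (𝓝 (R.toFun a)) (𝓝 (R'.toFun a)) :=
    l.toAffineMap.continuous_of_finiteDimensional.tendsto' _ _ hla
  refine ⟨l, hla, ?_⟩
  filter_upwards [eventually_affine_mem_tube H.left hA,
    hl_tendsto.eventually (eventually_affine_mem_tube H.right hA')] with z hz hlz
  have hA'l : R.toFun a + A' (l z - R'.toFun a) = z := by
    rw [hl, add_sub_cancel_left, ← LinearMap.comp_apply, hA'A, LinearMap.id_apply, add_sub_cancel]
  rw [hA'l] at hlz
  exact ⟨hz, hlz⟩

end AffineEquivalence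

section Correspondence

variable {E : Type*} [NormedAddCommGroup E] [NormedSpace ℂ E]
  {Z : Type*} [TopologicalSpace Z] [ChartedSpace E Z]
  {F : Type*} [NormedAddCommGroup F] [NormedSpace ℝ F]
  {M : Type*} [TopologicalSpace M] [ChartedSpace F M] [IsManifold 𝓘(ℝ, F) ω M]
  {ι : GenericEmbedding E Z F M} {a : M}

/-- The map on classes induced by `φ ↦ {φ^*(v ∂/∂z) : v ∈ ℝ^r}`, from tube realizations modulo
affine equivalence to tube subalgebras modulo conjugacy. -/
def conjugacyClass [CompleteSpace F] :
    Quot (TubeRealization.AffinelyEquivalent (ι := ι) (a := a)) →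
      Quot (TubeSubalgebra.Conjugate (ι := ι) (a := a)) :=
  Quot.map (fun R => ⟨R.translationAlgebra, R.isTubeSubalgebra⟩) fun _ _ h => h.exists_conjugation

theorem conjugacyClass_injective [CompleteSpace F] :
    Function.Injective (conjugacyClass (ι := ι) (a := a)) := by
  rintro ⟨R⟩ ⟨R'⟩ h
  obtain ⟨g, hgaut, hg⟩ :=
    TubeSubalgebra.equivalence_conjugate.eqvGen_iff.1 (Quot.eqvGen_exact h)
  exact Quot.sound (TubeRealization.affinelyEquivalent_of_isPushforward hgaut hg)

theorem conjugacyClass_surjective [FiniteDimensional ℂ E] [IsManifold 𝓘(ℂ, E) ω Z]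
    [FiniteDimensional ℝ F] [CompleteSpace F] :
    Function.Surjective (conjugacyClass (ι := ι) (a := a)) := by
  rintro ⟨𝔳, h𝔳⟩
  obtain ⟨τ, hτ⟩ := h𝔳.exists_involution
  obtain ⟨R, rfl⟩ := h𝔳.isAbelianSubalgebra.exists_tubeRealization h𝔳.spans
    (isTotallyReal_of_isInvolutionFor hτ)
  exact ⟨Quot.mk _ R, rfl⟩

end Correspondence

end CRTube

end

theorem mainTheorem3
    {E : Type*} [NormedAddCommGroup E] [NormedSpace ℂ E] [FiniteDimensional ℂ E]
    {Z : Type*} [TopologicalSpace Z] [T2Space Z] [ChartedSpace E Z] [IsManifold 𝓘(ℂ, E) ω Z]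
    {F : Type*} [NormedAddCommGroup F] [NormedSpace ℝ F] [FiniteDimensional ℝ F]
    {M : Type*} [TopologicalSpace M] [T2Space M] [ChartedSpace F M] [IsManifold 𝓘(ℝ, F) ω M]
    (ι : CRTube.GenericEmbedding E Z F M) (a : M) :
    -- the correspondence between classes of tube realizations and classes of subalgebras
    (Equivalence (CRTube.TubeRealization.AffinelyEquivalent (ι := ι) (a := a)) ∧
      Equivalence (CRTube.TubeSubalgebra.Conjugate (ι := ι) (a := a)) ∧
      ∃ C : Quot (CRTube.TubeRealization.AffinelyEquivalent (ι := ι) (a := a)) ≃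
          Quot (CRTube.TubeSubalgebra.Conjugate (ι := ι) (a := a)),
        ∀ R : CRTube.TubeRealization ι a,
          ∃ h : CRTube.IsTubeSubalgebra ι a R.translationAlgebra,
            C (Quot.mk _ R) = Quot.mk _ ⟨R.translationAlgebra, h⟩) ∧
    -- (i') replaces (i)
    (∀ 𝔳 : Submodule ℝ (CRTube.VFGerm F a),
      CRTube.IsAbelianSubalgebra ι a 𝔳 → CRTube.SpansTangent ι a 𝔳 →
        (CRTube.IsTotallyReal ι a 𝔳 ↔ ∃ τ, CRTube.IsInvolutionFor ι a 𝔳 τ)) ∧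
    -- the involution: uniqueness, dimension of its fixed point set, behaviour under conjugation
    (∀ 𝔳 : Submodule ℝ (CRTube.VFGerm F a),
      CRTube.IsAbelianSubalgebra ι a 𝔳 → CRTube.SpansTangent ι a 𝔳 →
      ∀ τ : M → M, CRTube.IsInvolutionFor ι a 𝔳 τ →
        (∀ τ' : M → M, CRTube.IsInvolutionFor ι a 𝔳 τ' → τ' =ᶠ[𝓝 a] τ) ∧
        CRTube.IsAnalyticSubmanifoldAt F {p : M | τ p = p} (CRTube.crDim ι a) a ∧
        Module.finrank ℝ (CRTube.negTangent F a τ) = Module.finrank ℂ E ∧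
        ∀ (g h : M → M) (𝔳' : Submodule ℝ (CRTube.VFGerm F a)),
          CRTube.IsAutPair ι a g h → CRTube.IsPushforward a g 𝔳 𝔳' →
            CRTube.IsAbelianSubalgebra ι a 𝔳' ∧ CRTube.SpansTangent ι a 𝔳' ∧
            CRTube.IsInvolutionFor ι a 𝔳' (g ∘ τ ∘ h) ∧
            ∀ τ' : M → M, CRTube.IsInvolutionFor ι a 𝔳' τ' → τ' =ᶠ[𝓝 a] g ∘ τ ∘ h) := by
  have : CompleteSpace F := FiniteDimensional.complete ℝ F
  refine ⟨⟨CRTube.TubeRealization.equivalence_affinelyEquivalent,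
      CRTube.TubeSubalgebra.equivalence_conjugate,
      Equiv.ofBijective CRTube.conjugacyClass
        ⟨CRTube.conjugacyClass_injective, CRTube.conjugacyClass_surjective⟩,
      fun R => ⟨R.isTubeSubalgebra, rfl⟩⟩,
    fun 𝔳 h𝔳 hspan => h𝔳.isTotallyReal_iff hspan, fun 𝔳 h𝔳 hspan τ hτ => ?_⟩
  obtain ⟨R, rfl⟩ :=
    h𝔳.exists_tubeRealization hspan (CRTube.isTotallyReal_of_isInvolutionFor hτ)
  refine ⟨fun τ' hτ' => R.involution_unique hτ hτ', R.isAnalyticSubmanifoldAt_fixed hτ,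
    R.finrank_negTangent hτ, fun g h 𝔳' H hg => ?_⟩
  obtain rfl := hg.unique (R.isPushforward_compAut H)
  have hconj := hτ.conj H hg
  exact ⟨(R.compAut H).isTubeSubalgebra.isAbelianSubalgebra, (R.compAut H).isTubeSubalgebra.spans,
    hconj, fun τ' hτ' => (R.compAut H).involution_unique hconj hτ'⟩
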